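/- \textbf{Conventions.} All manifolds, maps and forms are $C^\infty$ unless stated otherwise; a closed manifold is a compact manifold without boundary (not necessarily connected). A closed $2$-form has integral periods if its integral over every smooth integral singular $2$-cycle is an integer. \textbf{Hyperplane sections.} Let $(V,\omega)$ be a closed symplectic manifold of dimension $2n+2$ ($n\ge 0$) such that $\omega$ has integral periods. A symplectic hyperplane section of degree $k\ge 1$ in $(V,\omega)$ is a closed embedded submanifold $W\subset V$ of codimension $2$ such that $\omega|_W$ is symplectic and such that the homology class of $W$ (oriented by $\omega|_W$) is Poincar\'e dual to $k[\omega]$: $\int_W\beta=k\int_V\omega\wedge\beta$ for every closed $2n$-form $\beta$ on $V$. \textbf{Liouville domains.} A Liouville domain $(F,\lambda)$ is a compact manifold $F$ with boundary together with a $1$-form $\lambda$ such that $d\lambda$ is symplectic on $F$ and the Liouville vector field $Y$, defined by $Y\lrcorner\, d\lambda=\lambda$, points transversely outwards along $\partial F$. Its skeleton $\mathrm{Sk}(F,\lambda)$ is the union of all orbits of $Y$ which do not exit through $\partial F$. \textbf{Liouville compactifications.} A Liouville compactification of $V-W$ is a Liouville domain $(F,\lambda)$ with a continuous map $q:F\to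 V$ such that: \begin{itemize} \item $q$ restricts to a principal $\mathrm U(1)$-bundle $p:K:=\partial F\to W$, and $-2k\pi i\,\lambda$ induces a unitary connection form on $K$ with curvature form $-2k\pi i\,\omega|_W$; \item $q$ restricts to a diffeomorphism $F-\partial F\to V-W$, with $q^*\omega=d\lambda$ there; \item $K$ is the normal circle bundle of $W$ and $V$ is the smooth manifold obtained from $F$ by collapsing the fibres of $K\to W$: if $\phi_t(x)$ ($t\le 0$ small) denotes the orbit of $Y$ with $\phi_0(x)=x\in K$, then the map $(x,re^{i\theta})\mapsto q\bigl(\phi_{\log(1-r^2)}(e^{i\theta}x)\bigr)$, defined on $K\times\{|z|<\delta\}$ for some $\delta>0$, is smooth at the points of $K\times\{0\}$, and for every $x\in K$ its derivative in the direction of $\mathbb C$ at $(x,0)$ induces an isomorphism of $\mathbb C$ onto the normal space $T_{p(x)}V/T_{p(x)}W$. \end{itemize} \textbf{Standard symplectic disk bundles.} Let $(W,\omega_W)$ be a closed symplectic manifold such that $\omega_W$ and $\frac1k\omega_W$ have integral periods. Let $p:K\to W$ be a principal $\mathrm U(1)$-bundle with a connection form $-2\pi i\alpha$ such that $d\alpha=p^*\omega_W$.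 In $\{s\alpha_x : x\in K,\ 0<s\le 1\}\simeq K\times(0,1]$, contained in the symplectization of $(K,\ker\alpha)$ and equipped with the canonical $1$-form $s\alpha$, collapse each circle fibre of the level $s=1$ to a point. With $s=1-|z|^2$ the quotient is the associated open disk bundle $U=K\times_{\mathrm U(1)}\{|z|<1\}$, with its smooth structure; $d(s\alpha)$ extends to a symplectic form $\omega_U$ on $U$ with $\omega_U|_W=\omega_W$ on the zero section $W$. Any symplectic manifold symplectomorphic to $(U,\frac1k\omega_U)$ is called a standard symplectic disk bundle of area $1/k$ over $(W,\omega_W)$. \textbf{Corollary (Standard Disk Bundles in Symplectic Manifolds).} Let $V$ be a closed manifold, $\omega$ a symplectic form on $V$ with integral periods, $W$ a symplectic hyperplane section of degree $k\ge1$ in $(V,\omega)$, and $(F,\lambda)$ with $q:F\to V$ a Liouville compactification of $V-W$. Then $q(\mathrm{Sk}(F,\lambda))$ is closed and has measure zero in $V$, and its complement $V-q(\mathrm{Sk}(F,\lambda))$, with the symplectic form $\omega$, is a standard symplectic disk bundle of area $1/k$ over $(W,k\,\omega|_W)$, with $W\subset V$ as its zero section. -/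

import Mathlib

open Set Manifold MeasureTheory
open scoped ContDiff Topology

universe u

noncomputable section

/-! ### Differential forms on manifolds (possibly with boundary) -/

section Forms

variable {E : Type*} [NormedAddCommGroup E] [NormedSpace ℝ E]
  {H : Type*} [TopologicalSpace H] (I : ModelWithCorners ℝ E H)
  {M : Type*} [TopologicalSpace M] [ChartedSpace H M]
  {E' : Type*} [NormedAddCommGroup E'] [NormedSpace ℝ E']
  {H' : Type*} [TopologicalSpace H'] (I' : ModelWithCorners ℝ E' H')
  {M' : Type*} [TopologicalSpace M'] [ChartedSpace H' M']

variable (M) in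
/-- A (not necessarily smooth) differential form of degree `q` on `M`. -/
abbrev DForm (q : ℕ) : Type _ := ∀ x : M, (TangentSpace I x) [⋀^Fin q]→L[ℝ] ℝ

/-- Pull-back of a form by `f : M → M'`. -/
def pullbackForm {q : ℕ} (f : M → M') (Ω : DForm I' M' q) : DForm I M q :=
  fun x => (Ω (f x)).compContinuousLinearMap (mfderiv I I' f x)

/-- The expression of a form in the chart centred at `x₀`, as a form on the model space. -/
def chartForm {q : ℕ} (Ω : DForm I M q) (x₀ : M) : E → E [⋀^Fin q]→L[ℝ] ℝ :=
  fun y => (Ω ((extChartAt I x₀).symm y)).compContinuousLinearMap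
    (mfderivWithin 𝓘(ℝ, E) I (extChartAt I x₀).symm (range I) y)

/-- The form is `C^∞` in all charts. -/
def IsSmoothForm {q : ℕ} (Ω : DForm I M q) : Prop :=
  ∀ x₀ : M, ContDiffOn ℝ ∞ (chartForm I Ω x₀) (extChartAt I x₀).target

/-- The exterior derivative, computed at each point `x` in the chart centred at `x`. -/
def extD {q : ℕ} (Ω : DForm I M q) : DForm I M (q + 1) :=
  fun x => (extDerivWithin (chartForm I Ω x) (range I) (extChartAt I x x)).compContinuousLinearMap
    (mfderiv I 𝓘(ℝ, E) (extChartAt I x) x)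

/-- Nondegeneracy of a 2-form at every point. -/
def IsNondegenerateForm (Ω : DForm I M 2) : Prop :=
  ∀ (x : M) (v : TangentSpace I x), (∀ w : TangentSpace I x, Ω x ![v, w] = 0) → v = 0

/-- Symplectic forms: smooth closed nondegenerate 2-forms. -/
structure IsSymplecticForm (Ω : DForm I M 2) : Prop where
  smooth : IsSmoothForm I Ω
  closed : ∀ x, extD I Ω x = 0
  nondegenerate : IsNondegenerateForm I Ω

end Forms

/-! ### Integral periods -/

section Periods

variable {E : Type*} [NormedAddCommGroup E] [NormedSpace ℝ E]
  {H : Type*} [TopologicalSpace H] (I : ModelWithCorners ℝ E H)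
  {M : Type*} [TopologicalSpace M] [ChartedSpace H M]

/-- The standard 2-simplex, as the triangle with vertices `(0,0)`, `(1,0)`, `(0,1)`. -/
def stdTriangle : Set (ℝ × ℝ) := {p | 0 ≤ p.1 ∧ 0 ≤ p.2 ∧ p.1 + p.2 ≤ 1}

/-- The singular boundary of an integral singular 2-chain; its 1-simplices are maps on `[0,1]`.
A singular 2-simplex is given by a map on the plane, of which only the restriction to the triangle
matters. -/
def chainBoundary (c : (ℝ × ℝ → M) →₀ ℤ) : (unitInterval → M) →₀ ℤ :=
  c.sum fun σ m =>
    Finsupp.single (fun t : unitInterval => σ (1 - (t : ℝ), (t : ℝ))) m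
      - Finsupp.single (fun t : unitInterval => σ (0, (t : ℝ))) m
      + Finsupp.single (fun t : unitInterval => σ ((t : ℝ), 0)) m

/-- The integral of a 2-form over a smooth singular 2-simplex. -/
def simplexIntegral (Ω : DForm I M 2) (σ : ℝ × ℝ → M) : ℝ :=
  ∫ p in stdTriangle, Ω (σ p)
    ![mfderivWithin 𝓘(ℝ, ℝ × ℝ) I σ stdTriangle p ((1, 0) : ℝ × ℝ),
      mfderivWithin 𝓘(ℝ, ℝ × ℝ) I σ stdTriangle p ((0, 1) : ℝ × ℝ)]

/-- The (closed) 2-form `Ω` has integral periods: its integral over every smooth integral singular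
2-cycle is an integer. -/
def HasIntegralPeriods (Ω : DForm I M 2) : Prop :=
  ∀ c : (ℝ × ℝ → M) →₀ ℤ,
    (∀ σ ∈ c.support, ContMDiffOn 𝓘(ℝ, ℝ × ℝ) I ∞ σ stdTriangle) →
    chainBoundary c = 0 →
    ∃ m : ℤ, (c.sum fun σ a => (a : ℝ) * simplexIntegral I Ω σ) = m

end Periods

/-! ### Integration over closed symplectic manifolds and hyperplane sections -/

section Integration

variable {d : ℕ} {M : Type*} [TopologicalSpace M] [ChartedSpace (EuclideanSpace ℝ (Fin d)) M]

/-- The coordinate frame, at the point with coordinates `y`, of the chart centred at `x₀`. -/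
def coordFrame (x₀ : M) (y : EuclideanSpace ℝ (Fin d)) (i : Fin d) :
    TangentSpace (𝓡 d) ((extChartAt (𝓡 d) x₀).symm y) :=
  mfderivWithin (𝓡 d) (𝓡 d) (extChartAt (𝓡 d) x₀).symm (range (𝓡 d)) y
    (EuclideanSpace.single i (1 : ℝ))

/-- The value of the top power `Ω ∧ ⋯ ∧ Ω` (with `d / 2` factors) on the vectors `v`, up to a
positive constant factor. -/
def topPower (Ω : DForm (𝓡 d) M 2) (x : M) (v : Fin d → TangentSpace (𝓡 d) x) : ℝ :=
  ∑ σ : Equiv.Perm (Fin d), ((Equiv.Perm.sign σ : ℤ) : ℝ) *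
    ∏ i : Fin (d / 2), Ω x ![v (σ ⟨2 * i, by omega⟩), v (σ ⟨2 * i + 1, by omega⟩)]

/-- The wedge product of a 2-form and a `q`-form, evaluated on `q + 2` vectors. -/
def wedgeTwo {q : ℕ} (Ω : DForm (𝓡 d) M 2) (β : DForm (𝓡 d) M q) (x : M)
    (v : Fin (q + 2) → TangentSpace (𝓡 d) x) : ℝ :=
  (1 / (2 * (q.factorial : ℝ))) * ∑ σ : Equiv.Perm (Fin (q + 2)),
    ((Equiv.Perm.sign σ : ℤ) : ℝ) *
      (Ω x ![v (σ 0), v (σ 1)] * β x fun i : Fin q => v (σ i.succ.succ))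

/-- The integral of a form `β` of degree `d = dim M` over the compact manifold `M` oriented by the
symplectic form `Ω`, by means of a smooth partition of unity subordinate to the charts. -/
def symplecticIntegral [T2Space M] [CompactSpace M] [IsManifold (𝓡 d) ∞ M]
    (Ω : DForm (𝓡 d) M 2) (β : ∀ x : M, (Fin d → TangentSpace (𝓡 d) x) → ℝ) : ℝ :=
  ∑ᶠ i : M, ∫ y in (extChartAt (𝓡 d) i).target,
    (SmoothPartitionOfUnity.exists_isSubordinate_chartAt_source (𝓡 d) M).choose i
        ((extChartAt (𝓡 d) i).symm y)
      * Real.sign (topPower Ω ((extChartAt (𝓡 d) i).symm y) (coordFrame i y))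
      * β ((extChartAt (𝓡 d) i).symm y) (coordFrame i y)

/-- `ι : W → V` is a symplectic hyperplane section of degree `k` of `(V, Ω)`: a closed embedded
symplectic submanifold of codimension two whose homology class (for the orientation given by the
induced symplectic form) is Poincaré dual to `k [Ω]`. -/
structure IsSymplecticHyperplaneSection {n : ℕ}
    {V : Type*} [TopologicalSpace V] [ChartedSpace (EuclideanSpace ℝ (Fin (2 * n + 2))) V]
    [T2Space V] [CompactSpace V] [IsManifold (𝓡 (2 * n + 2)) ∞ V]
    {W : Type*} [TopologicalSpace W] [ChartedSpace (EuclideanSpace ℝ (Fin (2 * n))) W]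
    [T2Space W] [CompactSpace W] [IsManifold (𝓡 (2 * n)) ∞ W]
    (k : ℕ) (Ω : DForm (𝓡 (2 * n + 2)) V 2) (ι : W → V) : Prop where
  embedding : IsSmoothEmbedding (𝓡 (2 * n)) (𝓡 (2 * n + 2)) ∞ ι
  symplectic : IsSymplecticForm (𝓡 (2 * n)) (pullbackForm (𝓡 (2 * n)) (𝓡 (2 * n + 2)) ι Ω)
  poincareDual : ∀ β : DForm (𝓡 (2 * n + 2)) V (2 * n), IsSmoothForm (𝓡 (2 * n + 2)) β →
    (∀ x, extD (𝓡 (2 * n + 2)) β x = 0) →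
    symplecticIntegral (pullbackForm (𝓡 (2 * n)) (𝓡 (2 * n + 2)) ι Ω)
        (fun x v => pullbackForm (𝓡 (2 * n)) (𝓡 (2 * n + 2)) ι β x v)
      = k * symplecticIntegral Ω (wedgeTwo Ω β)

/-- The set `S` has measure zero in the manifold `M`. -/
def IsNullSubset (S : Set M) : Prop :=
  ∀ x₀ : M, volume (extChartAt (𝓡 d) x₀ '' (S ∩ (extChartAt (𝓡 d) x₀).source)) = 0

end Integration

/-! ### Circle bundles and connections -/

section CircleBundles

variable {a b : ℕ}
  {K : Type*} [TopologicalSpace K] [ChartedSpace (EuclideanSpace ℝ (Fin a)) K] [MulAction Circle K]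
  {W : Type*} [TopologicalSpace W] [ChartedSpace (EuclideanSpace ℝ (Fin b)) W]

/-- `p : K → W` is a smooth principal bundle for the given action of the circle group `U(1)`:
the action is smooth and free, and `p` is a surjective submersion whose fibres are the orbits. -/
structure IsPrincipalCircleBundle (p : K → W) : Prop where
  smooth_action : ContMDiff ((𝓡 1).prod (𝓡 a)) (𝓡 a) ∞ (fun y : Circle × K => y.1 • y.2)
  free : ∀ (g : Circle) (x : K), g • x = x → g = 1
  smooth : ContMDiff (𝓡 a) (𝓡 b) ∞ p
  surjective : Function.Surjective p
  submersion : ∀ x, Function.Surjective (mfderiv (𝓡 a) (𝓡 b) p x)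
  fibres : ∀ x y, p x = p y ↔ ∃ g : Circle, y = g • x

/-- The imaginary-valued 1-form `-2πi c α` is a (unitary) connection form on the circle bundle `K`:
it is invariant and takes the value `i` on the vector field generating the action of `e^{iθ}`. -/
structure IsConnectionForm (c : ℝ) (α : DForm (𝓡 a) K 1) : Prop where
  smooth : IsSmoothForm (𝓡 a) α
  invariant : ∀ g : Circle, pullbackForm (𝓡 a) (𝓡 a) (fun x : K => g • x) α = α
  generator : ∀ x : K, -2 * Real.pi * c * α (Circle.exp 0 • x)
    ![mfderiv 𝓘(ℝ, ℝ) (𝓡 a) (fun θ : ℝ => Circle.exp θ • x) 0 (1 : ℝ)] = 1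

/-- The canonical 1-form of the symplectization of `(K, ker α)`, in the splitting
`SK ≃ K × ℝ_{>0}`, `(x, s) ↔ s α_x`, given by `α`: it is `s α`. -/
def symplectizationForm (α : DForm (𝓡 a) K 1) : DForm ((𝓡 a).prod 𝓘(ℝ, ℝ)) (K × ℝ) 1 :=
  fun y => y.2 • pullbackForm ((𝓡 a).prod 𝓘(ℝ, ℝ)) (𝓡 a) Prod.fst α y

/-- The open subset `X` of the symplectic manifold `(V, Ω)` is a standard symplectic disk bundle of
area `1/k` over the closed integral symplectic manifold `(W, ΩW)`, with zero section `ι : W → X`.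

There are a principal circle bundle `p : K → W` with a connection form `-2πi α`, `dα = p^* ΩW`, and
a map `π`, defined on `K × {|z| < 1}`, which identifies the associated disk bundle (the quotient of
`K × {|z| < 1}` by the relation `(x, z) ∼ (g x, g⁻¹ z)`) with `X`. By restriction to `K × (0,1)`, and
with `s = 1 - |z|^2`, it identifies `{s α_x, s < 1}` in the symplectization of `K` with the
complement of the zero section, and `Ω` with `1/k` times the canonical symplectic form `d(s α)`; the
zero section is the quotient of the level `s = 1` by the action of the circle. -/
def IsStandardDiskBundle {n : ℕ}
    {V : Type u} [TopologicalSpace V] [ChartedSpace (EuclideanSpace ℝ (Fin (2 * n + 2))) V]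
    {W : Type u} [TopologicalSpace W] [ChartedSpace (EuclideanSpace ℝ (Fin (2 * n))) W]
    (k : ℕ) (Ω : DForm (𝓡 (2 * n + 2)) V 2) (X : Set V)
    (ΩW : DForm (𝓡 (2 * n)) W 2) (ι : W → V) : Prop :=
  CompactSpace W ∧ IsSymplecticForm (𝓡 (2 * n)) ΩW ∧
  HasIntegralPeriods (𝓡 (2 * n)) ΩW ∧ HasIntegralPeriods (𝓡 (2 * n)) ((1 / (k : ℝ)) • ΩW) ∧
  ∃ (K : Type u) (_ : TopologicalSpace K) (_ : T2Space K) (_ : CompactSpace K)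
    (_ : ChartedSpace (EuclideanSpace ℝ (Fin (2 * n + 1))) K)
    (_ : IsManifold (𝓡 (2 * n + 1)) ∞ K) (_ : MulAction Circle K)
    (p : K → W) (α : DForm (𝓡 (2 * n + 1)) K 1) (π : K × ℂ → V),
    IsPrincipalCircleBundle (a := 2 * n + 1) (b := 2 * n) p ∧
    IsConnectionForm 1 α ∧
    extD (𝓡 (2 * n + 1)) α = pullbackForm (𝓡 (2 * n + 1)) (𝓡 (2 * n)) p ΩW ∧
    ContMDiffOn ((𝓡 (2 * n + 1)).prod 𝓘(ℝ, ℂ)) (𝓡 (2 * n + 2)) ∞ π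
      (univ ×ˢ Metric.ball (0 : ℂ) 1) ∧
    (∀ y ∈ univ ×ˢ Metric.ball (0 : ℂ) 1, Function.Surjective
      (mfderiv ((𝓡 (2 * n + 1)).prod 𝓘(ℝ, ℂ)) (𝓡 (2 * n + 2)) π y)) ∧
    (∀ (x y : K) (z w : ℂ), ‖z‖ < 1 → ‖w‖ < 1 →
      (π (x, z) = π (y, w) ↔ ∃ g : Circle, y = g • x ∧ z = g * w)) ∧
    π '' (univ ×ˢ Metric.ball (0 : ℂ) 1) = X ∧
    (∀ x : K, π (x, 0) = ι (p x)) ∧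
    (∀ y ∈ (univ ×ˢ Ioo (0 : ℝ) 1 : Set (K × ℝ)),
      pullbackForm ((𝓡 (2 * n + 1)).prod 𝓘(ℝ, ℝ)) (𝓡 (2 * n + 2))
          (fun y : K × ℝ => π (y.1, (Real.sqrt (1 - y.2) : ℂ))) Ω y
        = (1 / (k : ℝ)) • extD ((𝓡 (2 * n + 1)).prod 𝓘(ℝ, ℝ)) (symplectizationForm α) y)

end CircleBundles

/-! ### Liouville domains and Liouville compactifications -/

section Liouville

variable {m : ℕ} [NeZero m]
  {F : Type*} [TopologicalSpace F] [ChartedSpace (EuclideanHalfSpace m) F]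

open Classical in
/-- The Liouville vector field: the field `Y` such that `Y ⌟ dα = α`. -/
def liouvilleField (α : DForm (𝓡∂ m) F 1) (x : F) : TangentSpace (𝓡∂ m) x :=
  if h : ∃ v : TangentSpace (𝓡∂ m) x, ∀ w : TangentSpace (𝓡∂ m) x,
      extD (𝓡∂ m) α x ![v, w] = α x ![w]
  then h.choose else 0

/-- `α` is a Liouville form on the domain `F`: `dα` is symplectic up to the boundary and
the Liouville field points transversely outwards along the boundary (`F` is modelled on the half
space `{y₀ ≥ 0}`). -/
structure IsLiouvilleForm (α : DForm (𝓡∂ m) F 1) : Prop where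
  smooth : IsSmoothForm (𝓡∂ m) α
  symplectic : IsSymplecticForm (𝓡∂ m) (extD (𝓡∂ m) α)
  outward : ∀ x ∈ (𝓡∂ m).boundary F,
    (EuclideanSpace.proj (0 : Fin m) : EuclideanSpace ℝ (Fin m) →L[ℝ] ℝ)
      (mfderiv (𝓡∂ m) 𝓘(ℝ, EuclideanSpace ℝ (Fin m)) (extChartAt (𝓡∂ m) x) x
        (liouvilleField α x)) < 0

/-- The skeleton: the union of the orbits of the Liouville field which do not exit through the
boundary. -/
def skeleton (α : DForm (𝓡∂ m) F 1) : Set F :=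
  {x | ¬ ∃ (T : ℝ) (γ : ℝ → F), 0 ≤ T ∧ γ 0 = x ∧
    IsMIntegralCurveOn γ (liouvilleField α) (Icc 0 T) ∧ γ T ∈ (𝓡∂ m).boundary F}

variable {n : ℕ}
  {V : Type*} [TopologicalSpace V] [ChartedSpace (EuclideanSpace ℝ (Fin (2 * n + 2))) V]
  {W : Type*} [TopologicalSpace W] [ChartedSpace (EuclideanSpace ℝ (Fin (2 * n))) W]
  {G : Type*} [TopologicalSpace G] [ChartedSpace (EuclideanHalfSpace (2 * n + 2)) G]
  {K : Type*} [TopologicalSpace K] [ChartedSpace (EuclideanSpace ℝ (Fin (2 * n + 1))) K]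
  [MulAction Circle K]

/-- Given a map `q : G → V` and, for each `x : K`, a curve `c x : (-ε, 0] → G` ending on the
boundary, this is the map `(x, r e^{iθ}) ↦ q (c (e^{iθ} x) (log (1 - r^2)))`, for small `r`. -/
def polarMap (q : G → V) (c : K → ℝ → G) (y : K × ℂ) : V :=
  q (c (Circle.exp (Complex.arg y.2) • y.1) (Real.log (1 - ‖y.2‖ ^ 2)))

/-- `(G, α)`, with the map `q : G → V`, is a Liouville compactification of the complement of the
degree `k` symplectic hyperplane section `ι : W → V` of `(V, Ω)`. Here `j : K → G` is the inclusion
of the boundary of `G`, and `p : K → W` the projection of the normal circle bundle.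

The map `q` collapses each circle of the boundary to a point, and can not be smooth along the
boundary of `G`. That `K` is the normal circle bundle of `W`, and that `V` is the smooth manifold
obtained by this collapsing, is expressed in the collar `{s α_x, s ≤ 1}` of the boundary given by
the Liouville flow (with `s = e^t` at time `t ≤ 0`): in the polar coordinates `s = 1 - r^2`, `q` is
smooth along `W`, and its derivative identifies the plane spanned by the circle with the normal
space of `W`. -/
structure IsLiouvilleCompactification (k : ℕ) (Ω : DForm (𝓡 (2 * n + 2)) V 2) (ι : W → V)
    (α : DForm (𝓡∂ (2 * n + 2)) G 1) (j : K → G) (p : K → W) (q : G → V) : Prop where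
  liouville : IsLiouvilleForm α
  boundary_embedding : IsSmoothEmbedding (𝓡 (2 * n + 1)) (𝓡∂ (2 * n + 2)) ∞ j
  boundary_range : range j = (𝓡∂ (2 * n + 2)).boundary G
  bundle : IsPrincipalCircleBundle (a := 2 * n + 1) (b := 2 * n) p
  continuous : Continuous q
  projects : ∀ x, q (j x) = ι (p x)
  connection : IsConnectionForm k (pullbackForm (𝓡 (2 * n + 1)) (𝓡∂ (2 * n + 2)) j α)
  curvature : extD (𝓡 (2 * n + 1)) (pullbackForm (𝓡 (2 * n + 1)) (𝓡∂ (2 * n + 2)) j α)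
    = pullbackForm (𝓡 (2 * n + 1)) (𝓡 (2 * n)) p
        (pullbackForm (𝓡 (2 * n)) (𝓡 (2 * n + 2)) ι Ω)
  bijOn : BijOn q ((𝓡∂ (2 * n + 2)).interior G) (range ι)ᶜ
  diffeo : IsLocalDiffeomorphOn (𝓡∂ (2 * n + 2)) (𝓡 (2 * n + 2)) ∞ q
    ((𝓡∂ (2 * n + 2)).interior G)
  pullback_eq : ∀ x ∈ (𝓡∂ (2 * n + 2)).interior G,
    pullbackForm (𝓡∂ (2 * n + 2)) (𝓡 (2 * n + 2)) q Ω x = extD (𝓡∂ (2 * n + 2)) α x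
  collapse : ∀ (ε : ℝ) (c : K → ℝ → G), 0 < ε →
    (∀ x, c x 0 = j x ∧ IsMIntegralCurveOn (c x) (liouvilleField α) (Ioc (-ε) 0)) →
    ∀ x : K,
      ContMDiffAt ((𝓡 (2 * n + 1)).prod 𝓘(ℝ, ℂ)) (𝓡 (2 * n + 2)) ∞ (polarMap q c) (x, 0) ∧
      ∀ v : EuclideanSpace ℝ (Fin (2 * n + 2)), ∃ (a : EuclideanSpace ℝ (Fin (2 * n))) (z : ℂ)
        (v₁ v₂ : EuclideanSpace ℝ (Fin (2 * n + 2))),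
        v = v₁ + v₂ ∧ v₁ = mfderiv (𝓡 (2 * n)) (𝓡 (2 * n + 2)) ι (p x) a ∧
        v₂ = mfderiv ((𝓡 (2 * n + 1)).prod 𝓘(ℝ, ℂ)) (𝓡 (2 * n + 2)) (polarMap q c) (x, 0)
            ((0 : EuclideanSpace ℝ (Fin (2 * n + 1))), z)

end Liouville

end

/-!
# The complement of the skeleton is a standard symplectic disk bundle

The Liouville field `Y` of `λ` points outwards along the boundary `K` of the compact manifold `F`, so
its flow `Ψ` is defined for all negative times (`exists_isBackwardSemiflow`), and the complement of
the skeleton is the flow-out of `K` (`IsBackwardSemiflow.notMem_skeleton_iff`), each of its points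
coming from a unique point of `K` at a unique time (`IsBackwardSemiflow.eq_and_eq`). The chart of the
disk bundle is therefore the map `(x, r e^{iθ}) ↦ q (Ψ (e^{iθ} x, log (1 - r ^ 2)))` (`diskMap`): its
fibres are the orbits of the circle (`IsLiouvilleCompactification.diskMap_eq_iff`) and its image is
the complement of the image of the skeleton (`IsLiouvilleCompactification.image_diskMap`).

*The symplectic form.* By Cartan's formula, `Ψ_t^* λ = e^t λ` (`IsBackwardSemiflow.pullbackForm_apply`;
at boundary points the value at time `0` comes from a Grönwall estimate). With `s = e^t = 1 - r ^ 2`,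
the pull-back of `λ` is thus `s` times its restriction to `K`, and that of `ω` is the symplectic form
of the symplectization (`IsLiouvilleCompactification.pullbackForm_diskMap_sqrt`). By hypothesis
`α = k λ|_K` is a connection form with `dα = p^* (k ω|_W)`, which accounts for the area `1 / k`.
The periods of `k ω|_W` and `ω|_W` are integral because periods are natural
(`HasIntegralPeriods.pullbackForm`).

*Smoothness.* Near the zero section the disk map is smooth by the hypothesis that `V` is obtained from
`F` by collapsing circles. This propagates to all negative times by the local flow of `Y`
(`IsLiouvilleCompactification.contMDiffAt_flow`). Smooth dependence of solutions of differential
equations on initial values is obtained from the implicit function theorem on spaces of continuous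
curves (`ContDiff.exists_contDiff_local_flow`). The disk map is a submersion, along the zero section
because the fibres map onto the normal spaces of `W`, and elsewhere because `d(s α)` is nondegenerate
(`IsLiouvilleCompactification.surjective_mfderiv_diskMap`). In particular its image is open, so the
image of the skeleton is closed.

*Measure zero.* For suitable arbitrarily large times the backward flow maps the skeleton onto itself
(`IsBackwardSemiflow.exists_bijOn_skeleton`), while it contracts `ω` exponentially, hence also the
volume. A compact set which is covered by its images under maps contracting a nondegenerate 2-form by
arbitrarily small factors is a null set (`isNullSubset_of_contracting`): comparing Gram determinants
of the form in charts bounds the Jacobians. The latter uses the behaviour of the flow at the points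
of the skeleton only, where it is smooth because the skeleton lies in the interior.
-/

noncomputable section

/-! ### Smooth dependence of solutions of differential equations on initial values -/

section Superposition

variable {X : Type*} [TopologicalSpace X] [CompactSpace X]
  {E : Type u} [NormedAddCommGroup E] [NormedSpace ℝ E]

/-- Pointwise application of a continuous family of operators to a continuous map, as a bounded
linear map in the family. -/
def pointwiseApply (X : Type*) [TopologicalSpace X] [CompactSpace X]
    (E F : Type*) [NormedAddCommGroup E] [NormedSpace ℝ E]
    [NormedAddCommGroup F] [NormedSpace ℝ F] :
    C(X, E →L[ℝ] F) →L[ℝ] C(X, E) →L[ℝ] C(X, F) :=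
  LinearMap.mkContinuous₂
    (LinearMap.mk₂ ℝ
      (fun (A : C(X, E →L[ℝ] F)) (h : C(X, E)) =>
        (⟨fun x => A x (h x), A.continuous.clm_apply h.continuous⟩ : C(X, F)))
      (fun _ _ _ => by ext; simp) (fun _ _ _ => by ext; simp)
      (fun _ _ _ => by ext; simp) (fun _ _ _ => by ext; simp))
    1 (fun A h => by
      rw [one_mul]
      refine (ContinuousMap.norm_le _ (by positivity)).2 fun x => ?_
      exact ((A x).le_opNorm (h x)).trans
        (mul_le_mul (A.norm_coe_le_norm x) (h.norm_coe_le_norm x) (norm_nonneg _) (norm_nonneg A)))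

@[simp]
theorem pointwiseApply_apply {F : Type*} [NormedAddCommGroup F] [NormedSpace ℝ F]
    (A : C(X, E →L[ℝ] F)) (h : C(X, E)) (x : X) :
    pointwiseApply X E F A h x = A x (h x) := rfl

/-- The superposition operator `γ ↦ f ∘ γ` on spaces of continuous maps. -/
def superposition {F : Type*} [TopologicalSpace F] {f : E → F} (hf : Continuous f)
    (γ : C(X, E)) : C(X, F) := ⟨fun x => f (γ x), hf.comp γ.continuous⟩

/-- The superposition operator is differentiable; its derivative at `γ` is pointwise application of
the superposition of the derivative of `f`. -/
theorem hasFDerivAt_superposition {F : Type*} [NormedAddCommGroup F] [NormedSpace ℝ F] {f : E → F}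
    (hf : ContDiff ℝ 1 f) (γ : C(X, E)) :
    HasFDerivAt (superposition (X := X) hf.continuous)
      (pointwiseApply X E F (superposition (hf.continuous_fderiv one_ne_zero) γ)) γ := by
  have hcont : Continuous (superposition (X := X) (hf.continuous_fderiv one_ne_zero)) :=
    ContinuousMap.continuous_postcomp
      (⟨fderiv ℝ f, hf.continuous_fderiv one_ne_zero⟩ : C(E, E →L[ℝ] F))
  rw [hasFDerivAt_iff_isLittleO_nhds_zero, Asymptotics.isLittleO_iff]
  intro c hc
  obtain ⟨δ, hδ, hball⟩ := (Metric.continuousAt_iff (α := C(X, E))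
    (β := C(X, E →L[ℝ] F)) (a := γ)).1 hcont.continuousAt c hc
  filter_upwards [Metric.ball_mem_nhds (0 : C(X, E)) hδ] with h hh
  rw [mem_ball_zero_iff] at hh
  refine (ContinuousMap.norm_le _ (by positivity)).2 fun x => ?_
  have key := (convex_segment (𝕜 := ℝ) (γ x) (γ x + h x)).norm_image_sub_le_of_norm_fderiv_le'
    (f := f) (φ := fderiv ℝ f (γ x)) (C := c) (fun z _ => hf.differentiable one_ne_zero z) ?_
    (left_mem_segment ℝ _ _) (right_mem_segment ℝ _ _)
  · refine (le_trans (le_of_eq ?_) key).trans ?_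
    · simp [superposition]
    · rw [add_sub_cancel_left]
      gcongr
      exact h.norm_coe_le_norm x
  · intro z hz
    rw [segment_eq_image'] at hz
    obtain ⟨θ, ⟨hθ0, hθ1⟩, rfl⟩ := hz
    have h1 : Dist.dist (γ + θ • h) γ < δ := by
      rw [dist_eq_norm, add_sub_cancel_left, norm_smul, Real.norm_of_nonneg hθ0]
      nlinarith [norm_nonneg h]
    have h2 := (ContinuousMap.dist_apply_le_dist x).trans (hball h1).le
    simpa [superposition, dist_eq_norm] using h2

/-- The superposition operator of a smooth map is of class `C^n`, by induction on `n`: its derivative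
is a bounded linear map composed with the superposition operator of the derivative. -/
theorem contDiff_superposition (n : ℕ) : ∀ {F : Type u} [NormedAddCommGroup F] [NormedSpace ℝ F]
    {f : E → F} (hf : ContDiff ℝ ∞ f),
    ContDiff ℝ n (superposition (X := X) hf.continuous) := by
  induction n with
  | zero =>
    intro F _ _ f hf
    exact contDiff_zero.2 (ContinuousMap.continuous_postcomp (⟨f, hf.continuous⟩ : C(E, F)))
  | succ n ih =>
    intro F _ _ f hf
    have hf1 : ContDiff ℝ 1 f := hf.of_le (by exact_mod_cast le_top)
    have hfd : ContDiff ℝ ∞ (fderiv ℝ f) := (contDiff_infty_iff_fderiv.1 hf).2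
    rw [show ((n + 1 : ℕ) : WithTop ℕ∞) = (n : WithTop ℕ∞) + 1 by simp,
      contDiff_succ_iff_hasFDerivAt]
    refine ⟨_, ?_, hasFDerivAt_superposition hf1⟩
    exact (pointwiseApply X E F).contDiff.comp (ih hfd)

end Superposition

section Flow

variable {E : Type u} [NormedAddCommGroup E] [NormedSpace ℝ E] [CompleteSpace E]

/-- The primitive `τ ↦ ∫₀^τ γ`, as a bounded operator on `C([0, 1], E)`. -/
def primitiveCLM (E : Type*) [NormedAddCommGroup E] [NormedSpace ℝ E] [CompleteSpace E] :
    C(unitInterval, E) →L[ℝ] C(unitInterval, E) :=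
  LinearMap.mkContinuous
    { toFun := fun γ => ⟨fun τ => ∫ σ in (0 : ℝ)..τ, γ (projIcc 0 1 zero_le_one σ),
        (intervalIntegral.continuous_primitive (fun a b =>
          (γ.continuous.comp continuous_projIcc).intervalIntegrable a b) 0).comp
          continuous_subtype_val⟩
      map_add' := fun γ γ' => by
        ext τ
        exact intervalIntegral.integral_add
          ((γ.continuous.comp continuous_projIcc).intervalIntegrable _ _)
          ((γ'.continuous.comp continuous_projIcc).intervalIntegrable _ _)
      map_smul' := fun c γ => by
        ext τ
        exact intervalIntegral.integral_smul c _ }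
    1 (fun γ => by
      refine (ContinuousMap.norm_le _ (by positivity)).2 fun τ => ?_
      refine (intervalIntegral.norm_integral_le_of_norm_le_const (C := ‖γ‖)
        fun σ _ => γ.norm_coe_le_norm _).trans ?_
      rw [one_mul, sub_zero, abs_of_nonneg τ.2.1]
      exact mul_le_of_le_one_right (norm_nonneg _) τ.2.2)

theorem primitiveCLM_apply (γ : C(unitInterval, E)) (τ : unitInterval) :
    primitiveCLM E γ τ = ∫ σ in (0 : ℝ)..τ, γ (projIcc 0 1 zero_le_one σ) := rfl

/-- A globally smooth vector field has a flow which near a given point and for small times is of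
class `C^n`. The solutions starting at `x`, rescaled to the unit interval, are the zeros of a map
between Banach spaces which depends smoothly on the curve, on `x` and on the scale; so the implicit
function theorem applies. -/
theorem ContDiff.exists_contDiff_local_flow {f : E → E} (hf : ContDiff ℝ ∞ f) (x₀ : E) (n : ℕ)
    (hn : n ≠ 0) :
    ∃ (Φ : E × ℝ → E), ContDiffAt ℝ n Φ (x₀, 0) ∧
      ∀ᶠ y in 𝓝 (x₀, (0 : ℝ)), Φ (y.1, 0) = y.1 ∧
        HasDerivAt (fun t => Φ (y.1, t)) (f (Φ y)) y.2 := by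
  obtain ⟨ε, hε, a, r, L, Kl, hr, hpl⟩ :=
    IsPicardLindelof.of_contDiffAt_one (hf.contDiffAt (x := x₀) |>.of_le (m := 1)
      (by exact_mod_cast le_top))
  obtain ⟨Φ, hΦ, hΦc⟩ :=
    (hpl 0).exists_forall_mem_closedBall_eq_hasDerivWithinAt_continuousOn
  simp only [zero_sub, zero_add] at hΦ hΦc
  have hr' : (0 : ℝ) < r := hr
  have hnhds : Metric.ball x₀ (r : ℝ) ×ˢ Ioo (-ε) ε ∈ 𝓝 (x₀, (0 : ℝ)) :=
    prod_mem_nhds (Metric.ball_mem_nhds _ hr') (Ioo_mem_nhds (by linarith) hε)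
  have hsub : Metric.ball x₀ (r : ℝ) ×ˢ Ioo (-ε) ε ⊆ Metric.closedBall x₀ r ×ˢ Icc (-ε) ε :=
    prod_mono Metric.ball_subset_closedBall Ioo_subset_Icc_self
  have hΦ0 : Φ (x₀, 0) = x₀ := (hΦ x₀ (Metric.mem_closedBall_self r.2)).1
  have hode : ∀ x ∈ Metric.ball x₀ (r : ℝ), ∀ t ∈ Ioo (-ε) ε,
      HasDerivAt (fun t => Φ (x, t)) (f (Φ (x, t))) t := fun x hx t ht =>
    ((hΦ x (Metric.ball_subset_closedBall hx)).2 t (Ioo_subset_Icc_self ht)).hasDerivAt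
      (Icc_mem_nhds ht.1 ht.2)
  refine ⟨Φ, ?_, ?_⟩
  swap
  · filter_upwards [hnhds] with y hy
    exact ⟨(hΦ y.1 (Metric.ball_subset_closedBall hy.1)).1, hode _ hy.1 _ hy.2⟩
  -- the map whose zeros are the rescaled solutions
  let C := C(unitInterval, E)
  let G : (E × ℝ) × C → C := fun y =>
    y.2 - ContinuousLinearMap.const ℝ unitInterval y.1.1
      - y.1.2 • primitiveCLM E (superposition hf.continuous y.2)
  let γ₀ : C := ContinuousLinearMap.const ℝ unitInterval x₀
  have hN : ContDiff ℝ n (superposition (X := unitInterval) hf.continuous) :=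
    contDiff_superposition n hf
  have hG : ContDiff ℝ n G := by
    refine (contDiff_snd.sub ?_).sub ?_
    · exact (show ContDiff ℝ n (fun x : E => (ContinuousLinearMap.const ℝ unitInterval x : C)) from
        ContinuousLinearMap.contDiff (E := E) (F := C)
          (ContinuousLinearMap.const ℝ unitInterval)).comp (contDiff_fst.comp contDiff_fst)
    · exact (contDiff_snd.comp contDiff_fst).smul
        ((primitiveCLM E).contDiff.comp (hN.comp contDiff_snd))
  have hGat : ContDiffAt ℝ n G ((x₀, 0), γ₀) := hG.contDiffAt
  have hn' : (n : WithTop ℕ∞) ≠ 0 := by exact_mod_cast hn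
  have hG0 : G ((x₀, 0), γ₀) = 0 := by simp [G, γ₀]
  -- at scale `0` the partial derivative in the curve is the identity
  have hinv : fderiv ℝ G ((x₀, 0), γ₀) ∘L .inr ℝ (E × ℝ) C = ContinuousLinearMap.id ℝ C := by
    have h1 : HasFDerivAt (fun γ : C => G ((x₀, 0), γ))
        (fderiv ℝ G ((x₀, 0), γ₀) ∘L .inr ℝ (E × ℝ) C) γ₀ :=
      HasFDerivAt.comp γ₀ (hG.differentiable hn' _).hasFDerivAt (hasFDerivAt_prodMk_right _ _)
    have h2 : (fun γ : C => G ((x₀, 0), γ)) = fun γ => γ - γ₀ := by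
      ext1 γ; simp [G, γ₀]
    rw [h2] at h1
    exact h1.unique ((hasFDerivAt_id γ₀).sub_const γ₀)
  have hinv' : (fderiv ℝ G ((x₀, 0), γ₀) ∘L .inr ℝ (E × ℝ) C).IsInvertible := by
    rw [hinv]; exact ContinuousLinearMap.isInvertible_equiv (f := ContinuousLinearEquiv.refl ℝ C)
  have himp := hGat.contDiffAt_implicitFunction hn' hinv'
  have huniq := hGat.eventually_apply_eq_iff_implicitFunction hn' hinv'
  set ψ := hGat.implicitFunction hn' hinv' with hψ
  refine ContDiffAt.congr_of_eventuallyEq (f := fun y => ψ y (1 : unitInterval)) ?_ ?_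
  · exact ContDiffAt.comp (g := fun γ : C => γ (1 : unitInterval)) (x₀, (0 : ℝ))
      (ContinuousLinearMap.contDiff (E := C) (F := E)
        (ContinuousMap.evalCLM ℝ (1 : unitInterval))).contDiffAt himp
  -- the rescaled solutions are close to the constant curve
  rw [Metric.eventually_nhds_iff] at huniq
  obtain ⟨η, hη, huniq⟩ := huniq
  have hcont : ContinuousAt Φ (x₀, 0) := hΦc.continuousAt (Filter.mem_of_superset hnhds hsub)
  obtain ⟨δ, hδ, hclose⟩ := Metric.continuousAt_iff.1 hcont (η / 2) (by positivity)
  rw [hΦ0] at hclose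
  have hev : Metric.ball (x₀, (0 : ℝ)) (min δ η) ∈ 𝓝 (x₀, (0 : ℝ)) :=
    Metric.ball_mem_nhds _ (lt_min hδ hη)
  filter_upwards [hnhds, hev] with y hy hy'
  obtain ⟨x, s⟩ := y
  -- `τ ↦ Φ (x, s τ)` is a zero of `G` near `γ₀`, so it is the one given by the implicit function
  have hscale : ∀ τ : ℝ, τ ∈ Icc (0 : ℝ) 1 → |s * τ| ≤ |s| := fun τ hτ => by
    rw [abs_mul, abs_of_nonneg hτ.1]; exact mul_le_of_le_one_right (abs_nonneg _) hτ.2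
  have hmem : ∀ τ : ℝ, τ ∈ Icc (0 : ℝ) 1 → s * τ ∈ Ioo (-ε) ε := fun τ hτ =>
    abs_lt.1 ((hscale τ hτ).trans_lt (abs_lt.2 hy.2))
  have hxb : x ∈ Metric.ball x₀ (r : ℝ) := hy.1
  let γ : C := ⟨fun τ => Φ (x, s * τ), by
    refine (hΦc.mono hsub).comp_continuous (by fun_prop) fun τ => ⟨hxb, hmem τ τ.2⟩⟩
  have hdist : Dist.dist γ γ₀ < η := by
    refine lt_of_le_of_lt ((ContinuousMap.dist_le (by positivity)).2 fun τ => ?_) (half_lt_self hη)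
    refine (hclose (x := (x, s * τ)) ?_).le
    refine lt_of_le_of_lt ?_ ((Metric.mem_ball.1 hy').trans_le (min_le_left _ _))
    rw [Prod.dist_eq, Prod.dist_eq]
    refine max_le_max le_rfl ?_
    simpa [Real.dist_eq] using hscale τ τ.2
  have hGγ : G ((x, s), γ) = 0 := by
    ext τ
    have hint : ∫ σ in (0 : ℝ)..τ, s • f (Φ (x, s * σ)) = Φ (x, s * τ) - Φ (x, s * 0) := by
      refine intervalIntegral.integral_eq_sub_of_hasDerivAt
        (f := fun σ => Φ (x, s * σ)) (fun σ hσ => ?_) ?_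
      · rw [uIcc_of_le τ.2.1] at hσ
        have := hode x hxb (s * σ) (hmem σ ⟨hσ.1, hσ.2.trans τ.2.2⟩)
        simpa [Function.comp_def] using this.scomp σ ((hasDerivAt_id σ).const_mul s)
      · refine ContinuousOn.intervalIntegrable ?_
        rw [uIcc_of_le τ.2.1]
        refine continuousOn_const.smul (hf.continuous.comp_continuousOn ?_)
        exact (hΦc.mono hsub).comp (by fun_prop)
          fun σ hσ => ⟨hxb, hmem σ ⟨hσ.1, hσ.2.trans τ.2.2⟩⟩
    rw [mul_zero, (hΦ x (Metric.ball_subset_closedBall hxb)).1,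
      intervalIntegral.integral_smul] at hint
    have hprim : primitiveCLM E (superposition hf.continuous γ) τ
        = ∫ σ in (0 : ℝ)..τ, f (Φ (x, s * σ)) := by
      rw [primitiveCLM_apply]
      refine intervalIntegral.integral_congr fun σ hσ => ?_
      rw [uIcc_of_le τ.2.1] at hσ
      simp [superposition, γ, projIcc_of_mem zero_le_one
        (show σ ∈ Icc (0 : ℝ) 1 from ⟨hσ.1, hσ.2.trans τ.2.2⟩)]
    change γ τ - x - s • primitiveCLM E (superposition hf.continuous γ) τ = 0
    rw [hprim, hint]
    exact sub_self _
  have hlt : Dist.dist ((x, s), γ) ((x₀, (0 : ℝ)), γ₀) < η := by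
    rw [Prod.dist_eq]
    exact max_lt ((Metric.mem_ball.1 hy').trans_le (min_le_right _ _)) hdist
  have := (huniq hlt).1 (hGγ.trans hG0.symm)
  change Φ (x, s) = ψ (x, s) 1
  rw [show ψ (x, s) = γ from this]
  change Φ (x, s) = Φ (x, s * ((1 : unitInterval) : ℝ))
  simp

/-- A vector field which is smooth on an open set has, near each point of this set and for small
times, a flow of class `C^n`. -/
theorem ContDiffOn.exists_contDiff_local_flow [FiniteDimensional ℝ E] {f : E → E} {U : Set E}
    (hU : IsOpen U) (hf : ContDiffOn ℝ ∞ f U) {x₀ : E} (hx₀ : x₀ ∈ U) (n : ℕ) (hn : n ≠ 0) :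
    ∃ (Φ : E × ℝ → E), ContDiffAt ℝ n Φ (x₀, 0) ∧
      ∀ᶠ y in 𝓝 (x₀, (0 : ℝ)), Φ (y.1, 0) = y.1 ∧
        HasDerivAt (fun t => Φ (y.1, t)) (f (Φ y)) y.2 := by
  obtain ⟨R, hR, hRU⟩ := Metric.nhds_basis_closedBall.mem_iff.1 (hU.mem_nhds hx₀)
  -- cut off by a bump function which is `1` near `x₀`, to get a globally smooth vector field
  let χ : ContDiffBump x₀ := ⟨R / 2, R, by positivity, by linarith⟩
  have hg : ContDiff ℝ ∞ (fun x => χ x • f x) := by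
    rw [contDiff_iff_contDiffAt]
    intro x
    by_cases hx : x ∈ U
    · exact χ.contDiffAt.smul (hf.contDiffAt (hU.mem_nhds hx))
    · have hx' : x ∈ (Metric.closedBall x₀ R)ᶜ := fun h => hx (hRU h)
      refine (contDiffAt_const (c := (0 : E))).congr_of_eventuallyEq ?_
      filter_upwards [Metric.isClosed_closedBall.isOpen_compl.mem_nhds hx'] with y hy
      rw [χ.zero_of_le_dist (le_of_lt (not_le.1 fun h => hy (Metric.mem_closedBall.2 h))), zero_smul]
  obtain ⟨Φ, hΦ, hode⟩ := hg.exists_contDiff_local_flow x₀ n hn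
  refine ⟨Φ, hΦ, ?_⟩
  have h0 : Φ (x₀, 0) = x₀ := hode.self_of_nhds.1
  have hev : ∀ᶠ y in 𝓝 (x₀, (0 : ℝ)), χ (Φ y) = 1 := by
    refine hΦ.continuousAt.eventually (p := fun y => χ y = 1) ?_
    rw [h0]
    exact χ.eventuallyEq_one
  filter_upwards [hode, hev] with y hy hy'
  refine ⟨hy.1, ?_⟩
  simpa [hy'] using hy.2

end Flow

/-! ### Differential forms and vector fields in charts -/

section FormsInCharts

variable {E : Type*} [NormedAddCommGroup E] [NormedSpace ℝ E]
  {H : Type*} [TopologicalSpace H] {I : ModelWithCorners ℝ E H}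
  {M : Type*} [TopologicalSpace M] [ChartedSpace H M]
  {q : ℕ}

/-- Every tangent space is the model space `E`, so that tuples of vectors of `E` can be inserted into a
form at any point. -/
theorem DForm.congr_point (Ω : DForm I M q) {x y : M} (h : x = y) (v : Fin q → E) :
    Ω x v = Ω y v := by
  subst h; rfl

variable [IsManifold I ∞ M]

theorem mfderivWithin_symm_mfderiv_extChartAt {x₀ y : M} (hy : y ∈ (extChartAt I x₀).source)
    (v : E) :
    (mfderivWithin 𝓘(ℝ, E) I (extChartAt I x₀).symm (range I) (extChartAt I x₀ y)
      (mfderiv I 𝓘(ℝ, E) (extChartAt I x₀) y v : E) : E) = v :=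
  congrArg (fun L : E →L[ℝ] E => L v)
    (mfderivWithin_extChartAt_symm_comp_mfderiv_extChartAt' (I := I) hy)

theorem mfderiv_mfderivWithin_symm_extChartAt {x₀ y : M} (hy : y ∈ (extChartAt I x₀).source)
    (v : E) :
    (mfderiv I 𝓘(ℝ, E) (extChartAt I x₀) y
      (mfderivWithin 𝓘(ℝ, E) I (extChartAt I x₀).symm (range I) (extChartAt I x₀ y) v : E) : E)
      = v :=
  congrArg (fun L : E →L[ℝ] E => L v)
    (mfderiv_extChartAt_comp_mfderivWithin_extChartAt_symm' (I := I) hy)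

/-- The chart expression of a form recovers the form, by inserting the images of tangent vectors under
the derivative of the chart. -/
theorem chartForm_mfderiv (Ω : DForm I M q) {x₀ y : M} (hy : y ∈ (extChartAt I x₀).source)
    (v : Fin q → E) :
    chartForm I Ω x₀ (extChartAt I x₀ y)
      (fun i => (mfderiv I 𝓘(ℝ, E) (extChartAt I x₀) y (v i) : E)) = Ω y v := by
  refine Eq.trans ?_ (DForm.congr_point Ω ((extChartAt I x₀).left_inv hy) v)
  change Ω _ _ = Ω _ _
  congr 1
  funext i
  exact mfderivWithin_symm_mfderiv_extChartAt hy (v i)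

omit [IsManifold I ∞ M] in
theorem IsSmoothForm.contDiffWithinAt {Ω : DForm I M q} (hΩ : IsSmoothForm I Ω) (x₀ : M) {y : M}
    (hy : y ∈ (extChartAt I x₀).source) :
    ContDiffWithinAt ℝ ∞ (chartForm I Ω x₀) (range I) (extChartAt I x₀ y) :=
  ((hΩ x₀).contDiffWithinAt ((extChartAt I x₀).map_source hy)).mono_of_mem_nhdsWithin
    (extChartAt_target_mem_nhdsWithin' hy)

/-- The pull-back of a form by a map defined on a vector space, in terms of a chart of the
target. -/
theorem pullbackForm_eq_chartForm {E' : Type*} [NormedAddCommGroup E'] [NormedSpace ℝ E']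
    (Ω : DForm I M q) {g : E' → M} {z : E'} (hg : MDifferentiableAt 𝓘(ℝ, E') I g z) {x₀ : M}
    (hz : g z ∈ (extChartAt I x₀).source) :
    (pullbackForm 𝓘(ℝ, E') I g Ω z : E' [⋀^Fin q]→L[ℝ] ℝ) =
      (chartForm I Ω x₀ (extChartAt I x₀ (g z))).compContinuousLinearMap
        (fderiv ℝ (fun w => extChartAt I x₀ (g w)) z) := by
  ext v
  change Ω (g z) (fun i => mfderiv 𝓘(ℝ, E') I g z (v i)) = _
  have hcomp : mfderiv 𝓘(ℝ, E') 𝓘(ℝ, E) (extChartAt I x₀ ∘ g) z =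
      (mfderiv I 𝓘(ℝ, E) (extChartAt I x₀) (g z)).comp (mfderiv 𝓘(ℝ, E') I g z) :=
    mfderiv_comp z (mdifferentiableAt_extChartAt (by simpa using hz)) hg
  rw [mfderiv_eq_fderiv] at hcomp
  have h := chartForm_mfderiv Ω hz (fun i => (mfderiv 𝓘(ℝ, E') I g z (v i) : E))
  rw [← h]
  change _ = chartForm I Ω x₀ (extChartAt I x₀ (g z))
    (fun i => fderiv ℝ (extChartAt I x₀ ∘ g) z (v i))
  congr 1
  funext i
  exact (congrArg (fun L : E' →L[ℝ] E => L (v i)) hcomp).symm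

/-- The exterior derivative commutes with pull-back by a map defined on a vector space. -/
theorem extDeriv_pullbackForm {E' : Type*} [NormedAddCommGroup E'] [NormedSpace ℝ E']
    {Ω : DForm I M q} (hΩ : IsSmoothForm I Ω) {g : E' → M} {z : E'}
    (hg : ContMDiffAt 𝓘(ℝ, E') I 2 g z) :
    extDeriv (fun w => (pullbackForm 𝓘(ℝ, E') I g Ω w : E' [⋀^Fin q]→L[ℝ] ℝ)) z =
      (pullbackForm 𝓘(ℝ, E') I g (extD I Ω) z : E' [⋀^Fin (q + 1)]→L[ℝ] ℝ) := by
  have hsrc : ∀ᶠ w in 𝓝 z, g w ∈ (extChartAt I (g z)).source :=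
    hg.continuousAt.eventually (extChartAt_source_mem_nhds (g z))
  have hdiff : ∀ᶠ w in 𝓝 z, MDifferentiableAt 𝓘(ℝ, E') I g w := by
    filter_upwards [(contMDiffAt_iff_contMDiffAt_nhds (by simp)).1 hg] with w hw
    exact hw.mdifferentiableAt (by simp)
  have hev : (fun w => (pullbackForm 𝓘(ℝ, E') I g Ω w : E' [⋀^Fin q]→L[ℝ] ℝ)) =ᶠ[𝓝 z]
      fun w => (chartForm I Ω (g z) (extChartAt I (g z) (g w))).compContinuousLinearMap
        (fderiv ℝ (fun w => extChartAt I (g z) (g w)) w) := by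
    filter_upwards [hsrc, hdiff] with w hw hw'
    exact pullbackForm_eq_chartForm Ω hw' hw
  rw [hev.extDeriv_eq]
  have hmem : g z ∈ (extChartAt I (g z)).source := mem_extChartAt_source (g z)
  have hG : ContDiffAt ℝ 2 (fun w => extChartAt I (g z) (g w)) z := by
    have := (contMDiffAt_extChartAt (I := I) (n := 2) (x := g z)).comp z hg
    exact contMDiffAt_iff_contDiffAt.1 this
  have key := extDerivWithin_pullback (E := E') (F := E) (G := ℝ) (𝕜 := ℝ) (n := q)
    (f := fun w => extChartAt I (g z) (g w)) (t := range I) (s := univ) (x := z) (r := 2)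
    (((hΩ.contDiffWithinAt (g z) hmem).differentiableWithinAt (by simp)))
    hG.contDiffWithinAt (by simp) uniqueDiffOn_univ (by simp) (mem_univ z)
    (fun w _ => mem_range_self _)
  rw [extDerivWithin_univ] at key
  simp only [fderivWithin_univ] at key
  rw [key]
  have hd := hdiff.self_of_nhds
  ext v
  have hcomp : mfderiv 𝓘(ℝ, E') 𝓘(ℝ, E) (extChartAt I (g z) ∘ g) z =
      (mfderiv I 𝓘(ℝ, E) (extChartAt I (g z)) (g z)).comp (mfderiv 𝓘(ℝ, E') I g z) :=
    mfderiv_comp z (mdifferentiableAt_extChartAt (by simp)) hd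
  rw [mfderiv_eq_fderiv] at hcomp
  change extDerivWithin (chartForm I Ω (g z)) (range I) (extChartAt I (g z) (g z))
    (fun i => fderiv ℝ (extChartAt I (g z) ∘ g) z (v i)) =
    extDerivWithin (chartForm I Ω (g z)) (range I) (extChartAt I (g z) (g z))
    (fun i => (mfderiv I 𝓘(ℝ, E) (extChartAt I (g z)) (g z)
      (mfderiv 𝓘(ℝ, E') I g z (v i) : E) : E))
  congr 1
  funext i
  exact congrArg (fun L : E' →L[ℝ] E => L (v i)) hcomp

/-- The expression of a vector field in the chart centred at `x₀`. -/
def chartField (I : ModelWithCorners ℝ E H) (Y : ∀ x : M, TangentSpace I x) (x₀ : M) (y : E) : E :=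
  mfderiv I 𝓘(ℝ, E) (extChartAt I x₀) ((extChartAt I x₀).symm y) (Y ((extChartAt I x₀).symm y))

omit [IsManifold I ∞ M] in
theorem chartField_extChartAt (Y : ∀ x : M, TangentSpace I x) {x₀ y : M}
    (hy : y ∈ (extChartAt I x₀).source) :
    chartField I Y x₀ (extChartAt I x₀ y) =
      (mfderiv I 𝓘(ℝ, E) (extChartAt I x₀) y (Y y) : E) := by
  have : ∀ z : M, z = y → (mfderiv I 𝓘(ℝ, E) (extChartAt I x₀) z (Y z) : E) =
      (mfderiv I 𝓘(ℝ, E) (extChartAt I x₀) y (Y y) : E) := by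
    rintro z rfl; rfl
  exact this _ ((extChartAt I x₀).left_inv hy)

/-- A curve is tangent to a vector field if and only if this holds in a chart. -/
theorem hasMFDerivWithinAt_smulRight_iff (Y : ∀ x : M, TangentSpace I x) {x₀ : M} {γ : ℝ → M}
    {s : Set ℝ} {t : ℝ} (ht : γ t ∈ (extChartAt I x₀).source)
    (hc : ContinuousWithinAt γ s t) :
    HasMFDerivWithinAt 𝓘(ℝ, ℝ) I γ s t ((1 : ℝ →L[ℝ] ℝ).smulRight (Y (γ t))) ↔
      HasDerivWithinAt (fun τ => extChartAt I x₀ (γ τ))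
        (chartField I Y x₀ (extChartAt I x₀ (γ t))) s t := by
  have hsrc : (extChartAt I x₀).source ∈ 𝓝 (γ t) := extChartAt_source_mem_nhds' ht
  rw [hasDerivWithinAt_iff_hasFDerivWithinAt, chartField_extChartAt Y ht]
  constructor
  · intro h
    have h2 := (mdifferentiableAt_extChartAt (I := I) (x := x₀) (y := γ t)
      (by simpa using ht)).hasMFDerivAt.comp_hasMFDerivWithinAt t h
    rw [hasMFDerivWithinAt_iff_hasFDerivWithinAt] at h2
    refine h2.congr_fderiv ?_
    ext
    change (mfderiv I 𝓘(ℝ, E) (extChartAt I x₀) (γ t) ((1 : ℝ) • Y (γ t)) : E)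
      = (1 : ℝ) • (mfderiv I 𝓘(ℝ, E) (extChartAt I x₀) (γ t) (Y (γ t)) : E)
    rw [one_smul, one_smul]
  · intro h
    have h1 : HasMFDerivWithinAt 𝓘(ℝ, ℝ) 𝓘(ℝ, E) (fun τ => extChartAt I x₀ (γ τ)) s t _ :=
      h.hasMFDerivWithinAt
    have h2 := (mdifferentiableWithinAt_extChartAt_symm (I := I)
      ((extChartAt I x₀).map_source ht)).hasMFDerivWithinAt.comp t h1 (fun _ _ => mem_range_self _)
    have h3 : HasMFDerivWithinAt 𝓘(ℝ, ℝ) I γ s t _ := h2.congr_of_eventuallyEq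
      (by
        filter_upwards [hc.eventually hsrc] with τ hτ
        exact ((extChartAt I x₀).left_inv hτ).symm)
      ((extChartAt I x₀).left_inv ht).symm
    refine h3.congr_mfderiv ?_
    ext
    change (mfderivWithin 𝓘(ℝ, E) I (extChartAt I x₀).symm (range I) (extChartAt I x₀ (γ t))
      ((1 : ℝ) • mfderiv I 𝓘(ℝ, E) (extChartAt I x₀) (γ t) (Y (γ t)) : E) : E)
      = ((1 : ℝ) • Y (γ t) : E)
    rw [one_smul]
    exact (mfderivWithin_symm_mfderiv_extChartAt ht (Y (γ t) : E)).trans (one_smul ℝ _).symm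

end FormsInCharts

/-! ### The Liouville field -/

section LiouvilleField

variable {m : ℕ} [NeZero m]
  {F : Type*} [TopologicalSpace F] [ChartedSpace (EuclideanHalfSpace m) F]
  {α : DForm (𝓡∂ m) F 1}

/-- The Liouville field satisfies its defining equation, because a nondegenerate 2-form identifies
vectors with 1-forms; so it never takes the default value of its definition. -/
theorem liouvilleField_spec (hα : IsNondegenerateForm (𝓡∂ m) (extD (𝓡∂ m) α)) (x : F)
    (w : TangentSpace (𝓡∂ m) x) :
    extD (𝓡∂ m) α x ![liouvilleField α x, w] = α x ![w] := by
  let e : EuclideanSpace ℝ (Fin m) [⋀^Fin 1]→L[ℝ] ℝ ≃ₗ[ℝ] (EuclideanSpace ℝ (Fin m) →L[ℝ] ℝ) :=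
    (ContinuousAlternatingMap.ofSubsingletonLIE (𝕜 := ℝ) (E := EuclideanSpace ℝ (Fin m))
      (F := ℝ) (i := (0 : Fin 1))).symm.toLinearEquiv
  let Ω : EuclideanSpace ℝ (Fin m) [⋀^Fin 2]→L[ℝ] ℝ := extD (𝓡∂ m) α x
  let B : EuclideanSpace ℝ (Fin m) →ₗ[ℝ] (EuclideanSpace ℝ (Fin m) →L[ℝ] ℝ) :=
    e.toLinearMap ∘ₗ Ω.curryLeft.toLinearMap
  have hinj : Function.Injective B := by
    rw [← LinearMap.ker_eq_bot, LinearMap.ker_eq_bot']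
    intro v hv
    refine hα x v fun w => ?_
    have h1 : Ω.curryLeft v = 0 := e.injective (hv.trans (map_zero e).symm)
    exact congrArg (fun L : EuclideanSpace ℝ (Fin m) [⋀^Fin 1]→L[ℝ] ℝ => L ![w]) h1
  have hfin : Module.finrank ℝ (EuclideanSpace ℝ (Fin m)) =
      Module.finrank ℝ (EuclideanSpace ℝ (Fin m) →L[ℝ] ℝ) := by
    rw [LinearEquiv.finrank_eq (LinearMap.toContinuousLinearMap
      (𝕜 := ℝ) (E := EuclideanSpace ℝ (Fin m)) (F' := ℝ)).symm]
    exact (Subspace.dual_finrank_eq).symm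
  have hsurj : Function.Surjective B :=
    (LinearMap.injective_iff_surjective_of_finrank_eq_finrank hfin).1 hinj
  have hex : ∃ v : TangentSpace (𝓡∂ m) x, ∀ w : TangentSpace (𝓡∂ m) x,
      extD (𝓡∂ m) α x ![v, w] = α x ![w] := by
    obtain ⟨v, hv⟩ := hsurj (e (α x))
    refine ⟨v, fun w => ?_⟩
    have h1 : Ω.curryLeft v = α x := e.injective hv
    exact congrArg (fun L : EuclideanSpace ℝ (Fin m) [⋀^Fin 1]→L[ℝ] ℝ => L ![w]) h1
  rw [liouvilleField, dif_pos hex]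
  exact hex.choose_spec w

theorem liouvilleForm_apply_liouvilleField
    (hα : IsNondegenerateForm (𝓡∂ m) (extD (𝓡∂ m) α)) (x : F) :
    α x ![liouvilleField α x] = 0 := by
  rw [← liouvilleField_spec hα x]
  exact (extD (𝓡∂ m) α x).map_eq_zero_of_eq _ (i := 0) (j := 1) rfl (by decide)

variable [IsManifold (𝓡∂ m) ∞ F]

/-- The Liouville field is smooth in charts: it is the solution of a linear equation with smooth
invertible coefficients. -/
theorem contDiffOn_chartField_liouvilleField (hα : IsLiouvilleForm α) (x₀ : F) :
    ContDiffOn ℝ ∞ (chartField (𝓡∂ m) (liouvilleField α) x₀) (extChartAt (𝓡∂ m) x₀).target := by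
  let e : EuclideanSpace ℝ (Fin m) [⋀^Fin 1]→L[ℝ] ℝ ≃L[ℝ] (EuclideanSpace ℝ (Fin m) →L[ℝ] ℝ) :=
    (ContinuousAlternatingMap.ofSubsingletonLIE (𝕜 := ℝ) (E := EuclideanSpace ℝ (Fin m))
      (F := ℝ) (i := (0 : Fin 1))).symm.toContinuousLinearEquiv
  let C : (EuclideanSpace ℝ (Fin m) [⋀^Fin 2]→L[ℝ] ℝ) →L[ℝ]
      (EuclideanSpace ℝ (Fin m) →L[ℝ] EuclideanSpace ℝ (Fin m) [⋀^Fin 1]→L[ℝ] ℝ) :=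
    (ContinuousAlternatingMap.curryLeftLI (𝕜 := ℝ) (E := EuclideanSpace ℝ (Fin m)) (F := ℝ)
      (n := 1)).toContinuousLinearMap
  let B : EuclideanSpace ℝ (Fin m) →
      EuclideanSpace ℝ (Fin m) →L[ℝ] (EuclideanSpace ℝ (Fin m) →L[ℝ] ℝ) :=
    fun y => (e : _ →L[ℝ] _).comp (C (chartForm (𝓡∂ m) (extD (𝓡∂ m) α) x₀ y))
  have hC : ContDiff ℝ ∞ C := by apply ContinuousLinearMap.contDiff
  have hB : ContDiffOn ℝ ∞ B (extChartAt (𝓡∂ m) x₀).target :=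
    contDiffOn_const.clm_comp
      (hC.comp_contDiffOn (hα.symplectic.smooth x₀))
  have hl : ContDiffOn ℝ ∞ (fun y => e (chartForm (𝓡∂ m) α x₀ y)) (extChartAt (𝓡∂ m) x₀).target :=
    e.contDiff.comp_contDiffOn (hα.smooth x₀)
  have hfin : Module.finrank ℝ (EuclideanSpace ℝ (Fin m)) =
      Module.finrank ℝ (EuclideanSpace ℝ (Fin m) →L[ℝ] ℝ) := by
    rw [LinearEquiv.finrank_eq (LinearMap.toContinuousLinearMap
      (𝕜 := ℝ) (E := EuclideanSpace ℝ (Fin m)) (F' := ℝ)).symm]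
    exact (Subspace.dual_finrank_eq).symm
  -- in the chart, the Liouville field is the image of `α` by the inverse of `v ↦ dα(v, ⬝)`
  have key : ∀ y ∈ (extChartAt (𝓡∂ m) x₀).target,
      (B y).IsInvertible ∧ B y (chartField (𝓡∂ m) (liouvilleField α) x₀ y) =
        e (chartForm (𝓡∂ m) α x₀ y) := by
    intro y hy
    set z := (extChartAt (𝓡∂ m) x₀).symm y with hz
    have hzs : z ∈ (extChartAt (𝓡∂ m) x₀).source := (extChartAt (𝓡∂ m) x₀).map_target hy
    have hyz : y = extChartAt (𝓡∂ m) x₀ z := ((extChartAt (𝓡∂ m) x₀).right_inv hy).symm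
    let D : EuclideanSpace ℝ (Fin m) → EuclideanSpace ℝ (Fin m) := fun v =>
      mfderivWithin 𝓘(ℝ, EuclideanSpace ℝ (Fin m)) (𝓡∂ m) (extChartAt (𝓡∂ m) x₀).symm
        (range (𝓡∂ m)) y v
    have hD : ∀ w : EuclideanSpace ℝ (Fin m), ∃ w', D w' = w := fun w => by
      refine ⟨mfderiv (𝓡∂ m) 𝓘(ℝ, EuclideanSpace ℝ (Fin m)) (extChartAt (𝓡∂ m) x₀) z w, ?_⟩
      simp only [D]
      rw [hyz]
      exact mfderivWithin_symm_mfderiv_extChartAt hzs w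
    have hDinj : ∀ v, D v = 0 → v = 0 := fun v hv => by
      have h := mfderiv_mfderivWithin_symm_extChartAt hzs v
      rw [← hyz] at h
      rw [← h]
      exact (congrArg (mfderiv (𝓡∂ m) 𝓘(ℝ, EuclideanSpace ℝ (Fin m)) (extChartAt (𝓡∂ m) x₀) z)
        hv).trans (map_zero _)
    have hform : ∀ v w, chartForm (𝓡∂ m) (extD (𝓡∂ m) α) x₀ y ![v, w] =
        extD (𝓡∂ m) α z ![D v, D w] := fun v w => by
      change extD (𝓡∂ m) α z (fun i => D (![v, w] i)) = _
      congr 1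
      funext i
      fin_cases i <;> rfl
    constructor
    · have hinj : Function.Injective (B y) := by
        rw [injective_iff_map_eq_zero]
        intro v hv
        have h1 : (chartForm (𝓡∂ m) (extD (𝓡∂ m) α) x₀ y).curryLeft v = 0 :=
          e.injective (hv.trans (map_zero e).symm)
        refine hDinj v (hα.symplectic.nondegenerate z (D v) fun w => ?_)
        obtain ⟨w', hw'⟩ := hD w
        have h2 := congrArg (fun L : EuclideanSpace ℝ (Fin m) [⋀^Fin 1]→L[ℝ] ℝ => L ![w']) h1
        have h3 := hform v w'
        rw [hw'] at h3
        exact h3.symm.trans h2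
      exact ⟨(LinearEquiv.ofInjectiveOfFinrankEq (B y).toLinearMap hinj
        hfin).toContinuousLinearEquiv, by ext; rfl⟩
    · refine congrArg e ?_
      ext v
      rw [show v = ![v 0] by ext i; fin_cases i; rfl]
      change chartForm (𝓡∂ m) (extD (𝓡∂ m) α) x₀ y
        ![chartField (𝓡∂ m) (liouvilleField α) x₀ y, v 0] = chartForm (𝓡∂ m) α x₀ y ![v 0]
      rw [hform]
      have h4 : D (chartField (𝓡∂ m) (liouvilleField α) x₀ y) = liouvilleField α z := by
        simp only [D]
        have h5 := mfderivWithin_symm_mfderiv_extChartAt hzs (liouvilleField α z)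
        rw [← hyz] at h5
        exact h5
      rw [h4]
      refine (liouvilleField_spec hα.symplectic.nondegenerate z (D (v 0))).trans ?_
      change _ = α z (fun i => D (![v 0] i))
      congr 1
      funext i
      fin_cases i; rfl
  have hinv : ContDiffOn ℝ ∞ (fun y => (B y).inverse (e (chartForm (𝓡∂ m) α x₀ y)))
      (extChartAt (𝓡∂ m) x₀).target := by
    refine ContDiffOn.clm_apply (fun y hy => ?_) hl
    obtain ⟨ε, hε⟩ := (key y hy).1
    have h := contDiffAt_map_inverse (𝕜 := ℝ) (n := ∞) ε
    rw [hε] at h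
    exact h.comp_contDiffWithinAt y (hB y hy)
  refine hinv.congr fun y hy => ?_
  obtain ⟨h1, h2⟩ := key y hy
  rw [← h2]
  exact (congrArg (fun L : EuclideanSpace ℝ (Fin m) →L[ℝ] EuclideanSpace ℝ (Fin m) =>
    L (chartField (𝓡∂ m) (liouvilleField α) x₀ y)) h1.inverse_comp_self).symm

end LiouvilleField

/-! ### Differential equations on a half space -/

section HalfSpace

/-- Picard–Lindelöf for a vector field which is Lipschitz on a ball, with the information that the
solutions remain in this ball. -/
theorem LipschitzOnWith.exists_local_flow {E : Type*} [NormedAddCommGroup E] [NormedSpace ℝ E]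
    [CompleteSpace E] {g : E → E} {y₀ : E} {a : ℝ} {L : NNReal} (ha : 0 < a)
    (hg : LipschitzOnWith L g (Metric.closedBall y₀ a)) :
    ∃ r > 0, ∃ δ > 0, ∀ y ∈ Metric.closedBall y₀ r, ∃ u : ℝ → E, u 0 = y ∧
      ∀ t ∈ Icc (-δ) δ, u t ∈ Metric.closedBall y₀ a ∧
        HasDerivWithinAt u (g (u t)) (Icc (-δ) δ) t := by
  set N : ℝ := L * a + ‖g y₀‖ + 1 with hN
  have hN0 : 0 < N := by positivity
  have hb : ∀ x ∈ Metric.closedBall y₀ a, ‖g x‖ ≤ N := fun x hx => by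
    have h1 := hg.norm_sub_le hx (Metric.mem_closedBall_self ha.le)
    have h2 : ‖g x‖ ≤ ‖g x - g y₀‖ + ‖g y₀‖ := norm_le_norm_sub_add _ _
    have h3 : (L : ℝ) * ‖x - y₀‖ ≤ L * a := by
      gcongr
      exact mem_closedBall_iff_norm.1 hx
    linarith
  have hδ : 0 < a / 2 / N := by positivity
  have hmem : (0 : ℝ) ∈ Icc (-(a / 2 / N)) (a / 2 / N) := ⟨by linarith, hδ.le⟩
  have hpl : IsPicardLindelof (fun _ => g) (tmin := -(a / 2 / N)) (tmax := a / 2 / N)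
      ⟨0, hmem⟩ y₀ (.mk a ha.le) (.mk (a / 2) (by positivity)) (.mk N hN0.le)
      L := by
    refine IsPicardLindelof.of_time_independent hb hg ?_
    simp only [NNReal.coe_mk, sub_zero, zero_sub, neg_neg, max_self]
    rw [mul_div_cancel₀ _ hN0.ne']
    linarith
  refine ⟨a / 2, by positivity, a / 2 / N, hδ, fun y hy => ?_⟩
  obtain ⟨α, hα⟩ := ODE.FunSpace.exists_isFixedPt_next hpl hy
  refine ⟨α.compProj, ?_, fun t ht => ⟨α.compProj_mem_closedBall hpl.mul_max_le, ?_⟩⟩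
  · exact (ODE.FunSpace.compProj_val (α := α) (t := ⟨0, hmem⟩)).trans
      ((congrArg (fun β => ODE.FunSpace.toFun β ⟨0, hmem⟩) hα.symm).trans
        (ODE.FunSpace.next_apply₀ hpl hy α))
  · refine (ODE.hasDerivWithinAt_picard_Icc (f := fun _ => g) (t₀ := 0)
      hmem hpl.continuousOn_uncurry
      α.continuous_compProj.continuousOn (fun _ _ => α.compProj_mem_closedBall hpl.mul_max_le)
      y ht).congr_of_mem ?_ ht
    intro t' ht'
    nth_rw 1 [← hα]
    exact (ODE.FunSpace.compProj_of_mem ht').trans (ODE.FunSpace.next_apply hpl hy α)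

variable {m : ℕ} [NeZero m]

/-- The retraction of the Euclidean space onto the half space `{y₀ ≥ 0}`. -/
def halfSpaceRetract (y : EuclideanSpace ℝ (Fin m)) : EuclideanSpace ℝ (Fin m) :=
  y + (max (y 0) 0 - y 0) • EuclideanSpace.single 0 (1 : ℝ)

theorem halfSpaceRetract_apply_zero (y : EuclideanSpace ℝ (Fin m)) :
    halfSpaceRetract y 0 = max (y 0) 0 := by
  simp [halfSpaceRetract]

theorem halfSpaceRetract_of_nonneg {y : EuclideanSpace ℝ (Fin m)} (hy : 0 ≤ y 0) :
    halfSpaceRetract y = y := by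
  simp [halfSpaceRetract, max_eq_left hy]

theorem lipschitzWith_halfSpaceRetract :
    LipschitzWith 3 (halfSpaceRetract : EuclideanSpace ℝ (Fin m) → EuclideanSpace ℝ (Fin m)) := by
  refine LipschitzWith.of_dist_le_mul fun x y => ?_
  rw [dist_eq_norm, dist_eq_norm]
  have h1 : halfSpaceRetract x - halfSpaceRetract y =
      (x - y) + ((max (x 0) 0 - max (y 0) 0) - (x - y) 0) •
        (EuclideanSpace.single 0 (1 : ℝ) : EuclideanSpace ℝ (Fin m)) := by
    simp only [halfSpaceRetract, PiLp.sub_apply]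
    module
  have h2 : |(x - y) 0| ≤ ‖x - y‖ := PiLp.norm_apply_le (x - y) 0
  have h3 : |max (x 0) 0 - max (y 0) 0| ≤ |(x - y) 0| := abs_max_sub_max_le_abs _ _ _
  have h4 : |(max (x 0) 0 - max (y 0) 0) - (x - y) 0| ≤ 2 * ‖x - y‖ :=
    (abs_sub _ _).trans (by linarith)
  rw [h1]
  refine (norm_add_le _ _).trans ?_
  rw [norm_smul, PiLp.norm_single, norm_one, mul_one, Real.norm_eq_abs]
  simp only [NNReal.coe_ofNat]
  linarith

theorem mem_range_halfSpace_iff {y : EuclideanSpace ℝ (Fin m)} : y ∈ range (𝓡∂ m) ↔ 0 ≤ y 0 := by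
  rw [range_modelWithCornersEuclideanHalfSpace]; rfl

/-- A vector field which is Lipschitz on the half space `{y₀ ≥ 0}` near `y₀` and which, if `y₀` is
on the boundary, points outwards at `y₀`, is integrable backwards for a uniform time from all points
near `y₀`, and forwards for the same time or until the boundary is met. -/
theorem exists_halfSpace_local_flow
    {g : EuclideanSpace ℝ (Fin m) → EuclideanSpace ℝ (Fin m)} {y₀ : EuclideanSpace ℝ (Fin m)}
    {a : ℝ} {L : NNReal} (ha : 0 < a)
    (hg : LipschitzOnWith L g (range (𝓡∂ m) ∩ Metric.closedBall y₀ a)) (hy₀ : 0 ≤ y₀ 0)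
    (hout : 0 < y₀ 0 ∨ g y₀ 0 < 0) :
    ∃ r > 0, ∃ δ > 0, ∀ y : EuclideanSpace ℝ (Fin m), 0 ≤ y 0 → y ∈ Metric.closedBall y₀ r →
      ∃ u : ℝ → EuclideanSpace ℝ (Fin m), u 0 = y ∧
        (∀ t ∈ Icc (-δ) δ, u t ∈ Metric.closedBall y₀ a) ∧
        (∀ t ∈ Ico (-δ) 0, 0 < u t 0) ∧
        ∃ T ∈ Icc 0 δ, (∀ t ∈ Icc (-δ) T, 0 ≤ u t 0 ∧
          HasDerivWithinAt u (g (u t)) (Icc (-δ) δ) t) ∧ (u T 0 = 0 ∨ T = δ) := by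
  -- extend the vector field beyond the half space by composition with the retraction, which is
  -- Lipschitz with constant `3`
  have hmaps : ∀ a' : ℝ, 3 * a' ≤ a → MapsTo halfSpaceRetract (Metric.closedBall y₀ a')
      (range (𝓡∂ m) ∩ Metric.closedBall y₀ a) := fun a' ha' y hy => by
    refine ⟨mem_range_halfSpace_iff.2 ?_, ?_⟩
    · rw [halfSpaceRetract_apply_zero]; exact le_max_right _ _
    · rw [Metric.mem_closedBall] at hy ⊢
      have := lipschitzWith_halfSpaceRetract.dist_le_mul y y₀
      rw [halfSpaceRetract_of_nonneg hy₀] at this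
      simp only [NNReal.coe_ofNat] at this
      linarith
  have hlip : ∀ a' : ℝ, 3 * a' ≤ a →
      LipschitzOnWith (L * 3) (g ∘ halfSpaceRetract) (Metric.closedBall y₀ a') := fun a' ha' =>
    hg.comp lipschitzWith_halfSpaceRetract.lipschitzOnWith (hmaps a' ha')
  have hcoord : ∀ x y : EuclideanSpace ℝ (Fin m), |x 0 - y 0| ≤ Dist.dist x y := fun x y => by
    rw [dist_eq_norm]; exact PiLp.norm_apply_le (x - y) 0
  rcases hout with hpos | hneg
  -- at an interior point, a ball of radius at most `y₀ 0 / 2` stays away from the boundary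
  · obtain ⟨r, hr, δ, hδ, H⟩ := (hlip (min (a / 3) (y₀ 0 / 2)) (by
      have := min_le_left (a / 3) (y₀ 0 / 2); linarith)).exists_local_flow
      (lt_min (by positivity) (by positivity))
    refine ⟨r, hr, δ, hδ, fun y _ hyr => ?_⟩
    obtain ⟨u, hu0, hu⟩ := H y hyr
    have hpos' : ∀ t ∈ Icc (-δ) δ, 0 < u t 0 := fun t ht => by
      have h1 := (hcoord (u t) y₀).trans (Metric.mem_closedBall.1 (hu t ht).1)
      have h2 := min_le_right (a / 3) (y₀ 0 / 2)
      have := (abs_le.1 h1).1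
      linarith
    refine ⟨u, hu0, fun t ht => Metric.closedBall_subset_closedBall
      ((min_le_left _ _).trans (by linarith)) (hu t ht).1,
      fun t ht => hpos' t ⟨ht.1, ht.2.le.trans hδ.le⟩, δ, ⟨hδ.le, le_rfl⟩,
      fun t ht => ⟨(hpos' t ht).le, ?_⟩, Or.inr rfl⟩
    have := (hu t ht).2
    rwa [Function.comp_apply, halfSpaceRetract_of_nonneg (hpos' t ht).le] at this
  · -- on a ball of small radius `a'` the first coordinate of the extended field stays negative, so
    -- that the first coordinate decreases along the solutions
    set a' : ℝ := min (a / 3) (-(g y₀ 0) / (2 * (L * 3 + 1))) with ha'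
    have hLp : (0 : ℝ) < 2 * (L * 3 + 1) := by positivity
    have ha'0 : 0 < a' := lt_min (by positivity) (div_pos (by linarith) hLp)
    have ha'a : 3 * a' ≤ a := by
      have := min_le_left (a / 3) (-(g y₀ 0) / (2 * (L * 3 + 1))); linarith
    have hneg' : ∀ x ∈ Metric.closedBall y₀ a', (g ∘ halfSpaceRetract) x 0 < 0 := fun x hx => by
      have h1 := (hlip a' ha'a).dist_le_mul x hx y₀ (Metric.mem_closedBall_self ha'0.le)
      have h2 := hcoord ((g ∘ halfSpaceRetract) x) ((g ∘ halfSpaceRetract) y₀)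
      have h3 : (g ∘ halfSpaceRetract) y₀ = g y₀ := by
        rw [Function.comp_apply, halfSpaceRetract_of_nonneg hy₀]
      rw [h3] at h1 h2
      have h4 : ((L * 3 : NNReal) : ℝ) * Dist.dist x y₀ ≤ (L * 3 + 1) * a' := by
        push_cast
        exact mul_le_mul (by linarith) (Metric.mem_closedBall.1 hx) dist_nonneg (by positivity)
      have h5 : (L * 3 + 1) * a' ≤ -(g y₀ 0) / 2 := by
        have h6 : a' ≤ -(g y₀ 0) / (2 * (L * 3 + 1)) := min_le_right _ _
        rw [le_div_iff₀ hLp] at h6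
        linarith
      have := (abs_le.1 (h2.trans h1)).2
      linarith
    obtain ⟨r, hr, δ, hδ, H⟩ := (hlip a' ha'a).exists_local_flow ha'0
    refine ⟨r, hr, δ, hδ, fun y hy hyr => ?_⟩
    obtain ⟨u, hu0, hu⟩ := H y hyr
    have hcont : ContinuousOn (fun t => u t 0) (Icc (-δ) δ) := fun t ht =>
      ((EuclideanSpace.proj (𝕜 := ℝ) (0 : Fin m)).continuous.continuousAt).comp_continuousWithinAt
        (hu t ht).2.continuousWithinAt
    have hanti : StrictAntiOn (fun t => u t 0) (Icc (-δ) δ) := by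
      refine strictAntiOn_of_deriv_neg (convex_Icc _ _) hcont fun t ht => ?_
      rw [interior_Icc] at ht
      have h1 := (hu t (Ioo_subset_Icc_self ht)).2.hasDerivAt (Icc_mem_nhds ht.1 ht.2)
      have h2 : HasDerivAt (fun t => u t 0) ((g ∘ halfSpaceRetract) (u t) 0) t :=
        ((EuclideanSpace.proj (𝕜 := ℝ) (0 : Fin m)).hasFDerivAt).comp_hasDerivAt t h1
      rw [h2.deriv]
      exact hneg' _ (hu t (Ioo_subset_Icc_self ht)).1
    have h0mem : (0 : ℝ) ∈ Icc (-δ) δ := ⟨by linarith, hδ.le⟩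
    have hu0' : 0 ≤ u 0 0 := by rw [hu0]; exact hy
    have hT : ∃ T ∈ Icc 0 δ, 0 ≤ u T 0 ∧ (u T 0 = 0 ∨ T = δ) := by
      by_cases hδ0 : 0 ≤ u δ 0
      · exact ⟨δ, ⟨hδ.le, le_rfl⟩, hδ0, Or.inr rfl⟩
      · obtain ⟨T, hT, hT0⟩ := intermediate_value_Icc' hδ.le
          (hcont.mono (Icc_subset_Icc_left (by linarith))) ⟨(not_le.1 hδ0).le, hu0'⟩
        exact ⟨T, hT, hT0.ge, Or.inl hT0⟩
    obtain ⟨T, hT, hT0, hTδ⟩ := hT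
    refine ⟨u, hu0, fun t ht => Metric.closedBall_subset_closedBall (by linarith) (hu t ht).1,
      fun t ht => hu0'.trans_lt (hanti ⟨ht.1, ht.2.le.trans hδ.le⟩ h0mem ht.2), T, hT,
      fun t ht => ?_, hTδ⟩
    have htmem : t ∈ Icc (-δ) δ := ⟨ht.1, ht.2.trans hT.2⟩
    have hnn : 0 ≤ u t 0 :=
      hT0.trans (hanti.antitoneOn htmem ⟨by linarith [hT.1], hT.2⟩ ht.2)
    refine ⟨hnn, ?_⟩
    have := (hu t htmem).2
    rwa [Function.comp_apply, halfSpaceRetract_of_nonneg hnn] at this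

end HalfSpace

/-! ### Integral curves of the Liouville field -/

section IntegralCurves

variable {m : ℕ} [NeZero m]
  {F : Type*} [TopologicalSpace F] [ChartedSpace (EuclideanHalfSpace m) F]

theorem extChartAt_apply_zero_nonneg (x₀ x : F) : 0 ≤ extChartAt (𝓡∂ m) x₀ x 0 :=
  mem_range_halfSpace_iff.1 (mem_range_self _)

variable [IsManifold (𝓡∂ m) ∞ F] {α : DForm (𝓡∂ m) F 1}

theorem mem_interior_iff_extChartAt {x₀ x : F} (hx : x ∈ (extChartAt (𝓡∂ m) x₀).source) :
    x ∈ (𝓡∂ m).interior F ↔ 0 < extChartAt (𝓡∂ m) x₀ x 0 := by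
  have hx' := hx
  rw [extChartAt_source] at hx'
  have h := (𝓡∂ m).isInteriorPoint_iff_of_mem_atlas (n := ∞) (M := F) (by simp)
    (chart_mem_atlas _ x₀) hx'
  have h2 : extChartAt (𝓡∂ m) x₀ x ∈ interior (extChartAt (𝓡∂ m) x₀).target ↔
      extChartAt (𝓡∂ m) x₀ x ∈ interior (range (𝓡∂ m)) := by
    refine ⟨fun h => interior_mono (extChartAt_target_subset_range x₀) h, fun h => ?_⟩
    have h3 := extChartAt_target_mem_nhdsWithin' (I := 𝓡∂ m) hx
    rw [nhdsWithin_eq_nhds.2 (mem_interior_iff_mem_nhds.1 h)] at h3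
    exact mem_interior_iff_mem_nhds.2 h3
  rw [interior_range_modelWithCornersEuclideanHalfSpace] at h2
  exact h.trans h2

theorem mem_boundary_iff_extChartAt {x₀ x : F} (hx : x ∈ (extChartAt (𝓡∂ m) x₀).source) :
    x ∈ (𝓡∂ m).boundary F ↔ extChartAt (𝓡∂ m) x₀ x 0 = 0 := by
  rw [← (𝓡∂ m).compl_interior, mem_compl_iff, mem_interior_iff_extChartAt hx, not_lt]
  exact ⟨fun h => h.antisymm (extChartAt_apply_zero_nonneg x₀ x), fun h => h.le⟩

/-- In a chart, the Liouville field is Lipschitz near the centre of the chart. -/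
theorem exists_lipschitzOnWith_chartField (hα : IsLiouvilleForm α) (x₀ : F) :
    ∃ a > 0, ∃ L : NNReal,
      LipschitzOnWith L (chartField (𝓡∂ m) (liouvilleField α) x₀)
        (range (𝓡∂ m) ∩ Metric.closedBall (extChartAt (𝓡∂ m) x₀ x₀) a) ∧
      range (𝓡∂ m) ∩ Metric.closedBall (extChartAt (𝓡∂ m) x₀ x₀) a ⊆
        (extChartAt (𝓡∂ m) x₀).target := by
  have hc : ContDiffWithinAt ℝ 1 (chartField (𝓡∂ m) (liouvilleField α) x₀) (range (𝓡∂ m))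
      (extChartAt (𝓡∂ m) x₀ x₀) :=
    (((contDiffOn_chartField_liouvilleField hα x₀).contDiffWithinAt
      (mem_extChartAt_target x₀)).mono_of_mem_nhdsWithin
      (extChartAt_target_mem_nhdsWithin x₀)).of_le (by exact_mod_cast le_top)
  obtain ⟨L, t, ht, hL⟩ := hc.exists_lipschitzOnWith (𝓡∂ m).convex_range
  obtain ⟨a, ha, hat⟩ := Metric.mem_nhdsWithin_iff.1
    (Filter.inter_mem ht (extChartAt_target_mem_nhdsWithin x₀))
  have hsub : range (𝓡∂ m) ∩ Metric.closedBall (extChartAt (𝓡∂ m) x₀ x₀) (a / 2) ⊆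
      t ∩ (extChartAt (𝓡∂ m) x₀).target := fun y hy =>
    hat ⟨Metric.closedBall_subset_ball (by linarith) hy.2, hy.1⟩
  exact ⟨a / 2, by positivity, L, hL.mono fun y hy => (hsub hy).1, fun y hy => (hsub hy).2⟩

theorem IsMIntegralCurveOn.hasDerivWithinAt_extChartAt' {γ : ℝ → F} {s : Set ℝ}
    (hγ : IsMIntegralCurveOn γ (liouvilleField α) s) {t : ℝ} (ht : t ∈ s) {x₀ : F}
    (hsrc : γ t ∈ (extChartAt (𝓡∂ m) x₀).source) :
    HasDerivWithinAt (fun τ => extChartAt (𝓡∂ m) x₀ (γ τ))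
      (chartField (𝓡∂ m) (liouvilleField α) x₀ (extChartAt (𝓡∂ m) x₀ (γ t))) s t :=
  (hasMFDerivWithinAt_smulRight_iff _ hsrc (hγ t ht).continuousWithinAt).1 (hγ t ht)

/-- Two integral curves of the Liouville field which agree at some point agree nearby. -/
theorem IsMIntegralCurveOn.eventuallyEq (hα : IsLiouvilleForm α) {γ γ' : ℝ → F} {a b t₀ : ℝ}
    (hγ : IsMIntegralCurveOn γ (liouvilleField α) (Icc a b))
    (hγ' : IsMIntegralCurveOn γ' (liouvilleField α) (Icc a b)) (ht₀ : t₀ ∈ Icc a b)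
    (h : γ t₀ = γ' t₀) : γ =ᶠ[𝓝[Icc a b] t₀] γ' := by
  obtain ⟨r, hr, L, hL, -⟩ := exists_lipschitzOnWith_chartField hα (γ t₀)
  set φ := extChartAt (𝓡∂ m) (γ t₀) with hφ
  have hnear : ∀ β : ℝ → F, IsMIntegralCurveOn β (liouvilleField α) (Icc a b) → β t₀ = γ t₀ →
      ∀ᶠ t in 𝓝[Icc a b] t₀, β t ∈ φ.source ∧ φ (β t) ∈ Metric.closedBall (φ (γ t₀)) r := by
    intro β hβ hβ0
    have hc : ContinuousWithinAt β (Icc a b) t₀ := (hβ t₀ ht₀).continuousWithinAt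
    refine hc.eventually (p := fun y => y ∈ φ.source ∧ φ y ∈ Metric.closedBall (φ (γ t₀)) r) ?_
    rw [hβ0]
    exact Filter.Eventually.and (extChartAt_source_mem_nhds _)
      ((continuousAt_extChartAt _).eventually (Metric.closedBall_mem_nhds _ hr))
  obtain ⟨ε, hε, hball⟩ := Metric.mem_nhdsWithin_iff.1 ((hnear γ hγ rfl).and (hnear γ' hγ' h.symm))
  have hin : ∀ t ∈ Icc a b, |t - t₀| < ε →
      (γ t ∈ φ.source ∧ φ (γ t) ∈ Metric.closedBall (φ (γ t₀)) r) ∧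
      (γ' t ∈ φ.source ∧ φ (γ' t) ∈ Metric.closedBall (φ (γ t₀)) r) := fun t ht htε =>
    hball ⟨by rwa [Metric.mem_ball, Real.dist_eq], ht⟩
  have hder : ∀ β : ℝ → F, IsMIntegralCurveOn β (liouvilleField α) (Icc a b) →
      ∀ t ∈ Icc a b, β t ∈ φ.source → HasDerivWithinAt (fun τ => φ (β τ))
        (chartField (𝓡∂ m) (liouvilleField α) (γ t₀) (φ (β t))) (Icc a b) t := fun β hβ t ht hs =>
    hβ.hasDerivWithinAt_extChartAt' ht hs
  have hsubset : Metric.ball t₀ (ε / 2) ∩ Icc a b ⊆ {t | γ t = γ' t} := by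
    rintro t ⟨htε, ht⟩
    rw [Metric.mem_ball, Real.dist_eq] at htε
    have hfin : ∀ τ ∈ uIcc t₀ t, τ ∈ Icc a b ∧ |τ - t₀| < ε := fun τ hτ => by
      refine ⟨ordConnected_Icc.uIcc_subset ht₀ ht hτ, ?_⟩
      have := abs_sub_left_of_mem_uIcc hτ
      linarith
    have hcont : ∀ β : ℝ → F, IsMIntegralCurveOn β (liouvilleField α) (Icc a b) →
        (∀ τ ∈ uIcc t₀ t, β τ ∈ φ.source) → ContinuousOn (fun τ => φ (β τ)) (uIcc t₀ t) :=
      fun β hβ hs τ hτ => ((hder β hβ τ (hfin τ hτ).1 (hs τ hτ)).continuousWithinAt).mono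
        fun τ' hτ' => (hfin τ' hτ').1
    have hs1 : ∀ τ ∈ uIcc t₀ t, γ τ ∈ φ.source := fun τ hτ =>
      (hin τ (hfin τ hτ).1 (hfin τ hτ).2).1.1
    have hs2 : ∀ τ ∈ uIcc t₀ t, γ' τ ∈ φ.source := fun τ hτ =>
      (hin τ (hfin τ hτ).1 (hfin τ hτ).2).2.1
    have hm1 : ∀ τ ∈ uIcc t₀ t, φ (γ τ) ∈ range (𝓡∂ m) ∩ Metric.closedBall (φ (γ t₀)) r :=
      fun τ hτ => ⟨mem_range_self _, (hin τ (hfin τ hτ).1 (hfin τ hτ).2).1.2⟩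
    have hm2 : ∀ τ ∈ uIcc t₀ t, φ (γ' τ) ∈ range (𝓡∂ m) ∩ Metric.closedBall (φ (γ t₀)) r :=
      fun τ hτ => ⟨mem_range_self _, (hin τ (hfin τ hτ).1 (hfin τ hτ).2).2.2⟩
    have heq : φ (γ t) = φ (γ' t) := by
      have h0 : φ (γ t₀) = φ (γ' t₀) := by rw [h]
      rcases le_total t₀ t with hle | hle
      · rw [uIcc_of_le hle] at *
        refine ODE_solution_unique_of_mem_Icc_right
          (v := fun _ => chartField (𝓡∂ m) (liouvilleField α) (γ t₀)) (s := fun _ => _)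
          (fun _ _ => hL) (hcont γ hγ hs1) (fun τ hτ => ?_)
          (fun τ hτ => hm1 τ (Ico_subset_Icc_self hτ)) (hcont γ' hγ' hs2) (fun τ hτ => ?_)
          (fun τ hτ => hm2 τ (Ico_subset_Icc_self hτ)) h0 ⟨hle, le_rfl⟩
        · have hb := (hfin τ (Ico_subset_Icc_self hτ)).1
          exact (hder γ hγ τ hb (hs1 τ (Ico_subset_Icc_self hτ))).mono_of_mem_nhdsWithin
            (Filter.mem_of_superset (Icc_mem_nhdsGE (hτ.2.trans_le ht.2))
              (Icc_subset_Icc_left hb.1))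
        · have hb := (hfin τ (Ico_subset_Icc_self hτ)).1
          exact (hder γ' hγ' τ hb (hs2 τ (Ico_subset_Icc_self hτ))).mono_of_mem_nhdsWithin
            (Filter.mem_of_superset (Icc_mem_nhdsGE (hτ.2.trans_le ht.2))
              (Icc_subset_Icc_left hb.1))
      · rw [uIcc_of_ge hle] at *
        refine ODE_solution_unique_of_mem_Icc_left
          (v := fun _ => chartField (𝓡∂ m) (liouvilleField α) (γ t₀)) (s := fun _ => _)
          (fun _ _ => hL) (hcont γ hγ hs1) (fun τ hτ => ?_)
          (fun τ hτ => hm1 τ (Ioc_subset_Icc_self hτ)) (hcont γ' hγ' hs2) (fun τ hτ => ?_)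
          (fun τ hτ => hm2 τ (Ioc_subset_Icc_self hτ)) h0 ⟨le_rfl, hle⟩
        · have hb := (hfin τ (Ioc_subset_Icc_self hτ)).1
          exact (hder γ hγ τ hb (hs1 τ (Ioc_subset_Icc_self hτ))).mono_of_mem_nhdsWithin
            (Filter.mem_of_superset (Icc_mem_nhdsLE (ht.1.trans_lt hτ.1))
              (Icc_subset_Icc_right hb.2))
        · have hb := (hfin τ (Ioc_subset_Icc_self hτ)).1
          exact (hder γ' hγ' τ hb (hs2 τ (Ioc_subset_Icc_self hτ))).mono_of_mem_nhdsWithin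
            (Filter.mem_of_superset (Icc_mem_nhdsLE (ht.1.trans_lt hτ.1))
              (Icc_subset_Icc_right hb.2))
    exact φ.injOn (hs1 t right_mem_uIcc) (hs2 t right_mem_uIcc) heq
  exact Metric.mem_nhdsWithin_iff.2 ⟨ε / 2, by positivity, hsubset⟩

/-- Uniqueness of integral curves of the Liouville field, up to the boundary. -/
theorem IsMIntegralCurveOn.eqOn_Icc [T2Space F] (hα : IsLiouvilleForm α) {γ γ' : ℝ → F}
    {a b t₀ : ℝ} (hγ : IsMIntegralCurveOn γ (liouvilleField α) (Icc a b))
    (hγ' : IsMIntegralCurveOn γ' (liouvilleField α) (Icc a b)) (ht₀ : t₀ ∈ Icc a b)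
    (h : γ t₀ = γ' t₀) : EqOn γ γ' (Icc a b) := by
  have hc : ∀ β : ℝ → F, IsMIntegralCurveOn β (liouvilleField α) (Icc a b) →
      Continuous ((Icc a b).domRestrict β) := fun β hβ =>
    continuousOn_iff_continuous_domRestrict.1 fun t ht => (hβ t ht).continuousWithinAt
  let S : Set (Icc a b) := {t | γ t = γ' t}
  have hcl : IsClosed S := isClosed_eq (hc γ hγ) (hc γ' hγ')
  have hop : IsOpen S := isOpen_iff_mem_nhds.2 fun t ht => by
    have := IsMIntegralCurveOn.eventuallyEq hα hγ hγ' t.2 ht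
    rw [nhds_subtype_eq_comap_nhdsWithin]
    exact Filter.preimage_mem_comap this
  have : PreconnectedSpace (Icc a b) := Subtype.preconnectedSpace isPreconnected_Icc
  have huniv : S = univ := IsClopen.eq_univ ⟨hcl, hop⟩ ⟨⟨t₀, ht₀⟩, h⟩
  intro t ht
  exact (huniv ▸ mem_univ _ : (⟨t, ht⟩ : Icc a b) ∈ S)

/-- From all points near a given point, the Liouville field can be integrated backwards for a
uniform time, without meeting the boundary, and forwards for the same time or until the boundary is
met. The integral curves remain near the given point. -/
theorem exists_local_integralCurves (hα : IsLiouvilleForm α) (x₀ : F) {O : Set F}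
    (hO : O ∈ 𝓝 x₀) :
    ∃ N ∈ 𝓝 x₀, ∃ δ > 0, ∀ x ∈ N, ∃ γ : ℝ → F, γ 0 = x ∧
      (∀ t ∈ Ico (-δ) 0, γ t ∈ (𝓡∂ m).interior F) ∧
      ∃ T ∈ Icc 0 δ, IsMIntegralCurveOn γ (liouvilleField α) (Icc (-δ) T) ∧
        (∀ t ∈ Icc (-δ) T, γ t ∈ O) ∧ (γ T ∈ (𝓡∂ m).boundary F ∨ T = δ) := by
  obtain ⟨a, ha, L, hL, hsub⟩ := exists_lipschitzOnWith_chartField hα x₀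
  set φ := extChartAt (𝓡∂ m) x₀ with hφ
  -- shrink the ball so that its image lies in `O`
  have hO' : ∀ᶠ y in 𝓝 (φ x₀), φ.symm y ∈ O :=
    (continuousAt_extChartAt_symm x₀).eventually
      (by rw [extChartAt_to_inv]; exact hO)
  obtain ⟨a', ha', haO⟩ := Metric.nhds_basis_closedBall.mem_iff.1 hO'
  set b := min a a' with hb
  have hb0 : 0 < b := lt_min ha ha'
  have hbsub : range (𝓡∂ m) ∩ Metric.closedBall (φ x₀) b ⊆
      range (𝓡∂ m) ∩ Metric.closedBall (φ x₀) a :=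
    inter_subset_inter_right _ (Metric.closedBall_subset_closedBall (min_le_left _ _))
  have hout : 0 < φ x₀ 0 ∨ chartField (𝓡∂ m) (liouvilleField α) x₀ (φ x₀) 0 < 0 := by
    by_cases hx : x₀ ∈ (𝓡∂ m).boundary F
    · right
      have := hα.outward x₀ hx
      rw [chartField_extChartAt _ (mem_extChartAt_source x₀)]
      exact this
    · left
      rw [← mem_interior_iff_extChartAt (mem_extChartAt_source x₀), ← (𝓡∂ m).compl_boundary]
      exact hx
  obtain ⟨r, hr, δ, hδ, H⟩ := exists_halfSpace_local_flow hb0 (hL.mono hbsub)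
    (extChartAt_apply_zero_nonneg x₀ x₀) hout
  refine ⟨φ.source ∩ φ ⁻¹' Metric.closedBall (φ x₀) r, Filter.inter_mem
    (extChartAt_source_mem_nhds x₀)
    ((continuousAt_extChartAt x₀).preimage_mem_nhds (Metric.closedBall_mem_nhds _ hr)), δ, hδ,
    fun x hx => ?_⟩
  obtain ⟨u, hu0, hub, hupos, T, hT, hu, hend⟩ := H (φ x) (extChartAt_apply_zero_nonneg x₀ x) hx.2
  have htar : ∀ t ∈ Icc (-δ) T, u t ∈ φ.target := fun t ht =>
    hsub (hbsub ⟨mem_range_halfSpace_iff.2 (hu t ht).1, hub t ⟨ht.1, ht.2.trans hT.2⟩⟩)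
  have hinv : ∀ t ∈ Icc (-δ) T, φ (φ.symm (u t)) = u t := fun t ht => φ.right_inv (htar t ht)
  have hsrc : ∀ t ∈ Icc (-δ) T, φ.symm (u t) ∈ φ.source := fun t ht => φ.map_target (htar t ht)
  refine ⟨fun t => φ.symm (u t), by simp only [hu0]; exact φ.left_inv hx.1, fun t ht => ?_, T, hT,
    fun t ht => ?_, fun t ht => haO (Metric.closedBall_subset_closedBall (min_le_right _ _)
      (hub t ⟨ht.1, ht.2.trans hT.2⟩)), ?_⟩
  · have ht' : t ∈ Icc (-δ) T := ⟨ht.1, ht.2.le.trans hT.1⟩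
    rw [mem_interior_iff_extChartAt (hsrc t ht'), hinv t ht']
    exact hupos t ht
  · have hd : HasDerivWithinAt u (chartField (𝓡∂ m) (liouvilleField α) x₀ (u t)) (Icc (-δ) T) t :=
      (hu t ht).2.mono (Icc_subset_Icc_right hT.2)
    have hc : ContinuousWithinAt (fun t => φ.symm (u t)) (Icc (-δ) T) t :=
      (continuousAt_extChartAt_symm'' (htar t ht)).comp_continuousWithinAt hd.continuousWithinAt
    rw [hasMFDerivWithinAt_smulRight_iff (liouvilleField α) (x₀ := x₀) (hsrc t ht) hc, hinv t ht]
    exact hd.congr (fun τ hτ => hinv τ hτ) (hinv t ht)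
  · have hTm : T ∈ Icc (-δ) T := ⟨by linarith [hT.1], le_rfl⟩
    refine hend.imp_left fun h => ?_
    rw [mem_boundary_iff_extChartAt (hsrc T hTm), hinv T hTm]
    exact h

end IntegralCurves

/-! ### The backward semiflow of a Liouville domain and the skeleton -/

section Gluing

variable {E : Type*} [NormedAddCommGroup E] [NormedSpace ℝ E]
  {H : Type*} [TopologicalSpace H] {I : ModelWithCorners ℝ E H}
  {M : Type*} [TopologicalSpace M] [ChartedSpace H M] {Y : ∀ x : M, TangentSpace I x}

theorem HasMFDerivWithinAt.smulRight_congr {γ γ' : ℝ → M} {s : Set ℝ} {t : ℝ}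
    (h : HasMFDerivWithinAt 𝓘(ℝ, ℝ) I γ s t ((1 : ℝ →L[ℝ] ℝ).smulRight (Y (γ t))))
    (heq : γ' =ᶠ[𝓝[s] t] γ) (ht : γ' t = γ t) :
    HasMFDerivWithinAt 𝓘(ℝ, ℝ) I γ' s t ((1 : ℝ →L[ℝ] ℝ).smulRight (Y (γ' t))) := by
  refine (h.congr_of_eventuallyEq heq ht).congr_mfderiv ?_
  have key : ∀ z w : M, z = w → ((1 : ℝ →L[ℝ] ℝ).smulRight (Y z) : ℝ →L[ℝ] E) =
      ((1 : ℝ →L[ℝ] ℝ).smulRight (Y w) : ℝ →L[ℝ] E) := by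
    rintro z w rfl; rfl
  exact key _ _ ht.symm

/-- Two integral curves which match at an endpoint can be glued. -/
theorem IsMIntegralCurveOn.glue {γ₁ γ₂ : ℝ → M} {a b c : ℝ} (hab : a ≤ b) (hbc : b ≤ c)
    (h₁ : IsMIntegralCurveOn γ₁ Y (Icc a b)) (h₂ : IsMIntegralCurveOn γ₂ Y (Icc b c))
    (h : γ₁ b = γ₂ b) :
    IsMIntegralCurveOn (fun t => if t ≤ b then γ₁ t else γ₂ t) Y (Icc a c) := by
  set γ : ℝ → M := fun t => if t ≤ b then γ₁ t else γ₂ t with hγ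
  have e₁ : EqOn γ γ₁ (Icc a b) := fun t ht => if_pos ht.2
  have e₂ : EqOn γ γ₂ (Icc b c) := fun t ht => by
    rcases ht.1.eq_or_lt with rfl | hlt
    · exact (if_pos le_rfl).trans h
    · exact if_neg hlt.not_ge
  have h₁' : IsMIntegralCurveOn γ Y (Icc a b) := fun t ht =>
    (h₁ t ht).smulRight_congr (Filter.eventuallyEq_of_mem self_mem_nhdsWithin e₁) (e₁ ht)
  have h₂' : IsMIntegralCurveOn γ Y (Icc b c) := fun t ht =>
    (h₂ t ht).smulRight_congr (Filter.eventuallyEq_of_mem self_mem_nhdsWithin e₂) (e₂ ht)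
  intro t ht
  rcases lt_trichotomy t b with hlt | rfl | hgt
  · refine (h₁' t ⟨ht.1, hlt.le⟩).mono_of_mem_nhdsWithin ?_
    refine mem_nhdsWithin.2 ⟨Iio b, isOpen_Iio, hlt, fun τ hτ => ⟨hτ.2.1, le_of_lt hτ.1⟩⟩
  · rw [← Icc_union_Icc_eq_Icc hab hbc]
    exact (h₁' t ⟨hab, le_rfl⟩).union (h₂' t ⟨le_rfl, hbc⟩)
  · refine (h₂' t ⟨hgt.le, ht.2⟩).mono_of_mem_nhdsWithin ?_
    refine mem_nhdsWithin.2 ⟨Ioi b, isOpen_Ioi, hgt, fun τ hτ => ⟨le_of_lt hτ.1, hτ.2.2⟩⟩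

theorem IsMIntegralCurveOn.shift {γ : ℝ → M} {s s' : Set ℝ} (h : IsMIntegralCurveOn γ Y s) (d : ℝ)
    (hs : ∀ t ∈ s', t + d ∈ s) : IsMIntegralCurveOn (fun t => γ (t + d)) Y s' :=
  (h.comp_add d).mono hs

end Gluing

section Semiflow

variable {m : ℕ} [NeZero m]
  {F : Type*} [TopologicalSpace F] [ChartedSpace (EuclideanHalfSpace m) F]

/-- The backward semiflow of the Liouville field: `Ψ x` is the integral curve of the Liouville field
on `(-∞, 0]` which ends at `x`, and it does not meet the boundary at negative times. -/
structure IsBackwardSemiflow (α : DForm (𝓡∂ m) F 1) (Ψ : F → ℝ → F) : Prop where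
  zero : ∀ x, Ψ x 0 = x
  integral : ∀ x, IsMIntegralCurveOn (Ψ x) (liouvilleField α) (Iic 0)
  interior : ∀ x, ∀ t < 0, Ψ x t ∈ (𝓡∂ m).interior F

variable [IsManifold (𝓡∂ m) ∞ F] {α : DForm (𝓡∂ m) F 1}

/-- On a compact Liouville domain the time of local integrability can be chosen uniformly. -/
theorem exists_uniform_integralCurves [CompactSpace F] (hα : IsLiouvilleForm α) :
    ∃ δ > 0, ∀ x : F, ∃ γ : ℝ → F, γ 0 = x ∧
      (∀ t ∈ Ico (-δ) 0, γ t ∈ (𝓡∂ m).interior F) ∧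
      ∃ T ∈ Icc 0 δ, IsMIntegralCurveOn γ (liouvilleField α) (Icc (-δ) T) ∧
        (γ T ∈ (𝓡∂ m).boundary F ∨ T = δ) := by
  let good : ℝ → F → Prop := fun δ x => ∃ γ : ℝ → F, γ 0 = x ∧
      (∀ t ∈ Ico (-δ) 0, γ t ∈ (𝓡∂ m).interior F) ∧
      ∃ T ∈ Icc 0 δ, IsMIntegralCurveOn γ (liouvilleField α) (Icc (-δ) T) ∧
        (γ T ∈ (𝓡∂ m).boundary F ∨ T = δ)
  have hmono : ∀ {δ δ' : ℝ} {x : F}, 0 < δ' → δ' ≤ δ → good δ x → good δ' x := by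
    rintro δ δ' x h0 hle ⟨γ, h1, h2, T, hT, h3, h4⟩
    refine ⟨γ, h1, fun t ht => h2 t ⟨by linarith [ht.1], ht.2⟩, min T δ',
      ⟨le_min hT.1 h0.le, min_le_right _ _⟩,
      h3.mono (Icc_subset_Icc (by linarith) (min_le_left _ _)), ?_⟩
    rcases le_total T δ' with h | h
    · rw [min_eq_left h]
      rcases h4 with h4 | rfl
      · exact Or.inl h4
      · exact Or.inr (le_antisymm h hle)
    · exact Or.inr (min_eq_right h)
  have key : ∃ δ > 0, ∀ x ∈ (univ : Set F), good δ x := by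
    refine isCompact_univ.induction_on (p := fun s => ∃ δ > 0, ∀ x ∈ s, good δ x) ?_ ?_ ?_ ?_
    · exact ⟨1, one_pos, fun x hx => hx.elim⟩
    · rintro s t hst ⟨δ, hδ, h⟩
      exact ⟨δ, hδ, fun x hx => h x (hst hx)⟩
    · rintro s t ⟨δ, hδ, h⟩ ⟨δ', hδ', h'⟩
      refine ⟨min δ δ', lt_min hδ hδ', fun x hx => ?_⟩
      rcases hx with hx | hx
      · exact hmono (lt_min hδ hδ') (min_le_left _ _) (h x hx)
      · exact hmono (lt_min hδ hδ') (min_le_right _ _) (h' x hx)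
    · intro x _
      obtain ⟨N, hN, δ, hδ, h⟩ := exists_local_integralCurves hα x Filter.univ_mem
      refine ⟨N, mem_nhdsWithin_of_mem_nhds hN, δ, hδ, fun y hy => ?_⟩
      obtain ⟨γ, h1, h2, T, hT, h3, -, h4⟩ := h y hy
      exact ⟨γ, h1, h2, T, hT, h3, h4⟩
  obtain ⟨δ, hδ, h⟩ := key
  exact ⟨δ, hδ, fun x => h x (mem_univ x)⟩

/-- On a compact Liouville domain the Liouville field can be integrated backwards for all times, by
concatenation of curves defined for a uniform time. -/
theorem exists_isBackwardSemiflow [CompactSpace F] [T2Space F] (hα : IsLiouvilleForm α) :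
    ∃ Ψ : F → ℝ → F, IsBackwardSemiflow α Ψ := by
  obtain ⟨δ, hδ, hunif⟩ := exists_uniform_integralCurves hα
  have hN : ∀ (N : ℕ) (x : F), ∃ γ : ℝ → F, γ 0 = x ∧
      IsMIntegralCurveOn γ (liouvilleField α) (Icc (-(N * δ)) 0) ∧
      ∀ t ∈ Ico (-(N * δ)) 0, γ t ∈ (𝓡∂ m).interior F := by
    intro N
    induction N with
    | zero =>
      intro x
      obtain ⟨γ, h1, h2, T, hT, h3, -⟩ := hunif x
      refine ⟨γ, h1, h3.mono ?_, fun t ht => ?_⟩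
      · exact Icc_subset_Icc (by simp [hδ.le]) hT.1
      · simp only [Nat.cast_zero, zero_mul, neg_zero, Ico_self] at ht
        exact ht.elim
    | succ N ih =>
      intro x
      obtain ⟨γ₁, h1, h2, T, hT, h3, -⟩ := hunif x
      obtain ⟨γ₂, g1, g2, g3⟩ := ih (γ₁ (-δ))
      have hNδ : (0 : ℝ) ≤ N * δ := by positivity
      have hs : -(((N + 1 : ℕ) : ℝ) * δ) = -(N * δ) - δ := by push_cast; ring
      rw [hs]
      refine ⟨fun t => if t ≤ -δ then γ₂ (t + δ) else γ₁ t, ?_, ?_, fun t ht => ?_⟩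
      · simp [hδ, h1]
      · refine IsMIntegralCurveOn.glue (by linarith) (by linarith)
          (g2.shift δ fun t ht => ⟨by linarith [ht.1], by linarith [ht.2]⟩)
          (h3.mono (Icc_subset_Icc_right hT.1)) (by simp [g1])
      · by_cases hle : t ≤ -δ
        · simp only [hle, if_true]
          rcases hle.eq_or_lt with rfl | hlt
          · rw [neg_add_cancel, g1]
            exact h2 _ ⟨le_rfl, ht.2⟩
          · exact g3 _ ⟨by linarith [ht.1], by linarith⟩
        · simp only [hle, if_false]
          exact h2 _ ⟨(not_le.1 hle).le, ht.2⟩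
  choose γ hγ0 hγ hγi using hN
  -- the number of steps of length `δ` which lead beyond the time `t`
  let n : ℝ → ℕ := fun t => ⌈-t / δ⌉₊ + 1
  have hn : ∀ t : ℝ, -(n t * δ) < t := fun t => by
    have h1 : -t / δ < n t := (Nat.le_ceil _).trans_lt (by simp [n])
    rw [div_lt_iff₀ hδ] at h1
    linarith
  have heq : ∀ (N : ℕ) (x : F), EqOn (fun t => γ (n t) x t) (γ N x) (Icc (-(N * δ)) 0) := by
    intro N x t ht
    have hsub : ∀ N' : ℕ, min N (n t) ≤ N' →
        Icc (-((min N (n t) : ℕ) * δ)) 0 ⊆ Icc (-((N' : ℝ) * δ)) 0 := fun N' h =>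
      Icc_subset_Icc_left (neg_le_neg (by gcongr))
    refine IsMIntegralCurveOn.eqOn_Icc (t₀ := 0) hα ((hγ (n t) x).mono (hsub _ (min_le_right _ _)))
      ((hγ N x).mono (hsub _ (min_le_left _ _))) ⟨neg_nonpos.2 (by positivity), le_rfl⟩
      ((hγ0 _ x).trans (hγ0 _ x).symm) ⟨?_, ht.2⟩
    rcases min_choice N (n t) with h | h <;> rw [h]
    · exact ht.1
    · exact (hn t).le
  refine ⟨fun x t => γ (n t) x t, fun x => hγ0 _ x, fun x t ht => ?_, fun x t ht =>
    hγi _ x t ⟨(hn t).le, ht⟩⟩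
  have hmem : Icc (-(n t * δ)) 0 ∈ 𝓝[Iic 0] t :=
    mem_nhdsWithin.2 ⟨Ioi _, isOpen_Ioi, hn t, fun τ hτ => ⟨le_of_lt hτ.1, hτ.2⟩⟩
  have h1 := (hγ (n t) x t ⟨(hn t).le, ht⟩).mono_of_mem_nhdsWithin hmem
  exact h1.smulRight_congr (Filter.eventuallyEq_of_mem hmem (heq (n t) x)) rfl

namespace IsBackwardSemiflow

variable [T2Space F] {Ψ : F → ℝ → F}

/-- An integral curve is determined by its endpoint. -/
theorem eq_of_integralCurve (hΨ : IsBackwardSemiflow α Ψ) (hα : IsLiouvilleForm α) {γ : ℝ → F}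
    {a b t : ℝ} (hγ : IsMIntegralCurveOn γ (liouvilleField α) (Icc a b)) (ht : t ∈ Icc a b) :
    γ t = Ψ (γ b) (t - b) := by
  have h1 : IsMIntegralCurveOn (fun τ => Ψ (γ b) (τ + -b)) (liouvilleField α) (Icc a b) :=
    (hΨ.integral (γ b)).shift (-b) fun τ hτ => by simpa using hτ.2
  have hb : b ∈ Icc a b := ⟨ht.1.trans ht.2, le_rfl⟩
  exact hγ.eqOn_Icc hα h1 hb (by simp [hΨ.zero]) ht

theorem add (hΨ : IsBackwardSemiflow α Ψ) (hα : IsLiouvilleForm α) (x : F) {s t : ℝ} (hs : s ≤ 0)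
    (ht : t ≤ 0) : Ψ (Ψ x s) t = Ψ x (s + t) := by
  have h := hΨ.eq_of_integralCurve hα (γ := Ψ x) (a := s + t) (b := s) (t := s + t)
    ((hΨ.integral x).mono fun τ hτ => hτ.2.trans hs) ⟨le_rfl, by linarith⟩
  rw [h, add_sub_cancel_left]

theorem injective (hΨ : IsBackwardSemiflow α Ψ) (hα : IsLiouvilleForm α) {x y : F} {t : ℝ}
    (ht : t ≤ 0) (h : Ψ x t = Ψ y t) : x = y := by
  have h1 := IsMIntegralCurveOn.eqOn_Icc hα ((hΨ.integral x).mono fun τ (hτ : τ ∈ Icc t 0) => hτ.2)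
    ((hΨ.integral y).mono fun τ hτ => hτ.2) ⟨le_rfl, ht⟩ h ⟨ht, le_rfl⟩
  rwa [hΨ.zero, hΨ.zero] at h1

/-- The complement of the skeleton consists of the points which the backward semiflow reaches from
the boundary. -/
theorem notMem_skeleton_iff (hΨ : IsBackwardSemiflow α Ψ) (hα : IsLiouvilleForm α) {x : F} :
    x ∉ skeleton α ↔ ∃ y ∈ (𝓡∂ m).boundary F, ∃ t ≤ 0, Ψ y t = x := by
  simp only [skeleton, Set.mem_ofPred_eq, not_not]
  constructor
  · rintro ⟨T, γ, hT, hγ0, hγ, hγT⟩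
    refine ⟨γ T, hγT, -T, by linarith, ?_⟩
    rw [← hγ0, hΨ.eq_of_integralCurve hα hγ (t := 0) ⟨le_rfl, hT⟩, zero_sub]
  · rintro ⟨y, hy, t, ht, rfl⟩
    refine ⟨-t, fun s => Ψ y (s + t), by linarith, by simp, ?_, by simpa [hΨ.zero] using hy⟩
    exact (hΨ.integral y).shift t fun s hs => by
      have := hs.2
      simp only [mem_Iic]; linarith

omit [IsManifold (𝓡∂ m) ∞ F] [T2Space F] in
theorem eq_zero_of_mem_boundary (hΨ : IsBackwardSemiflow α Ψ) {x : F} {t : ℝ} (ht : t ≤ 0)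
    (h : Ψ x t ∈ (𝓡∂ m).boundary F) : t = 0 := by
  by_contra h0
  have h1 := hΨ.interior x t (lt_of_le_of_ne ht h0)
  rw [← (𝓡∂ m).compl_boundary] at h1
  exact h1 h

/-- A point outside the skeleton determines the boundary point from which it is reached, and the
time. -/
theorem eq_and_eq (hΨ : IsBackwardSemiflow α Ψ) (hα : IsLiouvilleForm α) {x y : F} {s t : ℝ}
    (hx : x ∈ (𝓡∂ m).boundary F) (hy : y ∈ (𝓡∂ m).boundary F) (hs : s ≤ 0) (ht : t ≤ 0)
    (h : Ψ x s = Ψ y t) : s = t ∧ x = y := by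
  wlog hle : s ≤ t generalizing x y s t
  · obtain ⟨h1, h2⟩ := this hy hx ht hs h.symm (not_le.1 hle).le
    exact ⟨h1.symm, h2.symm⟩
  have h1 : Ψ x s = Ψ (Ψ x (s - t)) t := by
    rw [hΨ.add hα x (by linarith) ht, sub_add_cancel]
  have h2 : Ψ x (s - t) = y := hΨ.injective hα ht (h1.symm.trans h)
  have h3 : s - t = 0 := hΨ.eq_zero_of_mem_boundary (x := x) (by linarith) (h2 ▸ hy)
  refine ⟨by linarith, ?_⟩
  rwa [h3, hΨ.zero] at h2

/-- For a suitable time `-δ`, the backward semiflow restricts to a bijection of the skeleton: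
points of the skeleton can be flown forwards because they do not exit. -/
theorem exists_bijOn_skeleton [CompactSpace F] (hΨ : IsBackwardSemiflow α Ψ)
    (hα : IsLiouvilleForm α) :
    ∃ δ > 0, BijOn (fun x => Ψ x (-δ)) (skeleton α) (skeleton α) := by
  obtain ⟨δ, hδ, hunif⟩ := exists_uniform_integralCurves hα
  refine ⟨δ, hδ, fun x hx => ?_, fun x _ y _ h => hΨ.injective hα (by linarith) h, fun z hz => ?_⟩
  · by_contra hcon
    obtain ⟨y, hy, t, ht, h⟩ := (hΨ.notMem_skeleton_iff hα).1 hcon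
    rcases le_or_gt t (-δ) with hle | hgt
    · have h1 : Ψ (Ψ y (t + δ)) (-δ) = Ψ y t := by
        rw [hΨ.add hα y (by linarith) (by linarith)]; congr 1; ring
      have h2 : Ψ y (t + δ) = x := hΨ.injective hα (by linarith) (h1.trans h)
      exact (hΨ.notMem_skeleton_iff hα).2 ⟨y, hy, t + δ, by linarith, h2⟩ hx
    · have h1 : Ψ (Ψ x (-δ - t)) t = Ψ x (-δ) := by
        rw [hΨ.add hα x (by linarith) ht]; congr 1; ring
      have h2 : Ψ x (-δ - t) = y := hΨ.injective hα ht (h1.trans h.symm)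
      have := hΨ.eq_zero_of_mem_boundary (x := x) (t := -δ - t) (by linarith) (h2 ▸ hy)
      linarith
  · obtain ⟨γ, h1, -, T, hT, h3, h4⟩ := hunif z
    have h3' : IsMIntegralCurveOn γ (liouvilleField α) (Icc 0 T) :=
      h3.mono (Icc_subset_Icc_left (by linarith))
    have hbd : γ T ∉ (𝓡∂ m).boundary F := fun h => hz ⟨T, γ, hT.1, h1, h3', h⟩
    obtain rfl : T = δ := h4.resolve_left hbd
    have hz' : Ψ (γ T) (-T) = z := by
      rw [← h1, hΨ.eq_of_integralCurve hα h3' (t := 0) ⟨le_rfl, hT.1⟩, zero_sub]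
    refine ⟨γ T, ?_, hz'⟩
    by_contra hcon
    obtain ⟨y, hy, t, ht, h⟩ := (hΨ.notMem_skeleton_iff hα).1 hcon
    refine (hΨ.notMem_skeleton_iff hα).2 ⟨y, hy, t + -T, by linarith, ?_⟩ hz
    rw [← hΨ.add hα y ht (by linarith), h, hz']

end IsBackwardSemiflow

end Semiflow

/-! ### Smooth dependence of the backward semiflow on the initial point -/

section SmoothFlow

variable {m : ℕ} [NeZero m]
  {F : Type*} [TopologicalSpace F] [ChartedSpace (EuclideanHalfSpace m) F]
  [IsManifold (𝓡∂ m) ∞ F] {α : DForm (𝓡∂ m) F 1}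

/-- The local flow of the Liouville field near an interior point. Its class of smoothness is finite
because the neighbourhood on which it is known to be of class `C^n` depends on `n`. -/
theorem exists_contMDiffAt_local_flow (hα : IsLiouvilleForm α) {y₀ : F}
    (hy₀ : y₀ ∈ (𝓡∂ m).interior F) (n : ℕ) (hn : n ≠ 0) :
    ∃ Φ : F × ℝ → F, ContMDiffAt ((𝓡∂ m).prod 𝓘(ℝ, ℝ)) (𝓡∂ m) n Φ (y₀, 0) ∧
      ∃ N ∈ 𝓝 y₀, ∃ δ > 0, ∀ y ∈ N, Φ (y, 0) = y ∧
        IsMIntegralCurveOn (fun t => Φ (y, t)) (liouvilleField α) (Ioo (-δ) δ) := by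
  set φ := extChartAt (𝓡∂ m) y₀ with hφ
  have htar : φ.target ∈ 𝓝 (φ y₀) := by
    have h1 : (𝓡∂ m).IsInteriorPoint y₀ := hy₀
    have h2 : range (𝓡∂ m) ∈ 𝓝 (φ y₀) := mem_interior_iff_mem_nhds.1 h1
    have h3 := extChartAt_target_mem_nhdsWithin (I := 𝓡∂ m) y₀
    rwa [nhdsWithin_eq_nhds.2 h2] at h3
  have hmem : φ y₀ ∈ interior φ.target := mem_interior_iff_mem_nhds.2 htar
  obtain ⟨Φ, hΦ, hev⟩ := ContDiffOn.exists_contDiff_local_flow isOpen_interior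
    ((contDiffOn_chartField_liouvilleField hα y₀).mono interior_subset) hmem n hn
  have hΦ0 : Φ (φ y₀, 0) = φ y₀ := hev.self_of_nhds.1
  have hcont : ContinuousAt Φ (φ y₀, 0) := hΦ.continuousAt
  have hev2 : ∀ᶠ y in 𝓝 (φ y₀, (0 : ℝ)), Φ y ∈ φ.target ∧ ContinuousAt Φ y ∧
      Φ (y.1, 0) = y.1 ∧
      HasDerivAt (fun t => Φ (y.1, t)) (chartField (𝓡∂ m) (liouvilleField α) y₀ (Φ y)) y.2 := by
    have h1 : ∀ᶠ y in 𝓝 (φ y₀, (0 : ℝ)), Φ y ∈ φ.target :=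
      hcont.eventually (by rw [hΦ0]; exact htar)
    have h2 : ∀ᶠ y in 𝓝 (φ y₀, (0 : ℝ)), ContDiffAt ℝ n Φ y := hΦ.eventually (by simp)
    filter_upwards [hev, h1, h2] with y a b c using ⟨b, c.continuousAt, a⟩
  rw [nhds_prod_eq] at hev2
  obtain ⟨p, hp, p', hp', hpp⟩ := Filter.eventually_prod_iff.1 hev2
  obtain ⟨δ, hδ, hball⟩ := Metric.mem_nhds_iff.1 hp'
  have hφc : ContinuousAt φ y₀ := continuousAt_extChartAt y₀
  refine ⟨fun z => φ.symm (Φ (φ z.1, z.2)), ?_, {y | p (φ y)} ∩ φ.source,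
    Filter.inter_mem (hφc.eventually hp) (extChartAt_source_mem_nhds y₀), δ, hδ, fun y hy => ?_⟩
  · have h1 : ContMDiffAt 𝓘(ℝ, EuclideanSpace ℝ (Fin m)) (𝓡∂ m) n φ.symm (φ y₀) :=
      ((contMDiffOn_extChartAt_symm (n := ∞) y₀).of_le (by exact_mod_cast le_top)).contMDiffAt htar
    have h2 : ContMDiffAt ((𝓡∂ m).prod 𝓘(ℝ, ℝ)) 𝓘(ℝ, EuclideanSpace ℝ (Fin m) × ℝ) n
        (fun z : F × ℝ => (φ z.1, z.2)) (y₀, 0) := by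
      refine ContMDiffAt.prodMk_space ?_ contMDiffAt_snd
      exact ContMDiffAt.comp (y₀, (0 : ℝ)) (g := φ) (f := Prod.fst)
        ((contMDiffAt_extChartAt (n := ∞)).of_le (by exact_mod_cast le_top)) contMDiffAt_fst
    have h3 := ContMDiffAt.comp (y₀, (0 : ℝ)) (g := Φ) (f := fun z : F × ℝ => (φ z.1, z.2))
      hΦ.contMDiffAt h2
    refine ContMDiffAt.comp (y₀, (0 : ℝ)) (g := φ.symm)
      (f := fun z : F × ℝ => Φ (φ z.1, z.2)) ?_ h3
    change ContMDiffAt _ _ _ _ (Φ (φ y₀, 0))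
    rwa [hΦ0]
  · have hx : ∀ t ∈ Ioo (-δ) δ, _ := fun t ht =>
      hpp hy.1 (hball (show t ∈ Metric.ball (0 : ℝ) δ by
        rw [Metric.mem_ball, Real.dist_eq, sub_zero, abs_lt]; exact ht))
    have h0 := (hx 0 ⟨by linarith, hδ⟩).2.2.1
    refine ⟨by simp only [h0]; exact φ.left_inv hy.2, fun t ht => ?_⟩
    obtain ⟨ha, hb, -, hd⟩ := hx t ht
    have hc : ContinuousWithinAt (fun t => φ.symm (Φ (φ y, t))) (Ioo (-δ) δ) t :=
      (continuousAt_extChartAt_symm'' ha).comp_continuousWithinAt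
        (f := fun t => Φ (φ y, t)) hd.continuousAt.continuousWithinAt
    rw [hasMFDerivWithinAt_smulRight_iff (liouvilleField α) (x₀ := y₀) (φ.map_target ha) hc,
      φ.right_inv ha]
    refine hd.hasDerivWithinAt.congr (fun τ hτ => φ.right_inv (hx τ hτ).1) (φ.right_inv ha)

namespace IsBackwardSemiflow

variable [T2Space F] {Ψ : F → ℝ → F}

omit [IsManifold (𝓡∂ m) ∞ F] [T2Space F] in
theorem continuousAt_apply (hΨ : IsBackwardSemiflow α Ψ) (x : F) {t : ℝ} (ht : t < 0) :
    ContinuousAt (Ψ x) t :=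
  ((hΨ.integral x) t ht.le).continuousWithinAt.continuousAt (Iic_mem_nhds ht)

/-- Where the semiflow stays close to an interior point, it is given by a local flow. -/
theorem eq_local_flow (hΨ : IsBackwardSemiflow α Ψ) (hα : IsLiouvilleForm α) {Φ : F × ℝ → F}
    {y : F} {δ : ℝ} (hδ : 0 < δ) (h0 : Φ (y, 0) = y)
    (hΦ : IsMIntegralCurveOn (fun t => Φ (y, t)) (liouvilleField α) (Ioo (-δ) δ))
    {x : F} {t₁ s : ℝ} (ht₁ : t₁ ≤ 0) (hy : Ψ x t₁ = y) (hs : s ≤ 0) (hst : |s - t₁| < δ) :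
    Ψ x s = Φ (y, s - t₁) := by
  have hst' := abs_lt.1 hst
  have hsub : ∀ τ ∈ uIcc t₁ s, τ ≤ 0 ∧ τ + -t₁ ∈ Ioo (-δ) δ := fun τ hτ => by
    rcases le_total t₁ s with h | h
    · rw [uIcc_of_le h] at hτ
      exact ⟨hτ.2.trans hs, by linarith [hτ.1], by linarith [hτ.2]⟩
    · rw [uIcc_of_ge h] at hτ
      exact ⟨hτ.2.trans ht₁, by linarith [hτ.1], by linarith [hτ.2]⟩
  exact IsMIntegralCurveOn.eqOn_Icc (γ := Ψ x) (γ' := fun τ => Φ (y, τ + -t₁)) (t₀ := t₁) hα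
    ((hΨ.integral x).mono fun τ hτ => (hsub τ hτ).1)
    (IsMIntegralCurveOn.shift (γ := fun τ => Φ (y, τ)) hΦ (-t₁) fun τ hτ => (hsub τ hτ).2)
    left_mem_uIcc (by simp [hy, h0]) right_mem_uIcc

variable {E₁ : Type*} [NormedAddCommGroup E₁] [NormedSpace ℝ E₁]

/-- If the flow-out of `c₀` is smooth at a parameter `u` for some negative time, it is so for all
negative times. -/
theorem contMDiffAt_of_contMDiffAt (hΨ : IsBackwardSemiflow α Ψ) (hα : IsLiouvilleForm α)
    {c₀ : E₁ → F} {u : E₁} {n : ℕ} (hn : n ≠ 0) {t₀ : ℝ} (ht₀ : t₀ < 0)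
    (h : ContMDiffAt 𝓘(ℝ, E₁ × ℝ) (𝓡∂ m) n (fun z : E₁ × ℝ => Ψ (c₀ z.1) z.2) (u, t₀))
    {t : ℝ} (ht : t < 0) :
    ContMDiffAt 𝓘(ℝ, E₁ × ℝ) (𝓡∂ m) n (fun z : E₁ × ℝ => Ψ (c₀ z.1) z.2) (u, t) := by
  let f : E₁ × ℝ → F := fun z => Ψ (c₀ z.1) z.2
  -- the times of smoothness form an open set, which contains its limit points in `(-∞, 0)`: from a
  -- time of smoothness `t₁` close to `s`, the local flow near `Ψ (c₀ u) s` leads to time `s`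
  let S : Set ℝ := {t | ContMDiffAt 𝓘(ℝ, E₁ × ℝ) (𝓡∂ m) n f (u, t)}
  have hS : IsOpen S := isOpen_iff_mem_nhds.2 fun t ht => by
    have h1 : ∀ᶠ z in 𝓝 (u, t), ContMDiffAt 𝓘(ℝ, E₁ × ℝ) (𝓡∂ m) n f z :=
      (contMDiffAt_iff_contMDiffAt_nhds (by simp)).1 ht
    exact (Continuous.prodMk_right u).continuousAt.eventually h1
  refine isPreconnected_Iio.subset_of_closure_inter_subset hS ⟨t₀, ht₀, h⟩ ?_ ht
  rintro s ⟨hs, hs0⟩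
  obtain ⟨Φ, hΦ, N, hN, δ, hδ, hint⟩ := exists_contMDiffAt_local_flow hα
    (hΨ.interior (c₀ u) s hs0) n hn
  have hc : ContinuousAt (Ψ (c₀ u)) s := hΨ.continuousAt_apply _ hs0
  have e1 : ∀ᶠ t in 𝓝 s, Ψ (c₀ u) t ∈ _root_.interior N :=
    hc.eventually (interior_mem_nhds.2 hN)
  have e2 : ∀ᶠ t in 𝓝 s,
      ContMDiffAt ((𝓡∂ m).prod 𝓘(ℝ, ℝ)) (𝓡∂ m) n Φ (Ψ (c₀ u) t, s - t) := by
    have h1 : ContinuousAt (fun t => (Ψ (c₀ u) t, s - t)) s :=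
      hc.prodMk (by fun_prop)
    have h2 : ∀ᶠ z in 𝓝 (Ψ (c₀ u) s, (0 : ℝ)),
        ContMDiffAt ((𝓡∂ m).prod 𝓘(ℝ, ℝ)) (𝓡∂ m) n Φ z :=
      (contMDiffAt_iff_contMDiffAt_nhds (by simp)).1 hΦ
    exact h1.eventually (by simpa using h2)
  have e3 : ∀ᶠ t in 𝓝 s, |s - t| < δ :=
    (show ContinuousAt (fun t => |s - t|) s by fun_prop).eventually
      (Iio_mem_nhds (by simpa using hδ))
  obtain ⟨t₁, ⟨⟨⟨h1, h2⟩, h3⟩, h4⟩, ht₁⟩ :=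
    mem_closure_iff_nhds.1 hs _ (((e1.and e2).and e3).and (Iio_mem_nhds hs0))
  have h5 : ContinuousAt (fun z : E₁ × ℝ => f (z.1, t₁)) (u, s) :=
    (ContMDiffAt.continuousAt ht₁).comp_of_eq (f := fun z : E₁ × ℝ => (z.1, t₁))
      (by fun_prop) rfl
  have hev : f =ᶠ[𝓝 (u, s)] fun z : E₁ × ℝ => Φ (f (z.1, t₁), z.2 - t₁) := by
    have g1 : ∀ᶠ z in 𝓝 (u, s), f (z.1, t₁) ∈ _root_.interior N :=
      h5.eventually (isOpen_interior.mem_nhds h1)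
    have g2 : ∀ᶠ z : E₁ × ℝ in 𝓝 (u, s), |z.2 - t₁| < δ :=
      (show ContinuousAt (fun z : E₁ × ℝ => |z.2 - t₁|) (u, s) by fun_prop).eventually
        (Iio_mem_nhds h3)
    have g3 : ∀ᶠ z : E₁ × ℝ in 𝓝 (u, s), z.2 < 0 :=
      (continuousAt_snd (p := (u, s))).eventually (Iio_mem_nhds hs0)
    filter_upwards [g1, g2, g3] with z a b c
    obtain ⟨i1, i2⟩ := hint _ (interior_subset a)
    exact hΨ.eq_local_flow hα hδ i1 i2 (le_of_lt h4) rfl c.le b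
  refine ContMDiffAt.congr_of_eventuallyEq ?_ hev
  refine ContMDiffAt.comp (u, s) (g := Φ) (f := fun z : E₁ × ℝ => (f (z.1, t₁), z.2 - t₁)) h2 ?_
  have h6 : ContMDiffAt 𝓘(ℝ, E₁ × ℝ) 𝓘(ℝ, E₁ × ℝ) n (fun z : E₁ × ℝ => (z.1, t₁)) (u, s) :=
    ContDiffAt.contMDiffAt (by fun_prop)
  have h7 : ContMDiffAt 𝓘(ℝ, E₁ × ℝ) 𝓘(ℝ, ℝ) n (fun z : E₁ × ℝ => z.2 - t₁) (u, s) :=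
    ContDiffAt.contMDiffAt (by fun_prop)
  have ht₁' : ContMDiffAt 𝓘(ℝ, E₁ × ℝ) (𝓡∂ m) n f (u, t₁) := ht₁
  exact (ContMDiffAt.comp (u, s) (g := f) ht₁' h6).prodMk h7

/-- Starting from interior points, the backward semiflow depends smoothly on the initial point. -/
theorem contMDiffAt_of_interior (hΨ : IsBackwardSemiflow α Ψ) (hα : IsLiouvilleForm α)
    {c₀ : E₁ → F} {u : E₁} {n : ℕ} (hn : n ≠ 0) (hc₀ : ContMDiffAt 𝓘(ℝ, E₁) (𝓡∂ m) n c₀ u)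
    (hu : c₀ u ∈ (𝓡∂ m).interior F) {t : ℝ} (ht : t < 0) :
    ContMDiffAt 𝓘(ℝ, E₁ × ℝ) (𝓡∂ m) n (fun z : E₁ × ℝ => Ψ (c₀ z.1) z.2) (u, t) := by
  obtain ⟨Φ, hΦ, N, hN, δ, hδ, hint⟩ := exists_contMDiffAt_local_flow hα hu n hn
  have h2 : ∀ᶠ z in 𝓝 (c₀ u, (0 : ℝ)), ContMDiffAt ((𝓡∂ m).prod 𝓘(ℝ, ℝ)) (𝓡∂ m) n Φ z :=
    (contMDiffAt_iff_contMDiffAt_nhds (by simp)).1 hΦ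
  have h3 : ∀ᶠ t in 𝓝 (0 : ℝ), ContMDiffAt ((𝓡∂ m).prod 𝓘(ℝ, ℝ)) (𝓡∂ m) n Φ (c₀ u, t) :=
    (Continuous.prodMk_right (c₀ u)).continuousAt.eventually h2
  obtain ⟨t₀, ⟨h4, h5⟩, h6⟩ : ∃ t₀ : ℝ, (ContMDiffAt ((𝓡∂ m).prod 𝓘(ℝ, ℝ)) (𝓡∂ m) n Φ (c₀ u, t₀) ∧
      t₀ ∈ Ioo (-δ) δ) ∧ t₀ < 0 := by
    have := ((h3.and (Ioo_mem_nhds (neg_lt_zero.2 hδ) hδ)).filter_mono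
      (nhdsWithin_le_nhds (s := Iio 0))).and self_mem_nhdsWithin
    exact this.exists
  refine hΨ.contMDiffAt_of_contMDiffAt hα hn h6 ?_ ht
  have hev : (fun z : E₁ × ℝ => Ψ (c₀ z.1) z.2) =ᶠ[𝓝 (u, t₀)]
      fun z : E₁ × ℝ => Φ (c₀ z.1, z.2) := by
    have g1 : ∀ᶠ z : E₁ × ℝ in 𝓝 (u, t₀), c₀ z.1 ∈ N :=
      (hc₀.continuousAt.comp_of_eq (f := Prod.fst) (x := (u, t₀)) continuousAt_fst rfl).eventually hN
    have g2 : ∀ᶠ z : E₁ × ℝ in 𝓝 (u, t₀), |z.2| < δ :=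
      (show ContinuousAt (fun z : E₁ × ℝ => |z.2|) (u, t₀) by fun_prop).eventually
        (Iio_mem_nhds (abs_lt.2 h5))
    have g3 : ∀ᶠ z : E₁ × ℝ in 𝓝 (u, t₀), z.2 < 0 :=
      (continuousAt_snd (p := (u, t₀))).eventually (Iio_mem_nhds h6)
    filter_upwards [g1, g2, g3] with z a b c
    obtain ⟨i1, i2⟩ := hint _ a
    have := hΨ.eq_local_flow hα hδ i1 i2 (x := c₀ z.1) le_rfl (hΨ.zero _) c.le (by simpa using b)
    simpa using this
  refine ContMDiffAt.congr_of_eventuallyEq ?_ hev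
  refine ContMDiffAt.comp (u, t₀) (g := Φ) (f := fun z : E₁ × ℝ => (c₀ z.1, z.2)) h4 ?_
  have h6 : ContMDiffAt 𝓘(ℝ, E₁ × ℝ) 𝓘(ℝ, E₁) n (fun z : E₁ × ℝ => z.1) (u, t₀) :=
    ContDiffAt.contMDiffAt (by fun_prop)
  have h7 : ContMDiffAt 𝓘(ℝ, E₁ × ℝ) 𝓘(ℝ, ℝ) n (fun z : E₁ × ℝ => z.2) (u, t₀) :=
    ContDiffAt.contMDiffAt (by fun_prop)
  exact (ContMDiffAt.comp (u, t₀) (g := c₀) hc₀ h6).prodMk h7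

end IsBackwardSemiflow

end SmoothFlow

/-! ### The backward semiflow rescales the Liouville form -/

section Trajectories

variable {E : Type*} [NormedAddCommGroup E] [NormedSpace ℝ E]

/-- The difference of two trajectories of a Lipschitz vector field varies slowly. -/
theorem LipschitzOnWith.norm_trajectory_sub_sub_le {Y : E → E} {S : Set E} {L : NNReal}
    (hY : LipschitzOnWith L Y S) {X X' : ℝ → E} {δ : ℝ}
    (hX : ∀ s ∈ Icc 0 δ, HasDerivWithinAt X (Y (X s)) (Icc 0 δ) s ∧ X s ∈ S)
    (hX' : ∀ s ∈ Icc 0 δ, HasDerivWithinAt X' (Y (X' s)) (Icc 0 δ) s ∧ X' s ∈ S) :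
    ∀ s ∈ Icc 0 δ, ‖(X' s - X s) - (X' 0 - X 0)‖ ≤
      L * Real.exp (L * δ) * ‖X' 0 - X 0‖ * s := by
  have hD : ∀ s ∈ Icc 0 δ, HasDerivWithinAt (fun s => X' s - X s) (Y (X' s) - Y (X s))
      (Icc 0 δ) s := fun s hs => (hX' s hs).1.sub (hX s hs).1
  have hDr : ∀ s ∈ Ico 0 δ, HasDerivWithinAt (fun s => X' s - X s) (Y (X' s) - Y (X s))
      (Ici s) s := fun s hs =>
    (hD s (Ico_subset_Icc_self hs)).mono_of_mem_nhdsWithin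
      (Filter.mem_of_superset (Icc_mem_nhdsGE hs.2) (Icc_subset_Icc_left hs.1))
  have hcont : ContinuousOn (fun s => X' s - X s) (Icc 0 δ) := fun s hs =>
    (hD s hs).continuousWithinAt
  have hlip : ∀ s ∈ Icc 0 δ, ‖Y (X' s) - Y (X s)‖ ≤ L * ‖X' s - X s‖ := fun s hs =>
    hY.norm_sub_le (hX' s hs).2 (hX s hs).2
  have hgron : ∀ s ∈ Icc 0 δ, ‖X' s - X s‖ ≤ ‖X' 0 - X 0‖ * Real.exp (L * δ) := fun s hs => by
    have h1 := norm_le_gronwallBound_of_norm_deriv_right_le (δ := ‖X' 0 - X 0‖) (K := L) (ε := 0)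
      hcont hDr le_rfl (fun s hs => by simpa using hlip s (Ico_subset_Icc_self hs)) s hs
    rw [gronwallBound_ε0, sub_zero] at h1
    refine h1.trans ?_
    have : (L : ℝ) * s ≤ L * δ := by gcongr; exact hs.2
    gcongr
  intro s hs
  have h2 := norm_image_sub_le_of_norm_deriv_right_le_segment hcont hDr
    (C := L * Real.exp (L * δ) * ‖X' 0 - X 0‖) (fun s hs => by
      refine (hlip s (Ico_subset_Icc_self hs)).trans ?_
      rw [mul_assoc, mul_comm (Real.exp _)]
      exact mul_le_mul_of_nonneg_left (hgron s (Ico_subset_Icc_self hs)) L.2) s hs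
  simpa using h2

theorem HasDerivAt.norm_le_of_eventually_norm_sub_le {E' : Type*} [NormedAddCommGroup E']
    [NormedSpace ℝ E'] {A : ℝ → E} {B : ℝ → E'} {a : E} {b : E'} {x c : ℝ} (hA : HasDerivAt A a x)
    (hB : HasDerivAt B b x) (h : ∀ᶠ y in 𝓝 x, ‖A y - A x‖ ≤ c * ‖B y - B x‖) :
    ‖a‖ ≤ c * ‖b‖ := by
  refine le_of_tendsto_of_tendsto (hasDerivAt_iff_tendsto_slope.1 hA).norm
    ((hasDerivAt_iff_tendsto_slope.1 hB).norm.const_mul c) ?_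
  filter_upwards [h.filter_mono nhdsWithin_le_nhds] with y hy
  rw [slope_def_module, slope_def_module, norm_smul, norm_smul, mul_left_comm]
  exact mul_le_mul_of_nonneg_left hy (norm_nonneg _)

end Trajectories

section Rescaling

theorem differentiableAt_pullbackForm {E : Type*} [NormedAddCommGroup E] [NormedSpace ℝ E]
    {H : Type*} [TopologicalSpace H] {I : ModelWithCorners ℝ E H}
    {M : Type*} [TopologicalSpace M] [ChartedSpace H M] [IsManifold I ∞ M]
    {E' : Type*} [NormedAddCommGroup E'] [NormedSpace ℝ E'] {q : ℕ}
    {Ω : DForm I M q} (hΩ : IsSmoothForm I Ω) {g : E' → M} {z : E'}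
    (hg : ContMDiffAt 𝓘(ℝ, E') I 2 g z) :
    DifferentiableAt ℝ (F := E' [⋀^Fin q]→L[ℝ] ℝ)
      (fun w => (pullbackForm 𝓘(ℝ, E') I g Ω w : E' [⋀^Fin q]→L[ℝ] ℝ)) z := by
  have hsrc : ∀ᶠ w in 𝓝 z, g w ∈ (extChartAt I (g z)).source :=
    hg.continuousAt.eventually (extChartAt_source_mem_nhds (g z))
  have hdiff : ∀ᶠ w in 𝓝 z, MDifferentiableAt 𝓘(ℝ, E') I g w := by
    filter_upwards [(contMDiffAt_iff_contMDiffAt_nhds (by simp)).1 hg] with w hw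
    exact hw.mdifferentiableAt (by simp)
  have hev : (fun w => (pullbackForm 𝓘(ℝ, E') I g Ω w : E' [⋀^Fin q]→L[ℝ] ℝ)) =ᶠ[𝓝 z]
      fun w => (chartForm I Ω (g z) (extChartAt I (g z) (g w))).compContinuousLinearMap
        (fderiv ℝ (fun w => extChartAt I (g z) (g w)) w) := by
    filter_upwards [hsrc, hdiff] with w hw hw'
    exact pullbackForm_eq_chartForm Ω hw' hw
  have hG : ContDiffAt ℝ 2 (fun w => extChartAt I (g z) (g w)) z := by
    have := (contMDiffAt_extChartAt (I := I) (n := 2) (x := g z)).comp z hg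
    exact contMDiffAt_iff_contDiffAt.1 this
  have h1 : DifferentiableAt ℝ (fun w => chartForm I Ω (g z) (extChartAt I (g z) (g w))) z := by
    have h2 := ((hΩ.contDiffWithinAt (g z) (mem_extChartAt_source (g z))).differentiableWithinAt
      (by simp))
    have h3 := h2.comp z (s := univ) (f := fun w => extChartAt I (g z) (g w))
      (hG.differentiableAt (by simp)).differentiableWithinAt
      (fun w _ => mem_range_self _)
    exact differentiableWithinAt_univ.1 h3
  have h4 : DifferentiableAt ℝ (fderiv ℝ (fun w => extChartAt I (g z) (g w))) z :=
    (hG.fderiv_right (m := 1) (by norm_num)).differentiableAt (by simp)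
  have h5 := DifferentiableAt.continuousAlternatingMapCompContinuousLinearMap h1 h4
  exact h5.congr_of_eventuallyEq hev

variable {m : ℕ} [NeZero m]
  {F : Type*} [TopologicalSpace F] [ChartedSpace (EuclideanHalfSpace m) F]
  [IsManifold (𝓡∂ m) ∞ F] {α : DForm (𝓡∂ m) F 1}
  [T2Space F] {Ψ : F → ℝ → F}
  {E₁ : Type*} [NormedAddCommGroup E₁] [NormedSpace ℝ E₁]

namespace IsBackwardSemiflow

omit [IsManifold (𝓡∂ m) ∞ F] [T2Space F] in
/-- In the time direction, the derivative of the semiflow is the Liouville field. -/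
theorem mfderiv_time (hΨ : IsBackwardSemiflow α Ψ) {c₀ : E₁ → F} {z : E₁ × ℝ}
    (hz : z.2 < 0)
    (h : MDifferentiableAt 𝓘(ℝ, E₁ × ℝ) (𝓡∂ m) (fun z : E₁ × ℝ => Ψ (c₀ z.1) z.2) z) (τ : ℝ) :
    (mfderiv 𝓘(ℝ, E₁ × ℝ) (𝓡∂ m) (fun z : E₁ × ℝ => Ψ (c₀ z.1) z.2) z ((0, τ) : E₁ × ℝ) :
      EuclideanSpace ℝ (Fin m)) = τ • liouvilleField α (Ψ (c₀ z.1) z.2) := by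
  have h1 : HasMFDerivAt 𝓘(ℝ, ℝ) (𝓡∂ m) (Ψ (c₀ z.1)) z.2 _ :=
    ((hΨ.integral (c₀ z.1)) z.2 hz.le).hasMFDerivAt (Iic_mem_nhds hz)
  have h2 : HasMFDerivAt 𝓘(ℝ, ℝ) 𝓘(ℝ, E₁ × ℝ) (fun t : ℝ => (z.1, t)) z.2
      (ContinuousLinearMap.inr ℝ E₁ ℝ) := (hasFDerivAt_prodMk_right z.1 z.2).hasMFDerivAt
  have h3 : HasMFDerivAt 𝓘(ℝ, ℝ) (𝓡∂ m) (Ψ (c₀ z.1)) z.2 _ :=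
    HasMFDerivAt.comp z.2 (f := fun t : ℝ => (z.1, t)) h.hasMFDerivAt h2
  have h4 := congrArg (fun L : ℝ →L[ℝ] EuclideanSpace ℝ (Fin m) => L τ) (h3.mfderiv.symm.trans h1.mfderiv)
  exact h4

/-- In the space directions, the derivative of the semiflow is continuous at time `0`, by the
Grönwall inequality. -/
theorem tendsto_fderiv_extChartAt (hΨ : IsBackwardSemiflow α Ψ) (hα : IsLiouvilleForm α)
    {c₀ : E₁ → F} {u : E₁} (hc₀ : MDifferentiableAt 𝓘(ℝ, E₁) (𝓡∂ m) c₀ u)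
    (h : ∀ t < 0, MDifferentiableAt 𝓘(ℝ, E₁ × ℝ) (𝓡∂ m) (fun z : E₁ × ℝ => Ψ (c₀ z.1) z.2) (u, t))
    (v : E₁) :
    Filter.Tendsto (fun t : ℝ => fderiv ℝ
      (fun z : E₁ × ℝ => extChartAt (𝓡∂ m) (c₀ u) (Ψ (c₀ z.1) z.2)) (u, t) (v, 0)) (𝓝[<] 0)
      (𝓝 (fderiv ℝ (fun w => extChartAt (𝓡∂ m) (c₀ u) (c₀ w)) u v)) := by
  set φ := extChartAt (𝓡∂ m) (c₀ u) with hφ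
  obtain ⟨a, ha, L, hL, -⟩ := exists_lipschitzOnWith_chartField hα (c₀ u)
  obtain ⟨N, hN, δ, hδ, H⟩ := exists_local_integralCurves hα (c₀ u)
    (O := φ.source ∩ φ ⁻¹' Metric.closedBall (φ (c₀ u)) a) (Filter.inter_mem
    (extChartAt_source_mem_nhds _)
    ((continuousAt_extChartAt _).preimage_mem_nhds (Metric.closedBall_mem_nhds _ ha)))
  have hstay : ∀ x ∈ N, ∀ t ∈ Icc (-δ) 0,
      Ψ x t ∈ φ.source ∩ φ ⁻¹' Metric.closedBall (φ (c₀ u)) a := fun x hx t ht => by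
    obtain ⟨γ, h0, -, T, hT, h1, h2, -⟩ := H x hx
    have h3 := hΨ.eq_of_integralCurve hα (h1.mono (Icc_subset_Icc_right hT.1)) ht
    rw [h0, sub_zero] at h3
    rw [← h3]
    exact h2 t ⟨ht.1, ht.2.trans hT.1⟩
  -- the reversed trajectories in the chart
  have htraj : ∀ x ∈ N, ∀ s ∈ Icc 0 δ, HasDerivWithinAt (fun s => φ (Ψ x (-s)))
      (-(chartField (𝓡∂ m) (liouvilleField α) (c₀ u)) (φ (Ψ x (-s)))) (Icc 0 δ) s ∧
      φ (Ψ x (-s)) ∈ range (𝓡∂ m) ∩ Metric.closedBall (φ (c₀ u)) a := fun x hx s hs => by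
    have hs' : -s ∈ Icc (-δ) 0 := ⟨by linarith [hs.2], by linarith [hs.1]⟩
    obtain ⟨h1, h2⟩ := hstay x hx (-s) hs'
    refine ⟨?_, mem_range_self _, h2⟩
    have h3 := ((hΨ.integral x).mono (fun τ (hτ : τ ∈ Icc (-δ) 0) => hτ.2)).hasDerivWithinAt_extChartAt'
      hs' h1
    have h4 := h3.scomp s (h := fun s : ℝ => -s) (h' := -1) (s := Icc 0 δ)
      (hasDerivAt_neg s).hasDerivWithinAt (fun τ hτ => ⟨by linarith [hτ.2], by linarith [hτ.1]⟩)
    rw [neg_one_smul] at h4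
    exact h4
  have hLneg : LipschitzOnWith L (-(chartField (𝓡∂ m) (liouvilleField α) (c₀ u)))
      (range (𝓡∂ m) ∩ Metric.closedBall (φ (c₀ u)) a) :=
    LipschitzOnWith.of_dist_le_mul fun x hx y hy => by
      simpa [dist_neg_neg] using hL.dist_le_mul x hx y hy
  have hsrc : c₀ u ∈ φ.source := mem_extChartAt_source _
  -- derivatives along the line `u + ε v`
  have hB : HasDerivAt (fun ε : ℝ => φ (c₀ (u + ε • v))) (fderiv ℝ (fun w => φ (c₀ w)) u v) 0 := by
    have h1 : MDifferentiableAt 𝓘(ℝ, E₁) 𝓘(ℝ, EuclideanSpace ℝ (Fin m)) (fun w => φ (c₀ w)) u :=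
      (mdifferentiableAt_extChartAt (I := 𝓡∂ m) (by simp)).comp u hc₀
    have h2 : HasFDerivAt (fun w => φ (c₀ w)) _ u := h1.differentiableAt.hasFDerivAt
    have h3 : HasDerivAt (fun ε : ℝ => u + ε • v) v 0 := by
      simpa using ((hasDerivAt_id (0 : ℝ)).smul_const v).const_add u
    exact h2.comp_hasDerivAt_of_eq (0 : ℝ) h3 (by simp)
  have hA : ∀ t ∈ Ico (-δ) 0, HasDerivAt (fun ε : ℝ => φ (Ψ (c₀ (u + ε • v)) t))
      (fderiv ℝ (fun z : E₁ × ℝ => φ (Ψ (c₀ z.1) z.2)) (u, t) (v, 0)) 0 := fun t ht => by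
    have h0 : Ψ (c₀ u) t ∈ φ.source := (hstay _ (mem_of_mem_nhds hN) t ⟨ht.1, ht.2.le⟩).1
    have h1 : MDifferentiableAt 𝓘(ℝ, E₁ × ℝ) 𝓘(ℝ, EuclideanSpace ℝ (Fin m))
        (fun z : E₁ × ℝ => φ (Ψ (c₀ z.1) z.2)) (u, t) :=
      (mdifferentiableAt_extChartAt (I := 𝓡∂ m)
        (by simpa [hφ] using h0)).comp (u, t) (h t ht.2)
    have h2 : HasFDerivAt (fun z : E₁ × ℝ => φ (Ψ (c₀ z.1) z.2)) _ (u, t) :=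
      h1.differentiableAt.hasFDerivAt
    have h3 : HasDerivAt (fun ε : ℝ => (u + ε • v, t)) (v, (0 : ℝ)) 0 := by
      have : HasDerivAt (fun ε : ℝ => u + ε • v) v 0 := by
        simpa using ((hasDerivAt_id (0 : ℝ)).smul_const v).const_add u
      exact this.prodMk (hasDerivAt_const _ _)
    exact h2.comp_hasDerivAt_of_eq (0 : ℝ) h3 (by simp)
  have hnear : ∀ᶠ ε : ℝ in 𝓝 0, c₀ (u + ε • v) ∈ N := by
    have h1 : ContinuousAt (fun ε : ℝ => c₀ (u + ε • v)) 0 :=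
      hc₀.continuousAt.comp_of_eq (f := fun ε : ℝ => u + ε • v) (by fun_prop) (by simp)
    exact h1.eventually (by simpa using hN)
  set b := fderiv ℝ (fun w => φ (c₀ w)) u v with hb
  have hbound : ∀ t ∈ Ico (-δ) 0,
      ‖fderiv ℝ (fun z : E₁ × ℝ => φ (Ψ (c₀ z.1) z.2)) (u, t) (v, 0) - b‖ ≤
        L * Real.exp (L * δ) * (-t) * ‖b‖ := fun t ht => by
    refine ((hA t ht).sub hB).norm_le_of_eventually_norm_sub_le hB ?_
    filter_upwards [hnear] with ε hε
    have h1 := hLneg.norm_trajectory_sub_sub_le (htraj _ (mem_of_mem_nhds hN)) (htraj _ hε) (-t)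
      ⟨by linarith [ht.2], by linarith [ht.1]⟩
    simp only [neg_neg, neg_zero, hΨ.zero] at h1
    simp only [zero_smul, add_zero]
    calc _ = ‖φ (Ψ (c₀ (u + ε • v)) t) - φ (Ψ (c₀ u) t) - (φ (c₀ (u + ε • v)) - φ (c₀ u))‖ := by
          congr 1; simp only [Pi.sub_apply, zero_smul, add_zero]; abel
      _ ≤ _ := h1
      _ = _ := by ring
  rw [tendsto_iff_norm_sub_tendsto_zero]
  refine squeeze_zero' (Filter.Eventually.of_forall fun _ => norm_nonneg _)
    (g := fun t => L * Real.exp (L * δ) * (-t) * ‖b‖) ?_ ?_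
  · filter_upwards [Ico_mem_nhdsLT (neg_lt_zero.2 hδ)] with t ht using hbound t ht
  · have : Continuous fun t : ℝ => L * Real.exp (L * δ) * (-t) * ‖b‖ := by fun_prop
    simpa using (this.tendsto 0).mono_left (nhdsWithin_le_nhds (s := Iio 0))

/-- The semiflow rescales the Liouville form: `Ψ^* α = e^t α`, including for initial points on the
boundary. Indeed `f t = α (∂ Ψ)` satisfies `f' = f` by Cartan's formula, since `α (Y) = 0` and
`dα (Y, ·) = α`. -/
theorem pullbackForm_apply (hΨ : IsBackwardSemiflow α Ψ) (hα : IsLiouvilleForm α)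
    {c₀ : E₁ → F} {u : E₁} (hc₀ : MDifferentiableAt 𝓘(ℝ, E₁) (𝓡∂ m) c₀ u)
    (h : ∀ t < 0, ContMDiffAt 𝓘(ℝ, E₁ × ℝ) (𝓡∂ m) 2 (fun z : E₁ × ℝ => Ψ (c₀ z.1) z.2) (u, t))
    {t : ℝ} (ht : t < 0) (v : E₁) (τ : ℝ) :
    (pullbackForm 𝓘(ℝ, E₁ × ℝ) (𝓡∂ m) (fun z : E₁ × ℝ => Ψ (c₀ z.1) z.2) α (u, t) :
      (E₁ × ℝ) [⋀^Fin 1]→L[ℝ] ℝ) ![(v, τ)] =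
      Real.exp t * (pullbackForm 𝓘(ℝ, E₁) (𝓡∂ m) c₀ α u : E₁ [⋀^Fin 1]→L[ℝ] ℝ) ![v] := by
  set g : E₁ × ℝ → F := fun z => Ψ (c₀ z.1) z.2 with hg
  have hnd := hα.symplectic.nondegenerate
  let G : E₁ × ℝ → (E₁ × ℝ) [⋀^Fin 1]→L[ℝ] ℝ := fun z => pullbackForm 𝓘(ℝ, E₁ × ℝ) (𝓡∂ m) g α z
  have hmd : ∀ t < 0, MDifferentiableAt 𝓘(ℝ, E₁ × ℝ) (𝓡∂ m) g (u, t) := fun t ht =>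
    (h t ht).mdifferentiableAt (by simp)
  -- the form vanishes in the direction of time
  have htime : ∀ z : E₁ × ℝ, z.2 < 0 → MDifferentiableAt 𝓘(ℝ, E₁ × ℝ) (𝓡∂ m) g z → ∀ τ : ℝ,
      G z ![(0, τ)] = 0 := fun z hz hd τ => by
    have h1 := hΨ.mfderiv_time hz hd τ
    have h2 : G z ![(0, τ)] = α (g z) ![τ • liouvilleField α (g z)] := by
      change α (g z) (fun i => mfderiv 𝓘(ℝ, E₁ × ℝ) (𝓡∂ m) g z (![((0 : E₁), τ)] i)) = _
      congr 1
      funext i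
      fin_cases i
      exact h1
    rw [h2]
    have h3 : (![τ • liouvilleField α (g z)] : Fin 1 → TangentSpace (𝓡∂ m) (g z)) =
        τ • ![liouvilleField α (g z)] := by
      funext i; fin_cases i; rfl
    have h4 := (α (g z)).map_smul_univ (fun _ => τ) ![liouvilleField α (g z)]
    have h5 : (fun i => (fun _ : Fin 1 => τ) i • (![liouvilleField α (g z)] :
      Fin 1 → TangentSpace (𝓡∂ m) (g z)) i) = τ • ![liouvilleField α (g z)] := rfl
    rw [h3, ← h5, h4, liouvilleForm_apply_liouvilleField hnd, smul_zero]
  let f : ℝ → ℝ := fun t => G (u, t) ![(v, 0)]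
  -- evaluate `d (Ψ^* α) = Ψ^* dα` at the direction of time and `v`
  have hf : ∀ t < 0, HasDerivAt f (f t) t := fun t ht => by
    have hdG : DifferentiableAt ℝ G (u, t) := differentiableAt_pullbackForm hα.smooth (h t ht)
    have h1 : HasDerivAt f (fderiv ℝ (fun z => G z ![(v, 0)]) (u, t) (0, 1)) t := by
      have h2 : HasFDerivAt (fun z => G z ![(v, 0)]) _ (u, t) :=
        (hdG.continuousAlternatingMap_apply_const _).hasFDerivAt
      exact h2.comp_hasDerivAt t ((hasDerivAt_const t u).prodMk (hasDerivAt_id t))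
    have h2 := congrArg (fun L : (E₁ × ℝ) [⋀^Fin 2]→L[ℝ] ℝ => L ![(0, 1), (v, 0)])
      (extDeriv_pullbackForm hα.smooth (h t ht))
    have h3 : extDeriv G (u, t) ![((0 : E₁), (1 : ℝ)), (v, 0)] =
        fderiv ℝ (fun z => G z ![(v, 0)]) (u, t) (0, 1) -
          fderiv ℝ (fun z => G z ![(0, 1)]) (u, t) (v, 0) := by
      rw [extDeriv_apply hdG, Fin.sum_univ_two]
      have e0 : (0 : Fin 2).removeNth ![((0 : E₁), (1 : ℝ)), (v, 0)] = ![(v, 0)] := by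
        funext i; fin_cases i; rfl
      have e1 : (1 : Fin 2).removeNth ![((0 : E₁), (1 : ℝ)), (v, 0)] = ![(0, 1)] := by
        funext i; fin_cases i; rfl
      rw [e0, e1]
      simp [sub_eq_add_neg]
    have h4 : fderiv ℝ (fun z => G z ![((0 : E₁), (1 : ℝ))]) (u, t) = 0 := by
      have : (fun z => G z ![((0 : E₁), (1 : ℝ))]) =ᶠ[𝓝 (u, t)] fun _ => 0 := by
        have e1 : ∀ᶠ z : E₁ × ℝ in 𝓝 (u, t), z.2 < 0 :=
          (continuousAt_snd (p := (u, t))).eventually (Iio_mem_nhds ht)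
        filter_upwards [e1, (contMDiffAt_iff_contMDiffAt_nhds (by simp)).1 (h t ht)] with z a b
        exact htime z a (b.mdifferentiableAt (by simp)) 1
      rw [this.fderiv_eq]
      simp
    have h5 : (pullbackForm 𝓘(ℝ, E₁ × ℝ) (𝓡∂ m) g (extD (𝓡∂ m) α) (u, t) :
        (E₁ × ℝ) [⋀^Fin 2]→L[ℝ] ℝ) ![(0, 1), (v, 0)] = f t := by
      have e1 := hΨ.mfderiv_time (c₀ := c₀) (z := (u, t)) ht (hmd t ht) 1
      rw [one_smul] at e1
      change extD (𝓡∂ m) α (g (u, t)) (fun i => mfderiv 𝓘(ℝ, E₁ × ℝ) (𝓡∂ m) g (u, t)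
        (![((0 : E₁), (1 : ℝ)), (v, 0)] i)) = α (g (u, t)) (fun i =>
          mfderiv 𝓘(ℝ, E₁ × ℝ) (𝓡∂ m) g (u, t) (![(v, (0 : ℝ))] i))
      have e2 := liouvilleField_spec hnd (g (u, t))
        (mfderiv 𝓘(ℝ, E₁ × ℝ) (𝓡∂ m) g (u, t) ((v, 0) : E₁ × ℝ))
      refine Eq.trans ?_ (e2.trans ?_)
      · congr 1
        funext i
        fin_cases i
        · exact e1
        · rfl
      · congr 1
        funext i
        fin_cases i
        rfl
    have h6 : fderiv ℝ (fun z => G z ![(v, 0)]) (u, t) (0, 1) = f t := by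
      rw [h4] at h3
      simp only [zero_apply, sub_zero] at h3
      exact h3.symm.trans (h2.trans h5)
    rwa [h6] at h1
  -- the value at time `0`, where the semiflow is not known to be differentiable if `c₀ u` is on the
  -- boundary
  have hlim : Filter.Tendsto f (𝓝[<] 0)
      (𝓝 ((pullbackForm 𝓘(ℝ, E₁) (𝓡∂ m) c₀ α u : E₁ [⋀^Fin 1]→L[ℝ] ℝ) ![v])) := by
    set φ := extChartAt (𝓡∂ m) (c₀ u) with hφ
    have hgt : Filter.Tendsto (fun t => g (u, t)) (𝓝[<] 0) (𝓝 (c₀ u)) := by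
      have := ((hΨ.integral (c₀ u)) 0 (mem_Iic.2 le_rfl)).continuousWithinAt
      have h2 : Filter.Tendsto (Ψ (c₀ u)) (𝓝[Iic 0] 0) (𝓝 (Ψ (c₀ u) 0)) := this
      rw [hΨ.zero] at h2
      exact h2.mono_left (nhdsWithin_mono _ Iio_subset_Iic_self)
    have hsrc : ∀ᶠ t in 𝓝[<] (0 : ℝ), g (u, t) ∈ φ.source :=
      hgt.eventually (extChartAt_source_mem_nhds _)
    have hev : f =ᶠ[𝓝[<] 0] fun t => chartForm (𝓡∂ m) α (c₀ u) (φ (g (u, t)))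
        ![fderiv ℝ (fun z : E₁ × ℝ => φ (g z)) (u, t) (v, 0)] := by
      filter_upwards [hsrc, self_mem_nhdsWithin] with t h1 h2
      have h3 := pullbackForm_eq_chartForm α (hmd t h2) h1
      refine (congrArg (fun L : (E₁ × ℝ) [⋀^Fin 1]→L[ℝ] ℝ => L ![(v, 0)]) h3).trans ?_
      change chartForm (𝓡∂ m) α (c₀ u) (φ (g (u, t))) (fun i => _) = _
      congr 1
      funext i
      fin_cases i
      rfl
    have h0 : (pullbackForm 𝓘(ℝ, E₁) (𝓡∂ m) c₀ α u : E₁ [⋀^Fin 1]→L[ℝ] ℝ) ![v] =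
        chartForm (𝓡∂ m) α (c₀ u) (φ (c₀ u)) ![fderiv ℝ (fun w => φ (c₀ w)) u v] := by
      have h3 := pullbackForm_eq_chartForm α hc₀ (mem_extChartAt_source (I := 𝓡∂ m) (c₀ u))
      refine (congrArg (fun L : E₁ [⋀^Fin 1]→L[ℝ] ℝ => L ![v]) h3).trans ?_
      change chartForm (𝓡∂ m) α (c₀ u) (φ (c₀ u)) (fun i => _) = _
      congr 1
      funext i
      fin_cases i
      rfl
    rw [h0]
    refine Filter.Tendsto.congr' hev.symm ?_
    have h1 := hΨ.tendsto_fderiv_extChartAt hα hc₀ hmd v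
    have h2 : Filter.Tendsto (fun t => chartForm (𝓡∂ m) α (c₀ u) (φ (g (u, t)))) (𝓝[<] 0)
        (𝓝 (chartForm (𝓡∂ m) α (c₀ u) (φ (c₀ u)))) := by
      have h3 := (hα.smooth.contDiffWithinAt (c₀ u) (mem_extChartAt_source (c₀ u))).continuousWithinAt
      refine h3.tendsto.comp (tendsto_nhdsWithin_iff.2 ⟨?_, Filter.Eventually.of_forall
        fun _ => mem_range_self _⟩)
      exact (continuousAt_extChartAt (I := 𝓡∂ m) (c₀ u)).tendsto.comp hgt
    have h4 : Continuous fun p : (EuclideanSpace ℝ (Fin m) [⋀^Fin 1]→L[ℝ] ℝ) ×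
        EuclideanSpace ℝ (Fin m) => p.1 ![p.2] := by
      have : Continuous fun p : (EuclideanSpace ℝ (Fin m) [⋀^Fin 1]→L[ℝ] ℝ) ×
        (Fin 1 → EuclideanSpace ℝ (Fin m)) => p.1 p.2 := continuous_eval
      refine this.comp (continuous_fst.prodMk (continuous_pi fun i => ?_))
      fin_cases i
      exact continuous_snd
    exact (h4.tendsto _).comp (h2.prodMk_nhds h1)
  -- `e^{-t} f` is constant
  have hconst : ∀ s < 0, ∀ t < 0, Real.exp (-s) * f s = Real.exp (-t) * f t := by
    have hd : ∀ t < 0, HasDerivAt (fun t => Real.exp (-t) * f t) 0 t := fun t ht => by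
      have := ((hasDerivAt_neg t).exp).mul (hf t ht)
      refine this.congr_deriv ?_
      ring
    exact fun s hs t ht => isOpen_Iio.is_const_of_deriv_eq_zero isPreconnected_Iio
      (fun r hr => (hd r hr).differentiableAt.differentiableWithinAt)
      (fun r hr => (hd r hr).deriv) hs ht
  have hval : Real.exp (-t) * f t =
      (pullbackForm 𝓘(ℝ, E₁) (𝓡∂ m) c₀ α u : E₁ [⋀^Fin 1]→L[ℝ] ℝ) ![v] := by
    have h1 : Filter.Tendsto (fun s => Real.exp (-s) * f s) (𝓝[<] 0)
        (𝓝 (Real.exp (-0) * (pullbackForm 𝓘(ℝ, E₁) (𝓡∂ m) c₀ α u : E₁ [⋀^Fin 1]→L[ℝ] ℝ) ![v])) := by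
      refine Filter.Tendsto.mul ?_ hlim
      exact ((Real.continuous_exp.comp continuous_neg).tendsto 0).mono_left nhdsWithin_le_nhds
    rw [neg_zero, Real.exp_zero, one_mul] at h1
    refine tendsto_nhds_unique (tendsto_const_nhds.congr' ?_) h1
    filter_upwards [self_mem_nhdsWithin] with s hs using hconst t ht s hs
  have hsplit : G (u, t) ![(v, τ)] = G (u, t) ![(v, 0)] + G (u, t) ![(0, τ)] := by
    have h1 := (G (u, t)).map_update_add ![(v, τ)] 0 (v, 0) (0, τ)
    have h2 : ∀ x y : E₁ × ℝ, Function.update ![x] (0 : Fin 1) y = ![y] := fun x y => by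
      funext i; fin_cases i; simp
    rw [h2, h2, h2] at h1
    simpa using h1
  change G (u, t) ![(v, τ)] = _
  rw [hsplit, htime (u, t) ht (hmd t ht), add_zero, ← hval, ← mul_assoc, ← Real.exp_add,
    add_neg_cancel, Real.exp_zero, one_mul]

end IsBackwardSemiflow

end Rescaling

/-! ### Compact sets contracted by conformally symplectic maps have measure zero -/

section Gram

variable {d : ℕ}

/-- The bilinear form underlying an alternating 2-form. -/
def ContinuousAlternatingMap.toBilinForm {E : Type*} [NormedAddCommGroup E] [NormedSpace ℝ E]
    (A : E [⋀^Fin 2]→L[ℝ] ℝ) : LinearMap.BilinForm ℝ E :=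
  have e₀ : ∀ v w x : E, Function.update ![v, w] 0 x = ![x, w] := fun v w x => by
    funext i; fin_cases i <;> rfl
  have e₁ : ∀ v w x : E, Function.update ![v, w] 1 x = ![v, x] := fun v w x => by
    funext i; fin_cases i <;> rfl
  LinearMap.mk₂ ℝ (fun v w => A ![v, w])
    (fun v v' w => by
      have h := A.map_update_add ![v, w] 0 v v'
      rwa [e₀, e₀, e₀] at h)
    (fun a v w => by
      have h := A.map_update_smul ![v, w] 0 a v
      rwa [e₀, e₀] at h)
    (fun v w w' => by
      have h := A.map_update_add ![v, w] 1 w w'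
      rwa [e₁, e₁, e₁] at h)
    (fun a v w => by
      have h := A.map_update_smul ![v, w] 1 a w
      rwa [e₁, e₁] at h)

@[simp]
theorem ContinuousAlternatingMap.toBilinForm_apply {E : Type*} [NormedAddCommGroup E]
    [NormedSpace ℝ E] (A : E [⋀^Fin 2]→L[ℝ] ℝ) (v w : E) : A.toBilinForm v w = A ![v, w] := rfl

/-- The Gram determinant of an alternating 2-form in the standard basis. -/
def gramDet (A : EuclideanSpace ℝ (Fin d) [⋀^Fin 2]→L[ℝ] ℝ) : ℝ :=
  (LinearMap.BilinForm.toMatrix (EuclideanSpace.basisFun (Fin d) ℝ).toBasis A.toBilinForm).det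

theorem continuous_gramDet : Continuous (gramDet (d := d)) := by
  refine Continuous.matrix_det (continuous_matrix fun i j => ?_)
  simp only [LinearMap.BilinForm.toMatrix_apply, ContinuousAlternatingMap.toBilinForm_apply]
  exact continuous_eval_const _

theorem gramDet_comp (A : EuclideanSpace ℝ (Fin d) [⋀^Fin 2]→L[ℝ] ℝ)
    (L : EuclideanSpace ℝ (Fin d) →L[ℝ] EuclideanSpace ℝ (Fin d)) :
    gramDet (A.compContinuousLinearMap L) = L.det ^ 2 * gramDet A := by
  have h : (A.compContinuousLinearMap L).toBilinForm =
      A.toBilinForm.comp (L : EuclideanSpace ℝ (Fin d) →ₗ[ℝ] _) L := by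
    ext v w
    change A (fun i => L (![v, w] i)) = A ![L v, L w]
    congr 1
    funext i
    fin_cases i <;> rfl
  rw [gramDet, gramDet, h, LinearMap.BilinForm.toMatrix_comp (EuclideanSpace.basisFun (Fin d) ℝ).toBasis,
    Matrix.det_mul, Matrix.det_mul, Matrix.det_transpose, LinearMap.det_toMatrix]
  change LinearMap.det _ * _ * LinearMap.det _ = LinearMap.det _ ^ 2 * _
  ring

theorem gramDet_smul (c : ℝ) (A : EuclideanSpace ℝ (Fin d) [⋀^Fin 2]→L[ℝ] ℝ) :
    gramDet (c • A) = c ^ d * gramDet A := by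
  have h : (c • A).toBilinForm = c • A.toBilinForm := rfl
  rw [gramDet, h, map_smul, Matrix.det_smul, Fintype.card_fin, gramDet]

theorem gramDet_ne_zero {A : EuclideanSpace ℝ (Fin d) [⋀^Fin 2]→L[ℝ] ℝ}
    (hA : ∀ v, (∀ w, A ![v, w] = 0) → v = 0) : gramDet A ≠ 0 := by
  exact (LinearMap.BilinForm.nondegenerate_iff_det_ne_zero _).1
    (LinearMap.BilinForm.Nondegenerate.ofSeparatingLeft hA)

end Gram

section NullSets

variable {d : ℕ} {V : Type*} [TopologicalSpace V] [ChartedSpace (EuclideanSpace ℝ (Fin d)) V]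
  [IsManifold (𝓡 d) ∞ V]

theorem chartForm_nondegenerate {Ω : DForm (𝓡 d) V 2} (hΩ : IsNondegenerateForm (𝓡 d) Ω) {x₀ : V}
    {y : EuclideanSpace ℝ (Fin d)} (hy : y ∈ (extChartAt (𝓡 d) x₀).target)
    {v : EuclideanSpace ℝ (Fin d)} (hv : ∀ w, chartForm (𝓡 d) Ω x₀ y ![v, w] = 0) : v = 0 := by
  set x := (extChartAt (𝓡 d) x₀).symm y with hx
  have hxs : x ∈ (extChartAt (𝓡 d) x₀).source := (extChartAt (𝓡 d) x₀).map_target hy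
  have hxy : extChartAt (𝓡 d) x₀ x = y := (extChartAt (𝓡 d) x₀).right_inv hy
  have h1 := mfderiv_mfderivWithin_symm_extChartAt hxs v
  set v' : TangentSpace (𝓡 d) x := mfderivWithin 𝓘(ℝ, EuclideanSpace ℝ (Fin d)) (𝓡 d)
    (extChartAt (𝓡 d) x₀).symm (range (𝓡 d)) (extChartAt (𝓡 d) x₀ x) v with hv'
  have h2 : v' = 0 := by
    refine hΩ x v' fun w => ?_
    have h3 := chartForm_mfderiv Ω hxs ![v', w]
    refine h3.symm.trans ?_
    rw [hxy]
    refine Eq.trans ?_ (hv (mfderiv (𝓡 d) 𝓘(ℝ, EuclideanSpace ℝ (Fin d)) (extChartAt (𝓡 d) x₀) x w))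
    congr 1
    funext i
    fin_cases i
    · exact h1
    · rfl
  rw [h2] at h1
  rw [← h1]
  exact map_zero _

/-- In charts, a conformally symplectic map with factor `c` is conformally symplectic. -/
theorem chartForm_comp_fderiv {Ω : DForm (𝓡 d) V 2} {Θ : V → V} {c : ℝ} {x₀ x₁ : V}
    {y : EuclideanSpace ℝ (Fin d)} (hy : y ∈ (extChartAt (𝓡 d) x₀).target)
    (hΘ : MDifferentiableAt (𝓡 d) (𝓡 d) Θ ((extChartAt (𝓡 d) x₀).symm y))
    (hc : pullbackForm (𝓡 d) (𝓡 d) Θ Ω ((extChartAt (𝓡 d) x₀).symm y) =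
      c • Ω ((extChartAt (𝓡 d) x₀).symm y))
    (h₁ : Θ ((extChartAt (𝓡 d) x₀).symm y) ∈ (extChartAt (𝓡 d) x₁).source) :
    DifferentiableAt ℝ (fun w => extChartAt (𝓡 d) x₁ (Θ ((extChartAt (𝓡 d) x₀).symm w))) y ∧
    (chartForm (𝓡 d) Ω x₁ (extChartAt (𝓡 d) x₁ (Θ ((extChartAt (𝓡 d) x₀).symm y)))).compContinuousLinearMap
      (fderiv ℝ (fun w => extChartAt (𝓡 d) x₁ (Θ ((extChartAt (𝓡 d) x₀).symm w))) y) =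
      c • chartForm (𝓡 d) Ω x₀ y := by
  have hs : MDifferentiableAt 𝓘(ℝ, EuclideanSpace ℝ (Fin d)) (𝓡 d) (extChartAt (𝓡 d) x₀).symm y := by
    have := mdifferentiableWithinAt_extChartAt_symm (I := 𝓡 d) hy
    rwa [ModelWithCorners.range_eq_univ, mdifferentiableWithinAt_univ] at this
  have hg : MDifferentiableAt 𝓘(ℝ, EuclideanSpace ℝ (Fin d)) (𝓡 d)
      (fun w => Θ ((extChartAt (𝓡 d) x₀).symm w)) y := hΘ.comp y hs
  refine ⟨?_, ?_⟩
  · have h2 : MDifferentiableAt 𝓘(ℝ, EuclideanSpace ℝ (Fin d)) 𝓘(ℝ, EuclideanSpace ℝ (Fin d))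
        (fun w => extChartAt (𝓡 d) x₁ (Θ ((extChartAt (𝓡 d) x₀).symm w))) y :=
      (mdifferentiableAt_extChartAt (I := 𝓡 d) (by simpa using h₁)).comp y hg
    exact h2.differentiableAt
  · rw [← pullbackForm_eq_chartForm Ω hg h₁]
    have hcomp : mfderiv 𝓘(ℝ, EuclideanSpace ℝ (Fin d)) (𝓡 d)
        (fun w => Θ ((extChartAt (𝓡 d) x₀).symm w)) y = _ := mfderiv_comp y hΘ hs
    ext v
    change Ω _ (fun i => mfderiv 𝓘(ℝ, EuclideanSpace ℝ (Fin d)) (𝓡 d)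
        (fun w => Θ ((extChartAt (𝓡 d) x₀).symm w)) y (v i)) = c • Ω _ (fun i =>
          mfderivWithin 𝓘(ℝ, EuclideanSpace ℝ (Fin d)) (𝓡 d)
            (extChartAt (𝓡 d) x₀).symm (range (𝓡 d)) y (v i))
    rw [hcomp, ModelWithCorners.range_eq_univ, mfderivWithin_univ]
    exact congrArg (fun A : (EuclideanSpace ℝ (Fin d)) [⋀^Fin 2]→L[ℝ] ℝ => A (fun i =>
      mfderiv 𝓘(ℝ, EuclideanSpace ℝ (Fin d)) (𝓡 d) (extChartAt (𝓡 d) x₀).symm y (v i))) hc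

/-- A compact set which is covered by its images under maps contracting a nondegenerate 2-form by
arbitrarily small factors has measure zero. -/
theorem isNullSubset_of_contracting [T2Space V] (hd : d ≠ 0) {Ω : DForm (𝓡 d) V 2}
    (hsm : IsSmoothForm (𝓡 d) Ω) (hΩ : IsNondegenerateForm (𝓡 d) Ω) {S : Set V} (hS : IsCompact S)
    (h : ∀ ε > 0, ∃ c : ℝ, 0 < c ∧ c < ε ∧ ∃ Θ : V → V, S ⊆ Θ '' S ∧
      ∀ x ∈ S, MDifferentiableAt (𝓡 d) (𝓡 d) Θ x ∧
        pullbackForm (𝓡 d) (𝓡 d) Θ Ω x = c • Ω x) :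
    IsNullSubset (d := d) S := by
  -- a finite cover of `S` by compact subsets `Q x` of chart domains
  have hr : ∀ x : V, ∃ r > 0, Metric.closedBall (extChartAt (𝓡 d) x x) r ⊆
      (extChartAt (𝓡 d) x).target := fun x =>
    Metric.nhds_basis_closedBall.mem_iff.1
      (extChartAt_target_mem_nhds (I := 𝓡 d) x)
  choose r hr0 hr using hr
  let Q : V → Set V := fun x =>
    (extChartAt (𝓡 d) x).symm '' Metric.closedBall (extChartAt (𝓡 d) x x) (r x)
  have hQc : ∀ x, IsCompact (Q x) := fun x =>
    (isCompact_closedBall _ _).image_of_continuousOn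
      ((continuousOn_extChartAt_symm x).mono (hr x))
  have hQs : ∀ x, Q x ⊆ (extChartAt (𝓡 d) x).source := by
    rintro x _ ⟨y, hy, rfl⟩
    exact (extChartAt (𝓡 d) x).map_target (hr x hy)
  have hQn : ∀ x, Q x ∈ 𝓝 x := fun x => by
    have h1 : ∀ᶠ z in 𝓝 x, extChartAt (𝓡 d) x z ∈ Metric.closedBall (extChartAt (𝓡 d) x x) (r x) :=
      (continuousAt_extChartAt x).eventually (Metric.closedBall_mem_nhds _ (hr0 x))
    filter_upwards [h1, extChartAt_source_mem_nhds (I := 𝓡 d) x] with z hz hz'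
    exact ⟨_, hz, (extChartAt (𝓡 d) x).left_inv hz'⟩
  obtain ⟨I, -, hI⟩ := hS.elim_nhds_subcover Q fun x _ => hQn x
  let D : V → Set (EuclideanSpace ℝ (Fin d)) := fun x => extChartAt (𝓡 d) x '' (S ∩ Q x)
  have hD : ∀ x, IsCompact (D x) := fun x => (hS.inter (hQc x)).image_of_continuousOn
    ((continuousOn_extChartAt x).mono fun z hz => hQs x hz.2)
  have hDt : ∀ x, D x ⊆ (extChartAt (𝓡 d) x).target := by
    rintro x _ ⟨z, hz, rfl⟩
    exact (extChartAt (𝓡 d) x).map_source (hQs x hz.2)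
  let ρ : V → EuclideanSpace ℝ (Fin d) → ℝ := fun x y => |gramDet (chartForm (𝓡 d) Ω x y)|
  have hρc : ∀ x, ContinuousOn (ρ x) (D x) := fun x =>
    (continuous_gramDet.comp_continuousOn ((hsm x).continuousOn.mono (hDt x))).abs
  have hρ0 : ∀ x, ∀ y ∈ D x, 0 < ρ x y := fun x y hy =>
    abs_pos.2 (gramDet_ne_zero fun v hv => chartForm_nondegenerate hΩ (hDt x hy) hv)
  -- bounds for the densities
  have hub : ∀ x, ∃ B > 0, ∀ y ∈ D x, ρ x y ≤ B := fun x => by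
    obtain ⟨B, hB⟩ := (hD x).bddAbove_image (hρc x)
    exact ⟨max B 1, by positivity, fun y hy => (hB ⟨y, hy, rfl⟩).trans (le_max_left _ _)⟩
  have hlb : ∀ x, ∃ b > 0, ∀ y ∈ D x, b ≤ ρ x y := fun x => by
    rcases (D x).eq_empty_or_nonempty with he | hne
    · exact ⟨1, one_pos, by simp [he]⟩
    · obtain ⟨y, hy, hmin⟩ := (hD x).exists_isMinOn hne (hρc x)
      exact ⟨ρ x y, hρ0 x y hy, fun z hz => hmin hz⟩
  choose B hB0 hB using hub
  choose b hb0 hb using hlb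
  -- each piece is covered by the images of all pieces, with small Jacobians
  have hpiece : ∀ j, volume (D j) = 0 := by
    intro j
    let C : ENNReal := ∑ i ∈ I, ENNReal.ofReal (Real.sqrt (B i / b j)) * volume (D i)
    have hC : C ≠ ⊤ := by
      refine ENNReal.sum_ne_top.2 fun i _ => ENNReal.mul_ne_top ENNReal.ofReal_ne_top ?_
      exact (hD i).measure_lt_top.ne
    have hle : ∀ ε : ℝ, 0 < ε → ε ≤ 1 → volume (D j) ≤ ENNReal.ofReal (Real.sqrt ε) * C := by
      intro ε hε hε1
      obtain ⟨c, hc0, hcε, Θ, hcov, hΘ⟩ := h ε hε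
      have hΘc : ContinuousOn Θ S := fun x hx => (hΘ x hx).1.continuousAt.continuousWithinAt
      let g : V → EuclideanSpace ℝ (Fin d) → EuclideanSpace ℝ (Fin d) := fun i w =>
        extChartAt (𝓡 d) j (Θ ((extChartAt (𝓡 d) i).symm w))
      let T : V → Set (EuclideanSpace ℝ (Fin d)) := fun i =>
        extChartAt (𝓡 d) i '' (S ∩ Q i ∩ Θ ⁻¹' (S ∩ Q j))
      -- the part of the piece `i` which `Θ` maps to the piece `j`
      have hTD : ∀ i, T i ⊆ D i := fun i => image_mono inter_subset_left
      have hTm : ∀ i, MeasurableSet (T i) := fun i => by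
        have h1 : IsClosed (S ∩ Q j) := (hS.inter (hQc j)).isClosed
        obtain ⟨Z, hZ, hZeq⟩ := continuousOn_iff_isClosed.1 (hΘc.mono inter_subset_left) _ h1
        have h2 : S ∩ Q i ∩ Θ ⁻¹' (S ∩ Q j) = S ∩ Q i ∩ Z := by
          rw [inter_comm, hZeq, inter_comm]
        have h3 : IsCompact (S ∩ Q i ∩ Θ ⁻¹' (S ∩ Q j)) := by
          rw [h2]; exact (hS.inter (hQc i)).inter_right hZ
        exact (h3.image_of_continuousOn ((continuousOn_extChartAt i).mono
          fun z hz => hQs i hz.1.2)).isClosed.measurableSet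
      have hsub : D j ⊆ ⋃ i ∈ I, g i '' T i := by
        rintro _ ⟨z, hz, rfl⟩
        obtain ⟨x, hx, rfl⟩ := hcov hz.1
        obtain ⟨i, hi, hxi⟩ := mem_iUnion₂.1 (hI hx)
        refine mem_iUnion₂.2 ⟨i, hi, _, ⟨x, ⟨⟨hx, hxi⟩, hz⟩, rfl⟩, ?_⟩
        simp only [g, (extChartAt (𝓡 d) i).left_inv (hQs i hxi)]
      have hTj : ∀ i, ∀ y ∈ T i, (extChartAt (𝓡 d) i).symm y ∈ S ∧
          Θ ((extChartAt (𝓡 d) i).symm y) ∈ S ∩ Q j := by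
        rintro i _ ⟨x, hx, rfl⟩
        rw [(extChartAt (𝓡 d) i).left_inv (hQs i hx.1.2)]
        exact ⟨hx.1.1, hx.2⟩
      have hkey : ∀ i, ∀ y ∈ T i, DifferentiableAt ℝ (g i) y ∧
          |(fderiv ℝ (g i) y).det| ≤ Real.sqrt ε * Real.sqrt (B i / b j) := by
        intro i y hy
        obtain ⟨hyS, hyΘ⟩ := hTj i y hy
        obtain ⟨h1, h2⟩ := chartForm_comp_fderiv (x₁ := j) (hDt i (hTD i hy)) (hΘ _ hyS).1
          (hΘ _ hyS).2 (hQs j hyΘ.2)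
        refine ⟨h1, ?_⟩
        -- comparing Gram determinants gives the square of the Jacobian of `g i`
        have h3 := congrArg (fun t => |gramDet t|) h2
        simp only [gramDet_comp, gramDet_smul, abs_mul, abs_pow] at h3
        have h4 : b j ≤ ρ j (g i y) := hb j _ ⟨_, hyΘ, rfl⟩
        have h5 : ρ i y ≤ B i := hB i y (hTD i hy)
        have h6 : |c| ^ d ≤ ε := by
          rw [abs_of_pos hc0]
          calc c ^ d ≤ c ^ 1 := pow_le_pow_of_le_one hc0.le (by linarith) (Nat.one_le_iff_ne_zero.2 hd)
            _ ≤ ε := by rw [pow_one]; exact hcε.le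
        have h7 : |(fderiv ℝ (g i) y).det| ^ 2 * ρ j (g i y) = |c| ^ d * ρ i y := h3
        rw [← Real.sqrt_mul hε.le]
        refine Real.le_sqrt_of_sq_le ?_
        rw [← mul_div_assoc, le_div_iff₀ (hb0 j)]
        calc |(fderiv ℝ (g i) y).det| ^ 2 * b j ≤ |(fderiv ℝ (g i) y).det| ^ 2 * ρ j (g i y) := by
              gcongr
          _ = |c| ^ d * ρ i y := h7
          _ ≤ ε * B i := by
              have : 0 ≤ ρ i y := abs_nonneg _
              gcongr
      calc volume (D j) ≤ volume (⋃ i ∈ I, g i '' T i) := measure_mono hsub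
        _ ≤ ∑ i ∈ I, volume (g i '' T i) := measure_biUnion_finset_le _ _
        _ ≤ ∑ i ∈ I, ENNReal.ofReal (Real.sqrt ε) *
              (ENNReal.ofReal (Real.sqrt (B i / b j)) * volume (D i)) := by
            refine Finset.sum_le_sum fun i _ => ?_
            refine (addHaar_image_le_lintegral_abs_det_fderiv volume (hTm i)
              (fun y hy => (hkey i y hy).1.hasFDerivAt.hasFDerivWithinAt)).trans ?_
            calc ∫⁻ y in T i, ENNReal.ofReal |(fderiv ℝ (g i) y).det|
                ≤ ∫⁻ y in T i, ENNReal.ofReal (Real.sqrt ε * Real.sqrt (B i / b j)) :=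
                  setLIntegral_mono' (hTm i) fun y hy => ENNReal.ofReal_le_ofReal (hkey i y hy).2
              _ = ENNReal.ofReal (Real.sqrt ε * Real.sqrt (B i / b j)) * volume (T i) :=
                  setLIntegral_const _ _
              _ ≤ _ := by
                  rw [ENNReal.ofReal_mul (Real.sqrt_nonneg _), mul_assoc]
                  gcongr
                  exact hTD i
        _ = ENNReal.ofReal (Real.sqrt ε) * C := by rw [← Finset.mul_sum]
    have hlim : Filter.Tendsto (fun ε : ℝ => ENNReal.ofReal (Real.sqrt ε) * C) (𝓝[>] 0) (𝓝 0) := by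
      have h1 : Filter.Tendsto (fun ε : ℝ => ENNReal.ofReal (Real.sqrt ε)) (𝓝[>] 0) (𝓝 0) := by
        have : Continuous fun ε : ℝ => ENNReal.ofReal (Real.sqrt ε) :=
          ENNReal.continuous_ofReal.comp Real.continuous_sqrt
        simpa using (this.tendsto 0).mono_left (nhdsWithin_le_nhds (s := Ioi 0))
      simpa using ENNReal.Tendsto.mul_const h1 (Or.inr hC)
    refine le_antisymm (ge_of_tendsto hlim ?_) bot_le
    filter_upwards [Ioc_mem_nhdsGT one_pos] with ε hε using hle ε hε.1 hε.2
  -- transition maps preserve null sets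
  intro x₀
  have hsub : extChartAt (𝓡 d) x₀ '' (S ∩ (extChartAt (𝓡 d) x₀).source) ⊆
      ⋃ i ∈ I, (fun y => extChartAt (𝓡 d) x₀ ((extChartAt (𝓡 d) i).symm y)) ''
        (D i ∩ (extChartAt (𝓡 d) i).symm ⁻¹' (extChartAt (𝓡 d) x₀).source) := by
    rintro _ ⟨x, ⟨hx, hx'⟩, rfl⟩
    obtain ⟨i, hi, hxi⟩ := mem_iUnion₂.1 (hI hx)
    have h1 := (extChartAt (𝓡 d) i).left_inv (hQs i hxi)
    refine mem_iUnion₂.2 ⟨i, hi, extChartAt (𝓡 d) i x, ⟨⟨x, ⟨hx, hxi⟩, rfl⟩, ?_⟩, ?_⟩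
    · simpa only [mem_preimage, h1] using hx'
    · simp only [h1]
  refine measure_mono_null hsub ((measure_biUnion_null_iff I.countable_toSet).2 fun i _ => ?_)
  refine addHaar_image_eq_zero_of_differentiableOn_of_addHaar_eq_zero volume (fun y hy => ?_)
    (measure_mono_null inter_subset_left (hpiece i))
  have hs : MDifferentiableAt 𝓘(ℝ, EuclideanSpace ℝ (Fin d)) (𝓡 d) (extChartAt (𝓡 d) i).symm y := by
    have := mdifferentiableWithinAt_extChartAt_symm (I := 𝓡 d) (hDt i hy.1)
    rwa [ModelWithCorners.range_eq_univ, mdifferentiableWithinAt_univ] at this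
  have h2 : MDifferentiableAt 𝓘(ℝ, EuclideanSpace ℝ (Fin d)) 𝓘(ℝ, EuclideanSpace ℝ (Fin d))
      (fun y => extChartAt (𝓡 d) x₀ ((extChartAt (𝓡 d) i).symm y)) y :=
    (mdifferentiableAt_extChartAt (I := 𝓡 d) (by simpa using hy.2)).comp y hs
  exact h2.differentiableAt.differentiableWithinAt

end NullSets

/-! ### Functoriality of the pull-back -/

section Pullback

variable {E : Type*} [NormedAddCommGroup E] [NormedSpace ℝ E]
  {H : Type*} [TopologicalSpace H] {I : ModelWithCorners ℝ E H}
  {M : Type*} [TopologicalSpace M] [ChartedSpace H M]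
  {E' : Type*} [NormedAddCommGroup E'] [NormedSpace ℝ E']
  {H' : Type*} [TopologicalSpace H'] {I' : ModelWithCorners ℝ E' H'}
  {M' : Type*} [TopologicalSpace M'] [ChartedSpace H' M']
  {E'' : Type*} [NormedAddCommGroup E''] [NormedSpace ℝ E'']
  {H'' : Type*} [TopologicalSpace H''] {I'' : ModelWithCorners ℝ E'' H''}
  {M'' : Type*} [TopologicalSpace M''] [ChartedSpace H'' M''] {k : ℕ}

theorem pullbackForm_comp {g : M' → M''} {f : M → M'} {x : M}
    (hg : MDifferentiableAt I' I'' g (f x)) (hf : MDifferentiableAt I I' f x)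
    (Ω : DForm I'' M'' k) :
    pullbackForm I I'' (fun y => g (f y)) Ω x =
      pullbackForm I I' f (pullbackForm I' I'' g Ω) x := by
  ext v
  have h : mfderiv I I'' (fun y => g (f y)) x = _ := mfderiv_comp x hg hf
  change Ω (g (f x)) (fun i => mfderiv I I'' (fun y => g (f y)) x (v i)) = _
  rw [h]
  rfl

theorem pullbackForm_congr {f f' : M → M'} {x : M} (h : f =ᶠ[𝓝 x] f') (Ω : DForm I' M' k) :
    pullbackForm I I' f Ω x = pullbackForm I I' f' Ω x := by
  ext v
  have h1 : (mfderiv I I' f x : E →L[ℝ] E') = (mfderiv I I' f' x : E →L[ℝ] E') := h.mfderiv_eq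
  have key : ∀ y : M', f x = y → ∀ L : E →L[ℝ] E',
      Ω (f x) (fun i => L (v i)) = Ω y (fun i => L (v i)) := by
    rintro _ rfl L; rfl
  refine (key _ h.self_of_nhds (mfderiv I I' f x)).trans ?_
  exact congrArg (fun L : E →L[ℝ] E' => Ω (f' x) (fun i => L (v i))) h1

theorem pullbackForm_congr_form {f : M → M'} {x : M} {Ω Ω' : DForm I' M' k}
    (h : Ω (f x) = Ω' (f x)) : pullbackForm I I' f Ω x = pullbackForm I I' f Ω' x :=
  congrArg (fun A : (TangentSpace I' (f x)) [⋀^Fin k]→L[ℝ] ℝ =>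
    A.compContinuousLinearMap (mfderiv I I' f x)) h

theorem pullbackForm_id (Ω : DForm I M k) (x : M) :
    pullbackForm I I (fun y => y) Ω x = Ω x := by
  ext v
  have h : mfderiv I I (fun y : M => y) x = ContinuousLinearMap.id ℝ (TangentSpace I x) := mfderiv_id
  change Ω x (fun i => mfderiv I I (fun y : M => y) x (v i)) = _
  rw [h]
  rfl

theorem pullbackForm_smul (f : M → M') (c : ℝ) (Ω : DForm I' M' k) :
    pullbackForm I I' f (c • Ω) = c • pullbackForm I I' f Ω := rfl

/-- A form is determined at a point by its pull-back by a submersion. -/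
theorem eq_of_pullbackForm_eq {f : M → M'} {x : M} (hf : Function.Surjective (mfderiv I I' f x))
    {Ω Ω' : DForm I' M' k} (h : pullbackForm I I' f Ω x = pullbackForm I I' f Ω' x) :
    Ω (f x) = Ω' (f x) := by
  ext w
  choose v hv using fun i => hf (w i)
  have h1 := congrArg (fun A : (TangentSpace I x) [⋀^Fin k]→L[ℝ] ℝ => A v) h
  have h2 : (fun i => mfderiv I I' f x (v i)) = w := funext hv
  change Ω (f x) (fun i => mfderiv I I' f x (v i)) = Ω' (f x) (fun i => mfderiv I I' f x (v i)) at h1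
  rwa [h2] at h1

theorem surjective_mfderiv_of_comp {g : M' → M''} {f : M → M'} {x : M}
    (hg : MDifferentiableAt I' I'' g (f x)) (hf : MDifferentiableAt I I' f x)
    (h : Function.Surjective (mfderiv I I'' (fun y => g (f y)) x)) :
    Function.Surjective (mfderiv I' I'' g (f x)) := by
  have h1 : mfderiv I I'' (fun y => g (f y)) x = _ := mfderiv_comp x hg hf
  rw [h1] at h
  exact Function.Surjective.of_comp h

end Pullback

/-! ### The backward flow in the interior -/

section Flow

variable {m : ℕ} [NeZero m]
  {F : Type*} [TopologicalSpace F] [ChartedSpace (EuclideanHalfSpace m) F]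
  [IsManifold (𝓡∂ m) ∞ F] {α : DForm (𝓡∂ m) F 1}
  [T2Space F] {Ψ : F → ℝ → F}
  {E₁ : Type*} [NormedAddCommGroup E₁] [NormedSpace ℝ E₁]

theorem contMDiffAt_infty_of_forall_ne_zero {H : Type*} [TopologicalSpace H] {E : Type*}
    [NormedAddCommGroup E] [NormedSpace ℝ E] {I : ModelWithCorners ℝ E H} {M : Type*}
    [TopologicalSpace M] [ChartedSpace H M] {f : E₁ → M} {x : E₁}
    (h : ∀ n : ℕ, n ≠ 0 → ContMDiffAt 𝓘(ℝ, E₁) I n f x) : ContMDiffAt 𝓘(ℝ, E₁) I ∞ f x :=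
  contMDiffAt_infty.2 fun n => (h (n + 1) (by simp)).of_le (by exact_mod_cast Nat.le_succ n)

theorem IsBackwardSemiflow.contMDiffAt_time (hΨ : IsBackwardSemiflow α Ψ) (hα : IsLiouvilleForm α)
    {c₀ : E₁ → F} {u : E₁} (hc₀ : ContMDiffAt 𝓘(ℝ, E₁) (𝓡∂ m) ∞ c₀ u)
    (hu : c₀ u ∈ (𝓡∂ m).interior F) {t : ℝ} (ht : t < 0) :
    ContMDiffAt 𝓘(ℝ, E₁) (𝓡∂ m) ∞ (fun w => Ψ (c₀ w) t) u := by
  refine contMDiffAt_infty_of_forall_ne_zero fun n hn => ?_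
  have h1 := hΨ.contMDiffAt_of_interior hα hn
    (hc₀.of_le (by exact_mod_cast le_top)) hu ht
  have h2 : ContMDiffAt 𝓘(ℝ, E₁) 𝓘(ℝ, E₁ × ℝ) n (fun w : E₁ => (w, t)) u :=
    ContDiffAt.contMDiffAt (by fun_prop)
  exact ContMDiffAt.comp u (g := fun z : E₁ × ℝ => Ψ (c₀ z.1) z.2) h1 h2

/-- The backward flow contracts the symplectic form `dα` by the factor `e^t`. The interior is
parametrized by maps `c₀` on vector spaces. -/
theorem IsBackwardSemiflow.pullbackForm_extD (hΨ : IsBackwardSemiflow α Ψ)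
    (hα : IsLiouvilleForm α) {c₀ : E₁ → F} {u : E₁} (hc₀ : ContMDiffAt 𝓘(ℝ, E₁) (𝓡∂ m) ∞ c₀ u)
    (hu : c₀ u ∈ (𝓡∂ m).interior F) {t : ℝ} (ht : t < 0) :
    (pullbackForm 𝓘(ℝ, E₁) (𝓡∂ m) (fun w => Ψ (c₀ w) t) (extD (𝓡∂ m) α) u :
      E₁ [⋀^Fin 2]→L[ℝ] ℝ) =
      Real.exp t • (pullbackForm 𝓘(ℝ, E₁) (𝓡∂ m) c₀ (extD (𝓡∂ m) α) u : E₁ [⋀^Fin 2]→L[ℝ] ℝ) := by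
  have h2 : (2 : ℕ∞ω) ≤ ∞ := ENat.LEInfty.out
  rw [← extDeriv_pullbackForm hα.smooth ((hΨ.contMDiffAt_time hα hc₀ hu ht).of_le h2),
    ← extDeriv_pullbackForm hα.smooth (hc₀.of_le h2)]
  have hev : ∀ᶠ w in 𝓝 u, ContMDiffAt 𝓘(ℝ, E₁) (𝓡∂ m) 2 c₀ w ∧ c₀ w ∈ (𝓡∂ m).interior F :=
    ((contMDiffAt_iff_contMDiffAt_nhds (by simp)).1 (hc₀.of_le h2)).and
      (hc₀.continuousAt.eventually (((𝓡∂ m).isOpen_interior (n := ∞) (by simp)).mem_nhds hu))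
  let G₀ : E₁ → E₁ [⋀^Fin 1]→L[ℝ] ℝ := fun w => pullbackForm 𝓘(ℝ, E₁) (𝓡∂ m) c₀ α w
  have heq : (fun w => (pullbackForm 𝓘(ℝ, E₁) (𝓡∂ m) (fun w => Ψ (c₀ w) t) α w :
      E₁ [⋀^Fin 1]→L[ℝ] ℝ)) =ᶠ[𝓝 u]
      fun w => Real.exp t • G₀ w := by
    filter_upwards [hev] with w hw
    have hs : ∀ t < 0, ContMDiffAt 𝓘(ℝ, E₁ × ℝ) (𝓡∂ m) 2
        (fun z : E₁ × ℝ => Ψ (c₀ z.1) z.2) (w, t) := fun t ht =>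
      hΨ.contMDiffAt_of_interior hα (n := 2) (by simp) hw.1 hw.2 ht
    have h3 : MDifferentiableAt 𝓘(ℝ, E₁) 𝓘(ℝ, E₁ × ℝ) (fun w : E₁ => (w, t)) w :=
      (DifferentiableAt.mdifferentiableAt (by fun_prop))
    have h4 := pullbackForm_comp (g := fun z : E₁ × ℝ => Ψ (c₀ z.1) z.2) (f := fun w : E₁ => (w, t))
      ((hs t ht).mdifferentiableAt (by simp)) h3 α
    refine h4.trans ?_
    ext v
    have h5 := hΨ.pullbackForm_apply hα (hw.1.mdifferentiableAt (by simp)) hs ht (v 0) 0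
    have h6 : v = ![v 0] := by funext i; fin_cases i; rfl
    rw [h6]
    refine Eq.trans ?_ h5
    change (pullbackForm 𝓘(ℝ, E₁ × ℝ) (𝓡∂ m) (fun z : E₁ × ℝ => Ψ (c₀ z.1) z.2) α (w, t) :
      (E₁ × ℝ) [⋀^Fin 1]→L[ℝ] ℝ) (fun i => mfderiv 𝓘(ℝ, E₁) 𝓘(ℝ, E₁ × ℝ)
        (fun w : E₁ => (w, t)) w (![v 0] i)) = _
    congr 1
    funext i
    fin_cases i
    rw [mfderiv_eq_fderiv]
    have h7 : fderiv ℝ (fun w : E₁ => (w, t)) w = ContinuousLinearMap.inl ℝ E₁ ℝ :=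
      (hasFDerivAt_prodMk_left w t).fderiv
    rw [h7]
    rfl
  rw [heq.extDeriv_eq]
  have hd : DifferentiableAt ℝ G₀ u := differentiableAt_pullbackForm hα.smooth (hc₀.of_le h2)
  change extDeriv (fun w => Real.exp t • G₀ w) u = Real.exp t • extDeriv G₀ u
  rw [extDeriv, extDeriv, fderiv_fun_const_smul hd]
  ext v
  simp [ContinuousAlternatingMap.alternatizeUncurryFin_apply]

end Flow

/-! ### Image of the skeleton -/

section Compactification

variable {n k : ℕ}
  {V : Type*} [TopologicalSpace V] [ChartedSpace (EuclideanSpace ℝ (Fin (2 * n + 2))) V]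
  {W : Type*} [TopologicalSpace W] [ChartedSpace (EuclideanSpace ℝ (Fin (2 * n))) W]
  {F : Type*} [TopologicalSpace F] [ChartedSpace (EuclideanHalfSpace (2 * n + 2)) F]
  {K : Type*} [TopologicalSpace K] [ChartedSpace (EuclideanSpace ℝ (Fin (2 * n + 1))) K]
  [MulAction Circle K]
  {Ω : DForm (𝓡 (2 * n + 2)) V 2} {ι : W → V} {lam : DForm (𝓡∂ (2 * n + 2)) F 1}
  {j : K → F} {p : K → W} {q : F → V} {Ψ : F → ℝ → F}

theorem IsBackwardSemiflow.mem_interior_of_mem_skeleton [T2Space F]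
    [IsManifold (𝓡∂ (2 * n + 2)) ∞ F] (hΨ : IsBackwardSemiflow lam Ψ) (hα : IsLiouvilleForm lam)
    {x : F} (hx : x ∈ skeleton lam) : x ∈ (𝓡∂ (2 * n + 2)).interior F := by
  by_contra h
  rw [← (𝓡∂ (2 * n + 2)).compl_boundary, notMem_compl_iff] at h
  exact (hΨ.notMem_skeleton_iff hα).2 ⟨x, h, 0, le_rfl, hΨ.zero x⟩ hx

namespace IsLiouvilleCompactification

/-- The collapse map has smooth local inverses on the complement of the hyperplane section. -/
theorem exists_local_inverse [IsManifold (𝓡∂ (2 * n + 2)) ∞ F]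
    (hF : IsLiouvilleCompactification k Ω ι lam j p q) {y : F}
    (hy : y ∈ (𝓡∂ (2 * n + 2)).interior F) :
    ∃ Q : V → F, ContMDiffAt (𝓡 (2 * n + 2)) (𝓡∂ (2 * n + 2)) ∞ Q (q y) ∧ Q (q y) = y ∧
      ∀ᶠ v in 𝓝 (q y), Q v ∈ (𝓡∂ (2 * n + 2)).interior F ∧ q (Q v) = v ∧
        ∀ f ∈ (𝓡∂ (2 * n + 2)).interior F, q f = v → Q v = f := by
  have hd := hF.diffeo ⟨y, hy⟩
  have h0 : hd.localInverse (q y) = y := hd.localInverse_left_inv hd.localInverse_mem_target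
  have h1 : ∀ᶠ v in 𝓝 (q y), hd.localInverse v ∈ (𝓡∂ (2 * n + 2)).interior F :=
    hd.localInverse_contMDiffAt.continuousAt.eventually
      (((𝓡∂ (2 * n + 2)).isOpen_interior (n := ∞) (by simp)).mem_nhds
        (show hd.localInverse (q y) ∈ _ from h0.symm ▸ hy))
  refine ⟨hd.localInverse, hd.localInverse_contMDiffAt, h0, ?_⟩
  filter_upwards [h1, hd.localInverse_eventuallyEq_right] with v hv hv'
  exact ⟨hv, hv', fun f hf hfv => hF.bijOn.injOn hv hf (Eq.trans hv' hfv.symm)⟩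

theorem contMDiffAt_collapse (hF : IsLiouvilleCompactification k Ω ι lam j p q) {y : F}
    (hy : y ∈ (𝓡∂ (2 * n + 2)).interior F) :
    ContMDiffAt (𝓡∂ (2 * n + 2)) (𝓡 (2 * n + 2)) ∞ q y :=
  (hF.diffeo ⟨y, hy⟩).contMDiffAt

/-- For suitable arbitrarily large times `T`, the backward flow maps the skeleton onto itself, while
it contracts the symplectic form by the factor `e^{-T}`. So the image of the skeleton has measure
zero. -/
theorem isNullSubset_image_skeleton [T2Space V] [IsManifold (𝓡 (2 * n + 2)) ∞ V]
    [T2Space F] [CompactSpace F] [IsManifold (𝓡∂ (2 * n + 2)) ∞ F]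
    (hF : IsLiouvilleCompactification k Ω ι lam j p q)
    (hΩ : IsSymplecticForm (𝓡 (2 * n + 2)) Ω) (hΨ : IsBackwardSemiflow lam Ψ)
    (hS : IsCompact (q '' skeleton lam)) :
    IsNullSubset (d := 2 * n + 2) (q '' skeleton lam) := by
  have hα := hF.liouville
  rcases isEmpty_or_nonempty F with hempty | hne
  · intro x₀
    simp [Set.eq_empty_of_isEmpty (skeleton lam)]
  obtain ⟨δ, hδ, hbij⟩ := hΨ.exists_bijOn_skeleton hα
  have hiter : ∀ N : ℕ, skeleton lam ⊆ (fun x => Ψ x (-(N * δ))) '' skeleton lam := by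
    intro N
    induction N with
    | zero => intro x hx; exact ⟨x, hx, by simp [hΨ.zero]⟩
    | succ N ih =>
      intro x hx
      obtain ⟨y, hy, rfl⟩ := ih hx
      obtain ⟨z, hz, rfl⟩ := hbij.surjOn hy
      refine ⟨z, hz, ?_⟩
      have : (0 : ℝ) ≤ N * δ := by positivity
      simp only
      rw [hΨ.add hα z (by linarith) (by linarith)]
      congr 1; push_cast; ring
  refine isNullSubset_of_contracting (by simp) hΩ.smooth hΩ.nondegenerate hS fun ε hε => ?_
  obtain ⟨N, hN0, hN⟩ : ∃ N : ℕ, 0 < N ∧ Real.exp (-(N * δ)) < ε := by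
    have h1 : Filter.Tendsto (fun N : ℕ => Real.exp (-(N * δ))) Filter.atTop (𝓝 0) :=
      Real.tendsto_exp_neg_atTop_nhds_zero.comp
        (tendsto_natCast_atTop_atTop.atTop_mul_const hδ)
    exact ((Filter.eventually_gt_atTop 0).and (h1.eventually (Iio_mem_nhds hε))).exists
  set T : ℝ := -(N * δ) with hT
  have hT0 : T < 0 := by rw [hT]; exact neg_neg_of_pos (by positivity)
  -- the inverse of `q` on the interior
  set R : V → F := Function.invFunOn q ((𝓡∂ (2 * n + 2)).interior F) with hR
  have hRq : ∀ y ∈ (𝓡∂ (2 * n + 2)).interior F, R (q y) = y := fun y hy =>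
    hF.bijOn.injOn.leftInvOn_invFunOn hy
  refine ⟨Real.exp T, Real.exp_pos _, hN, fun v => q (Ψ (R v) T), ?_, ?_⟩
  · rintro _ ⟨x, hx, rfl⟩
    obtain ⟨y, hy, rfl⟩ := hiter N hx
    exact ⟨q y, ⟨y, hy, rfl⟩, by simp only [hRq y (hΨ.mem_interior_of_mem_skeleton hα hy)]; rfl⟩
  · rintro _ ⟨s, hs, rfl⟩
    have hsi := hΨ.mem_interior_of_mem_skeleton hα hs
    obtain ⟨Q, hQ, hQs, hQev⟩ := hF.exists_local_inverse hsi
    set φ := extChartAt (𝓡 (2 * n + 2)) (q s) with hφ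
    set u := φ (q s) with hu
    have hφu : φ.symm u = q s := extChartAt_to_inv (q s)
    have hsymm : ContMDiffAt 𝓘(ℝ, EuclideanSpace ℝ (Fin (2 * n + 2))) (𝓡 (2 * n + 2)) ∞ φ.symm u :=
      (contMDiffOn_extChartAt_symm (q s)).contMDiffAt (extChartAt_target_mem_nhds (I := 𝓡 (2 * n + 2)) (q s))
    set c₀ : EuclideanSpace ℝ (Fin (2 * n + 2)) → F := fun w => Q (φ.symm w) with hc₀
    have hc₀u : c₀ u = s := by simp only [hc₀, hφu, hQs]
    have hc₀s : ContMDiffAt 𝓘(ℝ, EuclideanSpace ℝ (Fin (2 * n + 2))) (𝓡∂ (2 * n + 2)) ∞ c₀ u :=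
      ContMDiffAt.comp u (g := Q) (by rwa [hφu]) hsymm
    have hc₀i : c₀ u ∈ (𝓡∂ (2 * n + 2)).interior F := hc₀u.symm ▸ hsi
    have hΨi : Ψ (c₀ u) T ∈ (𝓡∂ (2 * n + 2)).interior F := hΨ.interior _ _ hT0
    have hflow := hΨ.contMDiffAt_time hα hc₀s hc₀i hT0
    have hAs : ContMDiffAt 𝓘(ℝ, EuclideanSpace ℝ (Fin (2 * n + 2))) (𝓡 (2 * n + 2)) ∞
        (fun w => q (Ψ (c₀ w) T)) u :=
      ContMDiffAt.comp u (g := q) (hF.contMDiffAt_collapse hΨi) hflow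
    have hφd : MDifferentiableAt (𝓡 (2 * n + 2)) 𝓘(ℝ, EuclideanSpace ℝ (Fin (2 * n + 2))) φ (q s) :=
      mdifferentiableAt_extChartAt (by simp)
    -- near `q s`, the map is the composition of the flow and the chart
    have hev : (fun v => q (Ψ (R v) T)) =ᶠ[𝓝 (q s)] fun v => q (Ψ (c₀ (φ v)) T) := by
      filter_upwards [hQev, extChartAt_source_mem_nhds (I := 𝓡 (2 * n + 2)) (q s)] with v hv hv'
      have h1 : c₀ (φ v) = Q v := by simp only [hc₀]; rw [φ.left_inv hv']
      have h2 : R v = Q v := by rw [← hRq _ hv.1, hv.2.1]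
      simp only [h1, h2]
    have hev' : (fun v => q (c₀ (φ v))) =ᶠ[𝓝 (q s)] fun v => v := by
      filter_upwards [hQev, extChartAt_source_mem_nhds (I := 𝓡 (2 * n + 2)) (q s)] with v hv hv'
      have h1 : c₀ (φ v) = Q v := by simp only [hc₀]; rw [φ.left_inv hv']
      rw [h1, hv.2.1]
    refine ⟨(MDifferentiableAt.congr_of_eventuallyEq ?_ hev), ?_⟩
    · exact (hAs.mdifferentiableAt (by simp)).comp (q s) hφd
    have hqd : ∀ y ∈ (𝓡∂ (2 * n + 2)).interior F,
        MDifferentiableAt (𝓡∂ (2 * n + 2)) (𝓡 (2 * n + 2)) q y := fun y hy =>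
      (hF.contMDiffAt_collapse hy).mdifferentiableAt (by simp)
    have e1 : pullbackForm 𝓘(ℝ, EuclideanSpace ℝ (Fin (2 * n + 2))) (𝓡 (2 * n + 2))
        (fun w => q (Ψ (c₀ w) T)) Ω u = Real.exp T •
        pullbackForm 𝓘(ℝ, EuclideanSpace ℝ (Fin (2 * n + 2))) (𝓡 (2 * n + 2))
          (fun w => q (c₀ w)) Ω u := by
      rw [pullbackForm_comp (f := fun w => Ψ (c₀ w) T) (hqd _ hΨi) (hflow.mdifferentiableAt (by simp)),
        pullbackForm_comp (f := c₀) (hqd _ hc₀i) (hc₀s.mdifferentiableAt (by simp)),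
        pullbackForm_congr_form (f := c₀) (hF.pullback_eq _ hc₀i),
        pullbackForm_congr_form (f := fun w => Ψ (c₀ w) T) (hF.pullback_eq _ hΨi)]
      exact hΨ.pullbackForm_extD hα hc₀s hc₀i hT0
    rw [pullbackForm_congr hev, pullbackForm_comp (f := φ)
      (g := fun w => q (Ψ (c₀ w) T)) (hAs.mdifferentiableAt (by simp)) hφd,
      pullbackForm_congr_form (f := φ) (Ω' := Real.exp T •
        pullbackForm 𝓘(ℝ, EuclideanSpace ℝ (Fin (2 * n + 2))) (𝓡 (2 * n + 2))
          (fun w => q (c₀ w)) Ω) e1, pullbackForm_smul]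
    have e2 := pullbackForm_comp (I := 𝓡 (2 * n + 2)) (g := fun w => q (c₀ w)) (f := φ) (x := q s)
      (((hqd _ hc₀i)).comp u (hc₀s.mdifferentiableAt (by simp))) hφd Ω
    rw [Pi.smul_apply, ← e2, pullbackForm_congr hev', pullbackForm_id]

end IsLiouvilleCompactification

end Compactification

/-! ### Smoothness of the disk bundle chart -/

section Polar

theorem Circle.exp_arg_mul (g : Circle) {z : ℂ} (hz : z ≠ 0) :
    Circle.exp (Complex.arg (g * z)) = g * Circle.exp (Complex.arg z) := by
  have h1 := Complex.norm_mul_exp_arg_mul_I z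
  have h2 := Complex.norm_mul_exp_arg_mul_I (g * z)
  rw [norm_mul, Circle.norm_coe, one_mul] at h2
  have h3 : (‖z‖ : ℂ) ≠ 0 := by simpa using hz
  refine Circle.ext ?_
  rw [Circle.coe_mul, Circle.coe_exp, Circle.coe_exp]
  refine mul_left_cancel₀ h3 ?_
  rw [h2, mul_left_comm, h1]

theorem Circle.exists_inv_mul_eq_norm (z : ℂ) :
    ∃ g : Circle, ((g⁻¹ : Circle) : ℂ) * z = (‖z‖ : ℂ) := by
  refine ⟨Circle.exp (Complex.arg z), ?_⟩
  have h := Complex.norm_mul_exp_arg_mul_I z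
  rw [← Circle.exp_neg, Circle.coe_exp]
  calc _ = Complex.exp ((-Complex.arg z : ℝ) * Complex.I) *
        (‖z‖ * Complex.exp (Complex.arg z * Complex.I)) := by rw [h]
    _ = _ := by
      rw [mul_left_comm, ← Complex.exp_add]
      push_cast
      rw [neg_mul, neg_add_cancel, Complex.exp_zero, mul_one]

theorem log_one_sub_norm_sq_neg {z : ℂ} (hz0 : z ≠ 0) (hz : ‖z‖ < 1) :
    Real.log (1 - ‖z‖ ^ 2) < 0 := by
  have h0 : 0 < ‖z‖ := norm_pos_iff.2 hz0
  exact Real.log_neg (by nlinarith) (by nlinarith)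

variable {K F V : Type*} [MulAction Circle K]
  {j : K → F} {q : F → V} {Ψ : F → ℝ → F}

/-- The angular part of the disk map is invariant under the anti-diagonal circle action. -/
theorem exp_arg_smul_smul (g : Circle) (x : K) {z : ℂ} (hz : z ≠ 0) :
    Circle.exp (Complex.arg (g⁻¹ * z)) • (g • x) = Circle.exp (Complex.arg z) • x := by
  have h := Circle.exp_arg_mul g⁻¹ hz
  rw [h, smul_smul, mul_right_comm, inv_mul_cancel, one_mul]

/-- The parametrization of the disk bundle by `K × {|z| < 1}`, given by the backward flow from the
boundary. -/
def diskMap (j : K → F) (q : F → V) (Ψ : F → ℝ → F) : K × ℂ → V :=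
  polarMap q fun x t => Ψ (j x) t

theorem diskMap_ofReal (x : K) {r : ℝ} (hr : 0 ≤ r) :
    diskMap j q Ψ (x, (r : ℂ)) = q (Ψ (j x) (Real.log (1 - r ^ 2))) := by
  simp [diskMap, polarMap, Complex.arg_ofReal_of_nonneg hr, Circle.exp_zero]

theorem diskMap_sqrt (x : K) {s : ℝ} (hs : s ≤ 1) :
    diskMap j q Ψ (x, (Real.sqrt (1 - s) : ℂ)) = q (Ψ (j x) (Real.log s)) := by
  rw [diskMap_ofReal x (Real.sqrt_nonneg _), Real.sq_sqrt (by linarith), sub_sub_cancel]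

end Polar

section Compactification

variable {n k : ℕ}
  {V : Type*} [TopologicalSpace V] [ChartedSpace (EuclideanSpace ℝ (Fin (2 * n + 2))) V]
  {W : Type*} [TopologicalSpace W] [ChartedSpace (EuclideanSpace ℝ (Fin (2 * n))) W]
  {F : Type*} [TopologicalSpace F] [ChartedSpace (EuclideanHalfSpace (2 * n + 2)) F]
  {K : Type*} [TopologicalSpace K] [ChartedSpace (EuclideanSpace ℝ (Fin (2 * n + 1))) K]
  [MulAction Circle K]
  {Ω : DForm (𝓡 (2 * n + 2)) V 2} {ι : W → V} {lam : DForm (𝓡∂ (2 * n + 2)) F 1}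
  {j : K → F} {p : K → W} {q : F → V} {Ψ : F → ℝ → F}

namespace IsLiouvilleCompactification

theorem diskMap_zero (hF : IsLiouvilleCompactification k Ω ι lam j p q)
    (hΨ : IsBackwardSemiflow lam Ψ) (x : K) : diskMap j q Ψ (x, 0) = ι (p x) := by
  simp [diskMap, polarMap, Circle.exp_zero, hΨ.zero, hF.projects]

theorem contMDiffAt_diskMap_zero (hF : IsLiouvilleCompactification k Ω ι lam j p q)
    (hΨ : IsBackwardSemiflow lam Ψ) (x : K) :
    ContMDiffAt ((𝓡 (2 * n + 1)).prod 𝓘(ℝ, ℂ)) (𝓡 (2 * n + 2)) ∞ (diskMap j q Ψ) (x, 0) :=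
  (hF.collapse 1 (fun x t => Ψ (j x) t) one_pos
    (fun x => ⟨hΨ.zero _, (hΨ.integral (j x)).mono fun _ ht => ht.2⟩) x).1

variable [IsManifold (𝓡∂ (2 * n + 2)) ∞ F] [T2Space F]

/-- The backward flow from the boundary is smooth at negative times: near the boundary, this is part
of the hypothesis that `V` is the manifold obtained by collapsing the circles of the boundary. -/
theorem contMDiffAt_flow (hF : IsLiouvilleCompactification k Ω ι lam j p q)
    [IsManifold (𝓡 (2 * n + 2)) ∞ V] [IsManifold (𝓡 (2 * n + 1)) ∞ K]
    (hΨ : IsBackwardSemiflow lam Ψ) {x₀ : K} {u : EuclideanSpace ℝ (Fin (2 * n + 1))}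
    (hu : u ∈ (extChartAt (𝓡 (2 * n + 1)) x₀).target) {t : ℝ} (ht : t < 0) :
    ContMDiffAt 𝓘(ℝ, EuclideanSpace ℝ (Fin (2 * n + 1)) × ℝ) (𝓡∂ (2 * n + 2)) ∞
      (fun z : EuclideanSpace ℝ (Fin (2 * n + 1)) × ℝ =>
        Ψ (j ((extChartAt (𝓡 (2 * n + 1)) x₀).symm z.1)) z.2) (u, t) := by
  have hα := hF.liouville
  refine contMDiffAt_infty_of_forall_ne_zero fun N hN => ?_
  have hNtop : (N : ℕ∞ω) ≤ ∞ := by exact_mod_cast le_top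
  set κ := extChartAt (𝓡 (2 * n + 1)) x₀ with hκ
  have hD : ∀ᶠ y in 𝓝 (κ.symm u, (0 : ℂ)),
      ContMDiffAt ((𝓡 (2 * n + 1)).prod 𝓘(ℝ, ℂ)) (𝓡 (2 * n + 2)) N (diskMap j q Ψ) y :=
    (contMDiffAt_iff_contMDiffAt_nhds (by simp)).1
      ((hF.contMDiffAt_diskMap_zero hΨ (κ.symm u)).of_le hNtop)
  have hc : ContinuousAt (fun t : ℝ => (κ.symm u, ((Real.sqrt (1 - Real.exp t) : ℝ) : ℂ))) 0 := by
    fun_prop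
  have hD' := hc.eventually (by simpa using hD)
  obtain ⟨t₀, hD₀, ht₀⟩ : ∃ t₀ : ℝ, ContMDiffAt ((𝓡 (2 * n + 1)).prod 𝓘(ℝ, ℂ)) (𝓡 (2 * n + 2)) N
      (diskMap j q Ψ) (κ.symm u, ((Real.sqrt (1 - Real.exp t₀) : ℝ) : ℂ)) ∧ t₀ < 0 :=
    ((hD'.filter_mono (nhdsWithin_le_nhds (s := Iio 0))).and self_mem_nhdsWithin).exists
  refine hΨ.contMDiffAt_of_contMDiffAt hα (c₀ := fun w => j (κ.symm w)) hN ht₀ ?_ ht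
  set f : EuclideanSpace ℝ (Fin (2 * n + 1)) × ℝ → F := fun z => Ψ (j (κ.symm z.1)) z.2 with hf
  -- the composition with the collapse map is smooth
  have hqf : ContMDiffAt 𝓘(ℝ, EuclideanSpace ℝ (Fin (2 * n + 1)) × ℝ) (𝓡 (2 * n + 2)) N
      (fun z => q (f z)) (u, t₀) := by
    have h1 : (fun z => q (f z)) =ᶠ[𝓝 (u, t₀)]
        fun z => diskMap j q Ψ (κ.symm z.1, ((Real.sqrt (1 - Real.exp z.2) : ℝ) : ℂ)) := by
      filter_upwards [(continuousAt_snd (p := (u, t₀))).eventually (Iio_mem_nhds ht₀)] with z hz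
      rw [diskMap_sqrt _ (Real.exp_le_one_iff.2 (le_of_lt hz)), Real.log_exp]
    refine ContMDiffAt.congr_of_eventuallyEq ?_ h1
    refine ContMDiffAt.comp (u, t₀) (g := diskMap j q Ψ) (f := fun z : _ × ℝ =>
      (κ.symm z.1, ((Real.sqrt (1 - Real.exp z.2) : ℝ) : ℂ))) hD₀ (ContMDiffAt.prodMk ?_ ?_)
    · have h2 : ContMDiffAt 𝓘(ℝ, EuclideanSpace ℝ (Fin (2 * n + 1))) (𝓡 (2 * n + 1)) N κ.symm u :=
        ((contMDiffOn_extChartAt_symm (n := ∞) x₀).of_le hNtop).contMDiffAt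
          (extChartAt_target_mem_nhds' hu)
      exact ContMDiffAt.comp (u, t₀) (g := κ.symm) (f := Prod.fst) h2
        (ContDiffAt.contMDiffAt contDiffAt_fst)
    · refine ContDiffAt.contMDiffAt ?_
      have h3 : ContDiffAt ℝ N (fun z : EuclideanSpace ℝ (Fin (2 * n + 1)) × ℝ =>
          Real.sqrt (1 - Real.exp z.2)) (u, t₀) := by
        refine ContDiffAt.sqrt (by fun_prop) ?_
        have := Real.exp_lt_one_iff.2 ht₀
        simp only
        linarith
      exact Complex.ofRealCLM.contDiff.contDiffAt.comp _ h3
  -- compose with a smooth local inverse of the collapse map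
  obtain ⟨Q, hQ, -, hQev⟩ := hF.exists_local_inverse (hΨ.interior (j (κ.symm u)) t₀ ht₀)
  have hev : f =ᶠ[𝓝 (u, t₀)] fun z => Q (q (f z)) := by
    filter_upwards [hqf.continuousAt.eventually hQev,
      (continuousAt_snd (p := (u, t₀))).eventually (Iio_mem_nhds ht₀)] with z hz hz'
    exact (hz.2.2 (f z) (hΨ.interior _ _ hz') rfl).symm
  refine ContMDiffAt.congr_of_eventuallyEq ?_ hev
  exact ContMDiffAt.comp (u, t₀) (g := Q) (hQ.of_le hNtop) hqf

end IsLiouvilleCompactification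

end Compactification

section Compactification

variable {n k : ℕ}
  {V : Type*} [TopologicalSpace V] [ChartedSpace (EuclideanSpace ℝ (Fin (2 * n + 2))) V]
  {W : Type*} [TopologicalSpace W] [ChartedSpace (EuclideanSpace ℝ (Fin (2 * n))) W]
  {F : Type*} [TopologicalSpace F] [ChartedSpace (EuclideanHalfSpace (2 * n + 2)) F]
  {K : Type*} [TopologicalSpace K] [ChartedSpace (EuclideanSpace ℝ (Fin (2 * n + 1))) K]
  [MulAction Circle K]
  {Ω : DForm (𝓡 (2 * n + 2)) V 2} {ι : W → V} {lam : DForm (𝓡∂ (2 * n + 2)) F 1}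
  {j : K → F} {p : K → W} {q : F → V} {Ψ : F → ℝ → F}

namespace IsLiouvilleCompactification

theorem contMDiff_smul (hF : IsLiouvilleCompactification k Ω ι lam j p q) (g : Circle) :
    ContMDiff (𝓡 (2 * n + 1)) (𝓡 (2 * n + 1)) ∞ fun x : K => g • x :=
  hF.bundle.smooth_action.comp (contMDiff_const.prodMk contMDiff_id)

/-- The disk map is invariant under the anti-diagonal circle action. -/
theorem diskMap_smul (hF : IsLiouvilleCompactification k Ω ι lam j p q)
    (hΨ : IsBackwardSemiflow lam Ψ) (g : Circle) (x : K) (z : ℂ) :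
    diskMap j q Ψ (g • x, (g⁻¹ : Circle) * z) = diskMap j q Ψ (x, z) := by
  rcases eq_or_ne z 0 with rfl | hz
  · rw [mul_zero, hF.diskMap_zero hΨ, hF.diskMap_zero hΨ, (hF.bundle.fibres x (g • x)).2 ⟨g, rfl⟩]
  · simp only [diskMap, polarMap]
    rw [exp_arg_smul_smul g x hz, norm_mul, Circle.norm_coe, one_mul]

theorem contMDiff_rotation (hF : IsLiouvilleCompactification k Ω ι lam j p q) (g : Circle) :
    ContMDiff ((𝓡 (2 * n + 1)).prod 𝓘(ℝ, ℂ)) ((𝓡 (2 * n + 1)).prod 𝓘(ℝ, ℂ)) ∞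
      fun y : K × ℂ => (g • y.1, ((g⁻¹ : Circle) : ℂ) * y.2) := by
  refine ((hF.contMDiff_smul g).comp contMDiff_fst).prodMk ?_
  have h : ContMDiff 𝓘(ℝ, ℂ) 𝓘(ℝ, ℂ) ∞ fun z : ℂ => ((g⁻¹ : Circle) : ℂ) * z :=
    ContDiff.contMDiff (by fun_prop)
  exact h.comp contMDiff_snd

theorem injective_boundary (hF : IsLiouvilleCompactification k Ω ι lam j p q) :
    Function.Injective j := hF.boundary_embedding.isEmbedding.injective

theorem mem_boundary (hF : IsLiouvilleCompactification k Ω ι lam j p q) (x : K) :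
    j x ∈ (𝓡∂ (2 * n + 2)).boundary F := hF.boundary_range ▸ mem_range_self x

theorem collapse_notMem_range (hF : IsLiouvilleCompactification k Ω ι lam j p q) {f : F}
    (hf : f ∈ (𝓡∂ (2 * n + 2)).interior F) : q f ∉ range ι := hF.bijOn.mapsTo hf

variable [IsManifold (𝓡∂ (2 * n + 2)) ∞ F] [T2Space F]

theorem contMDiffAt_diskMap_ofReal (hF : IsLiouvilleCompactification k Ω ι lam j p q)
    [IsManifold (𝓡 (2 * n + 2)) ∞ V] [IsManifold (𝓡 (2 * n + 1)) ∞ K]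
    (hΨ : IsBackwardSemiflow lam Ψ) (x : K) {r : ℝ} (hr0 : 0 < r) (hr1 : r < 1) :
    ContMDiffAt ((𝓡 (2 * n + 1)).prod 𝓘(ℝ, ℂ)) (𝓡 (2 * n + 2)) ∞ (diskMap j q Ψ) (x, (r : ℂ)) := by
  have hα := hF.liouville
  set κ := extChartAt (𝓡 (2 * n + 1)) x with hκ
  set f : EuclideanSpace ℝ (Fin (2 * n + 1)) × ℝ → F := fun z => Ψ (j (κ.symm z.1)) z.2 with hf
  have harg : ContMDiffAt 𝓘(ℝ, ℂ) 𝓘(ℝ, ℝ) ∞ Complex.arg (r : ℂ) := by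
    refine ContDiffAt.contMDiffAt ?_
    have h1 : ContDiffAt ℝ ∞ Complex.log (r : ℂ) :=
      (Complex.contDiffAt_log (n := ∞) (by simp [Complex.slitPlane, hr0])).restrict_scalars ℝ
    have h2 : ContDiffAt ℝ ∞ (fun z : ℂ => (Complex.log z).im) (r : ℂ) :=
      Complex.imCLM.contDiff.contDiffAt.comp _ h1
    simpa only [Complex.log_im] using h2
  -- the angular part
  set A : K × ℂ → K := fun y => Circle.exp (Complex.arg y.2) • y.1 with hA
  have hA0 : A (x, (r : ℂ)) = x := by
    simp [hA, Complex.arg_ofReal_of_nonneg hr0.le, Circle.exp_zero]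
  have hAs : ContMDiffAt ((𝓡 (2 * n + 1)).prod 𝓘(ℝ, ℂ)) (𝓡 (2 * n + 1)) ∞ A (x, (r : ℂ)) := by
    have h1 : ContMDiffAt ((𝓡 (2 * n + 1)).prod 𝓘(ℝ, ℂ)) 𝓘(ℝ, ℝ) ∞
        (fun y : K × ℂ => Complex.arg y.2) (x, (r : ℂ)) :=
      ContMDiffAt.comp (x, (r : ℂ)) (g := Complex.arg) (f := Prod.snd) harg contMDiffAt_snd
    have h2 : ContMDiffAt ((𝓡 (2 * n + 1)).prod 𝓘(ℝ, ℂ)) (𝓡 1) ∞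
        (fun y : K × ℂ => Circle.exp (Complex.arg y.2)) (x, (r : ℂ)) :=
      (contMDiff_circleExp.contMDiffAt).comp (x, (r : ℂ)) h1
    exact (hF.bundle.smooth_action.contMDiffAt).comp (x, (r : ℂ)) (h2.prodMk contMDiffAt_fst)
  -- the radial part
  have hlog : ContMDiffAt ((𝓡 (2 * n + 1)).prod 𝓘(ℝ, ℂ)) 𝓘(ℝ, ℝ) ∞
      (fun y : K × ℂ => Real.log (1 - ‖y.2‖ ^ 2)) (x, (r : ℂ)) := by
    have h1 : ContDiffAt ℝ ∞ (fun z : ℂ => Real.log (1 - ‖z‖ ^ 2)) (r : ℂ) := by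
      refine ContDiffAt.log (contDiffAt_const.sub (contDiff_norm_sq ℝ).contDiffAt) ?_
      simp only [Complex.norm_real, Real.norm_eq_abs, sq_abs]
      nlinarith
    exact ContMDiffAt.comp (x, (r : ℂ)) (g := fun z : ℂ => Real.log (1 - ‖z‖ ^ 2)) (f := Prod.snd)
      h1.contMDiffAt contMDiffAt_snd
  have hev : diskMap j q Ψ =ᶠ[𝓝 (x, (r : ℂ))]
      fun y => q (f (κ (A y), Real.log (1 - ‖y.2‖ ^ 2))) := by
    filter_upwards [hAs.continuousAt.eventually
      (by rw [hA0]; exact extChartAt_source_mem_nhds (I := 𝓡 (2 * n + 1)) x)] with y hy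
    simp only [hf]
    rw [κ.left_inv hy]
    rfl
  have ht : Real.log (1 - ‖(r : ℂ)‖ ^ 2) < 0 := by
    simp only [Complex.norm_real, Real.norm_eq_abs, sq_abs]
    exact Real.log_neg (by nlinarith) (by nlinarith)
  refine ContMDiffAt.congr_of_eventuallyEq ?_ hev
  refine ContMDiffAt.comp (x, (r : ℂ)) (g := q)
    (f := fun y : K × ℂ => f (κ (A y), Real.log (1 - ‖y.2‖ ^ 2)))
    (hF.contMDiffAt_collapse (hΨ.interior _ _ ht)) ?_
  have hκA : ContMDiffAt ((𝓡 (2 * n + 1)).prod 𝓘(ℝ, ℂ)) 𝓘(ℝ, EuclideanSpace ℝ (Fin (2 * n + 1))) ∞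
      (fun y => κ (A y)) (x, (r : ℂ)) :=
    ContMDiffAt.comp (x, (r : ℂ)) (g := κ) (by rw [hA0]; exact contMDiffAt_extChartAt) hAs
  refine ContMDiffAt.comp (x, (r : ℂ)) (g := f) (hF.contMDiffAt_flow hΨ ?_ ht)
    (hκA.prodMk_space hlog)
  rw [hA0]
  exact mem_extChartAt_target x

theorem contMDiffAt_diskMap (hF : IsLiouvilleCompactification k Ω ι lam j p q)
    [IsManifold (𝓡 (2 * n + 2)) ∞ V] [IsManifold (𝓡 (2 * n + 1)) ∞ K]
    (hΨ : IsBackwardSemiflow lam Ψ) (x : K) {z : ℂ} (hz : ‖z‖ < 1) :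
    ContMDiffAt ((𝓡 (2 * n + 1)).prod 𝓘(ℝ, ℂ)) (𝓡 (2 * n + 2)) ∞ (diskMap j q Ψ) (x, z) := by
  rcases eq_or_ne z 0 with rfl | hz0
  · exact hF.contMDiffAt_diskMap_zero hΨ x
  · -- rotate to the positive real axis, near which the argument is smooth
    obtain ⟨g, hg⟩ := Circle.exists_inv_mul_eq_norm z
    have h1 : diskMap j q Ψ = diskMap j q Ψ ∘ fun y : K × ℂ => (g • y.1, ((g⁻¹ : Circle) : ℂ) * y.2) :=
      funext fun y => (hF.diskMap_smul hΨ g y.1 y.2).symm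
    rw [h1]
    refine ContMDiffAt.comp (x, z) ?_ (hF.contMDiff_rotation g).contMDiffAt
    simp only [hg]
    exact hF.contMDiffAt_diskMap_ofReal hΨ _ (norm_pos_iff.2 hz0) hz

/-! ### The disk map identifies the disk bundle with the complement of the skeleton -/

/-- The fibres of the disk map are the orbits of the anti-diagonal circle action: it induces an
injective map on the associated disk bundle. -/
theorem diskMap_eq_iff (hF : IsLiouvilleCompactification k Ω ι lam j p q)
    (hι : Function.Injective ι)
    (hΨ : IsBackwardSemiflow lam Ψ) (x y : K) {z w : ℂ} (hz : ‖z‖ < 1) (hw : ‖w‖ < 1) :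
    diskMap j q Ψ (x, z) = diskMap j q Ψ (y, w) ↔ ∃ g : Circle, y = g • x ∧ z = g * w := by
  constructor
  · intro h
    have hint : ∀ (x : K) {z : ℂ}, z ≠ 0 → ‖z‖ < 1 → Ψ (j (Circle.exp (Complex.arg z) • x))
        (Real.log (1 - ‖z‖ ^ 2)) ∈ (𝓡∂ (2 * n + 2)).interior F := fun x z h0 h1 =>
      hΨ.interior _ _ (log_one_sub_norm_sq_neg h0 h1)
    have hnot : ∀ (x : K) {z : ℂ}, z ≠ 0 → ‖z‖ < 1 → diskMap j q Ψ (x, z) ∉ range ι :=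
      fun x z h0 h1 => hF.collapse_notMem_range (hint x h0 h1)
    have hzero : ∀ x : K, diskMap j q Ψ (x, 0) ∈ range ι := fun x =>
      ⟨p x, (hF.diskMap_zero hΨ x).symm⟩
    rcases eq_or_ne z 0 with rfl | hz0
    · rcases eq_or_ne w 0 with rfl | hw0
      · rw [hF.diskMap_zero hΨ, hF.diskMap_zero hΨ] at h
        obtain ⟨g, hg⟩ := (hF.bundle.fibres x y).1 (hι h)
        exact ⟨g, hg, by simp⟩
      · exact absurd (h ▸ hzero x) (hnot y hw0 hw)
    · rcases eq_or_ne w 0 with rfl | hw0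
      · exact absurd (h.symm ▸ hzero y) (hnot x hz0 hz)
      · have h1 := hF.bijOn.injOn (hint x hz0 hz) (hint y hw0 hw) h
        obtain ⟨h2, h3⟩ := hΨ.eq_and_eq hF.liouville (hF.mem_boundary _) (hF.mem_boundary _)
          (log_one_sub_norm_sq_neg hz0 hz).le (log_one_sub_norm_sq_neg hw0 hw).le h1
        have h4 : 1 - ‖z‖ ^ 2 = 1 - ‖w‖ ^ 2 :=
          Real.log_injOn_pos (by simp only [mem_Ioi]; nlinarith [norm_nonneg z])
            (by simp only [mem_Ioi]; nlinarith [norm_nonneg w]) h2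
        have h5 : ‖z‖ = ‖w‖ := by
          have : ‖z‖ ^ 2 = ‖w‖ ^ 2 := by linarith
          exact (sq_eq_sq₀ (norm_nonneg z) (norm_nonneg w)).1 this
        have h6 := hF.injective_boundary h3
        refine ⟨(Circle.exp (Complex.arg w))⁻¹ * Circle.exp (Complex.arg z), ?_, ?_⟩
        · rw [mul_smul, h6, inv_smul_smul]
        · have e1 := Complex.norm_mul_exp_arg_mul_I z
          have e2 := Complex.norm_mul_exp_arg_mul_I w
          have e3 : (Circle.exp (Complex.arg w) : ℂ) ≠ 0 := Circle.coe_ne_zero _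
          rw [← Circle.coe_exp] at e1 e2
          rw [Circle.coe_mul, Circle.coe_inv]
          calc z = ‖w‖ * (Circle.exp (Complex.arg z) : ℂ) := by rw [← h5]; exact e1.symm
            _ = (Circle.exp (Complex.arg w) : ℂ)⁻¹ * Circle.exp (Complex.arg z) *
                (‖w‖ * Circle.exp (Complex.arg w)) := by field_simp
            _ = _ := by rw [e2]
  · rintro ⟨g, rfl, rfl⟩
    have h := hF.diskMap_smul hΨ g x (g * w)
    rw [← mul_assoc, ← Circle.coe_mul, inv_mul_cancel, Circle.coe_one, one_mul] at h
    exact h.symm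

theorem image_diskMap (hF : IsLiouvilleCompactification k Ω ι lam j p q)
    (hΨ : IsBackwardSemiflow lam Ψ) :
    diskMap j q Ψ '' (univ ×ˢ Metric.ball (0 : ℂ) 1) = (q '' skeleton lam)ᶜ := by
  have hα := hF.liouville
  ext v
  constructor
  · rintro ⟨⟨x, z⟩, ⟨-, hz⟩, rfl⟩ ⟨s, hs, hsv⟩
    have hz : ‖z‖ < 1 := by simpa using hz
    have hsi := hΨ.mem_interior_of_mem_skeleton hα hs
    rcases eq_or_ne z 0 with rfl | hz0
    · exact hF.collapse_notMem_range hsi ⟨p x, by rw [hsv, hF.diskMap_zero hΨ]⟩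
    · have h1 := hF.bijOn.injOn hsi (hΨ.interior _ _ (log_one_sub_norm_sq_neg hz0 hz)) hsv
      exact (hΨ.notMem_skeleton_iff hα).2 ⟨_, hF.mem_boundary _, _, (log_one_sub_norm_sq_neg hz0 hz).le,
        h1.symm⟩ hs
  · intro hv
    obtain ⟨f, rfl⟩ : ∃ f, q f = v := by
      by_cases h : v ∈ range ι
      · obtain ⟨w, rfl⟩ := h
        obtain ⟨x, rfl⟩ := hF.bundle.surjective w
        exact ⟨j x, hF.projects x⟩
      · obtain ⟨f, -, hf⟩ := hF.bijOn.surjOn h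
        exact ⟨f, hf⟩
    obtain ⟨y, hy, t, ht, rfl⟩ := (hΨ.notMem_skeleton_iff hα).1 fun h => hv ⟨f, h, rfl⟩
    rw [← hF.boundary_range] at hy
    obtain ⟨x, rfl⟩ := hy
    refine ⟨(x, ((Real.sqrt (1 - Real.exp t) : ℝ) : ℂ)), ⟨mem_univ _, ?_⟩, ?_⟩
    · rw [mem_ball_zero_iff, Complex.norm_real, Real.norm_eq_abs, abs_of_nonneg (Real.sqrt_nonneg _),
        Real.sqrt_lt' one_pos]
      linarith [Real.exp_pos t]
    · rw [diskMap_sqrt _ (Real.exp_le_one_iff.2 ht), Real.log_exp]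

end IsLiouvilleCompactification

end Compactification

/-! ### The canonical form of the symplectization -/

section Symplectization

/-- In a manifold modelled on a vector space, the chart expression of a form is a pull-back. -/
theorem chartForm_eq_pullbackForm {E : Type*} [NormedAddCommGroup E] [NormedSpace ℝ E]
    {H : Type*} [TopologicalSpace H] {I : ModelWithCorners ℝ E H} [I.Boundaryless]
    {M : Type*} [TopologicalSpace M] [ChartedSpace H M] {q : ℕ} (Ω : DForm I M q) (x₀ : M) (y : E) :
    chartForm I Ω x₀ y = (pullbackForm 𝓘(ℝ, E) I (extChartAt I x₀).symm Ω y : E [⋀^Fin q]→L[ℝ] ℝ) := by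
  rw [chartForm, ModelWithCorners.range_eq_univ, mfderivWithin_univ]
  rfl

variable {a : ℕ}
  {K : Type*} [TopologicalSpace K] [ChartedSpace (EuclideanSpace ℝ (Fin a)) K]

/-- The inverse of the product chart of `K × ℝ`. -/
def prodChartSymm (x₀ : K) (z : EuclideanSpace ℝ (Fin a) × ℝ) : K × ℝ :=
  ((extChartAt (𝓡 a) x₀).symm z.1, z.2)

variable [IsManifold (𝓡 a) ∞ K]

theorem contMDiffAt_extChartAt_symm_of_mem {x₀ : K} {u : EuclideanSpace ℝ (Fin a)}
    (hu : u ∈ (extChartAt (𝓡 a) x₀).target) :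
    ContMDiffAt 𝓘(ℝ, EuclideanSpace ℝ (Fin a)) (𝓡 a) ∞ (extChartAt (𝓡 a) x₀).symm u :=
  (contMDiffOn_extChartAt_symm x₀).contMDiffAt (extChartAt_target_mem_nhds' hu)

theorem contMDiffAt_prodChartSymm {x₀ : K} {z : EuclideanSpace ℝ (Fin a) × ℝ}
    (hz : z.1 ∈ (extChartAt (𝓡 a) x₀).target) :
    ContMDiffAt 𝓘(ℝ, EuclideanSpace ℝ (Fin a) × ℝ) ((𝓡 a).prod 𝓘(ℝ, ℝ)) ∞ (prodChartSymm x₀) z := by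
  refine ContMDiffAt.prodMk ?_ (ContDiffAt.contMDiffAt contDiffAt_snd)
  exact ContMDiffAt.comp z (g := (extChartAt (𝓡 a) x₀).symm) (f := Prod.fst)
    (contMDiffAt_extChartAt_symm_of_mem hz) (ContDiffAt.contMDiffAt contDiffAt_fst)

theorem surjective_mfderiv_prodChartSymm {x₀ : K} {z : EuclideanSpace ℝ (Fin a) × ℝ}
    (hz : z.1 ∈ (extChartAt (𝓡 a) x₀).target) :
    Function.Surjective
      (mfderiv 𝓘(ℝ, EuclideanSpace ℝ (Fin a) × ℝ) ((𝓡 a).prod 𝓘(ℝ, ℝ)) (prodChartSymm x₀) z) := by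
  have hs := (contMDiffAt_prodChartSymm hz).mdifferentiableAt (by simp)
  set y := prodChartSymm x₀ z with hy
  let e : K × ℝ → EuclideanSpace ℝ (Fin a) × ℝ := fun y => (extChartAt (𝓡 a) x₀ y.1, y.2)
  have hys : y.1 ∈ (extChartAt (𝓡 a) x₀).source := (extChartAt (𝓡 a) x₀).map_target hz
  have hez : e y = z := Prod.ext ((extChartAt (𝓡 a) x₀).right_inv hz) rfl
  have he : MDifferentiableAt ((𝓡 a).prod 𝓘(ℝ, ℝ)) 𝓘(ℝ, EuclideanSpace ℝ (Fin a) × ℝ) e y := by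
    have h1 : MDifferentiableAt ((𝓡 a).prod 𝓘(ℝ, ℝ)) 𝓘(ℝ, EuclideanSpace ℝ (Fin a))
        (fun y : K × ℝ => extChartAt (𝓡 a) x₀ y.1) y :=
      MDifferentiableAt.comp y (g := extChartAt (𝓡 a) x₀) (f := Prod.fst)
        (mdifferentiableAt_extChartAt (by simpa using hys)) mdifferentiableAt_fst
    exact h1.prodMk_space mdifferentiableAt_snd
  have hev : (fun y => prodChartSymm x₀ (e y)) =ᶠ[𝓝 y] fun y => y := by
    have h1 : ∀ᶠ y' : K × ℝ in 𝓝 y, y'.1 ∈ (extChartAt (𝓡 a) x₀).source :=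
      continuousAt_fst.eventually (extChartAt_source_mem_nhds' hys)
    filter_upwards [h1] with y' hy'
    exact Prod.ext ((extChartAt (𝓡 a) x₀).left_inv hy') rfl
  have key : Function.Surjective (mfderiv 𝓘(ℝ, EuclideanSpace ℝ (Fin a) × ℝ)
      ((𝓡 a).prod 𝓘(ℝ, ℝ)) (prodChartSymm x₀) (e y)) := by
    refine surjective_mfderiv_of_comp (by rw [hez]; exact hs) he ?_
    have h1 : (mfderiv ((𝓡 a).prod 𝓘(ℝ, ℝ)) ((𝓡 a).prod 𝓘(ℝ, ℝ))
        (fun y => prodChartSymm x₀ (e y)) y : EuclideanSpace ℝ (Fin a) × ℝ →L[ℝ] _) =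
        ContinuousLinearMap.id ℝ _ := hev.mfderiv_eq.trans mfderiv_id
    intro w
    exact ⟨w, congrArg (fun L : EuclideanSpace ℝ (Fin a) × ℝ →L[ℝ] EuclideanSpace ℝ (Fin a) × ℝ =>
      L w) h1⟩
  rwa [hez] at key

/-- In a product chart, the canonical form is `s α`. -/
theorem pullbackForm_symplectizationForm (α : DForm (𝓡 a) K 1) {x₀ : K}
    {z : EuclideanSpace ℝ (Fin a) × ℝ} (hz : z.1 ∈ (extChartAt (𝓡 a) x₀).target) :
    (pullbackForm 𝓘(ℝ, EuclideanSpace ℝ (Fin a) × ℝ) ((𝓡 a).prod 𝓘(ℝ, ℝ)) (prodChartSymm x₀)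
      (symplectizationForm α) z : (EuclideanSpace ℝ (Fin a) × ℝ) [⋀^Fin 1]→L[ℝ] ℝ) =
      z.2 • (chartForm (𝓡 a) α x₀ z.1).compContinuousLinearMap
        (ContinuousLinearMap.fst ℝ (EuclideanSpace ℝ (Fin a)) ℝ) := by
  have h1 : pullbackForm 𝓘(ℝ, EuclideanSpace ℝ (Fin a) × ℝ) ((𝓡 a).prod 𝓘(ℝ, ℝ)) (prodChartSymm x₀)
      (symplectizationForm α) z = z.2 • pullbackForm 𝓘(ℝ, EuclideanSpace ℝ (Fin a) × ℝ)
        ((𝓡 a).prod 𝓘(ℝ, ℝ)) (prodChartSymm x₀)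
        (pullbackForm ((𝓡 a).prod 𝓘(ℝ, ℝ)) (𝓡 a) Prod.fst α) z := rfl
  rw [h1, ← pullbackForm_comp (g := Prod.fst) (f := prodChartSymm x₀) mdifferentiableAt_fst
    ((contMDiffAt_prodChartSymm hz).mdifferentiableAt (by simp))]
  have h2 := pullbackForm_comp (I := 𝓘(ℝ, EuclideanSpace ℝ (Fin a) × ℝ)) (x := z)
    (g := (extChartAt (𝓡 a) x₀).symm) (f := Prod.fst)
    ((contMDiffAt_extChartAt_symm_of_mem hz).mdifferentiableAt (by simp))
    (DifferentiableAt.mdifferentiableAt differentiableAt_fst) α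
  refine congrArg (fun A : (EuclideanSpace ℝ (Fin a) × ℝ) [⋀^Fin 1]→L[ℝ] ℝ => z.2 • A)
    (h2.trans ?_)
  rw [chartForm_eq_pullbackForm]
  ext v
  change (pullbackForm 𝓘(ℝ, EuclideanSpace ℝ (Fin a)) (𝓡 a) (extChartAt (𝓡 a) x₀).symm α z.1 :
    EuclideanSpace ℝ (Fin a) [⋀^Fin 1]→L[ℝ] ℝ) (fun i => mfderiv 𝓘(ℝ, EuclideanSpace ℝ (Fin a) × ℝ)
      𝓘(ℝ, EuclideanSpace ℝ (Fin a)) Prod.fst z (v i)) = _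
  rw [mfderiv_eq_fderiv, fderiv_fst]
  rfl

theorem isSmoothForm_symplectizationForm {α : DForm (𝓡 a) K 1} (hα : IsSmoothForm (𝓡 a) α) :
    IsSmoothForm ((𝓡 a).prod 𝓘(ℝ, ℝ)) (symplectizationForm α) := by
  rintro ⟨x₀, s₀⟩
  have htarget : (extChartAt ((𝓡 a).prod 𝓘(ℝ, ℝ)) (x₀, s₀)).target =
      (extChartAt (𝓡 a) x₀).target ×ˢ univ := by
    rw [extChartAt_prod]; simp [chartAt_self_eq]
  have hsymm : ((extChartAt ((𝓡 a).prod 𝓘(ℝ, ℝ)) (x₀, s₀)).symm :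
      EuclideanSpace ℝ (Fin a) × ℝ → K × ℝ) = prodChartSymm x₀ := by
    rw [extChartAt_prod]; rfl
  have heq : EqOn (chartForm ((𝓡 a).prod 𝓘(ℝ, ℝ)) (symplectizationForm α) (x₀, s₀))
      (fun z => z.2 • (chartForm (𝓡 a) α x₀ z.1).compContinuousLinearMap
        (ContinuousLinearMap.fst ℝ (EuclideanSpace ℝ (Fin a)) ℝ))
      (extChartAt ((𝓡 a).prod 𝓘(ℝ, ℝ)) (x₀, s₀)).target := by
    intro z hz
    rw [htarget] at hz
    rw [chartForm_eq_pullbackForm, hsymm]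
    exact pullbackForm_symplectizationForm α hz.1
  refine ContDiffOn.congr ?_ heq
  rw [htarget]
  refine contDiffOn_snd.smul ?_
  have h1 : ContDiffOn ℝ ∞ (fun z : EuclideanSpace ℝ (Fin a) × ℝ => chartForm (𝓡 a) α x₀ z.1)
      ((extChartAt (𝓡 a) x₀).target ×ˢ univ) :=
    (hα x₀).comp contDiffOn_fst fun z hz => hz.1
  let L : (EuclideanSpace ℝ (Fin a) [⋀^Fin 1]→L[ℝ] ℝ) →L[ℝ]
      (EuclideanSpace ℝ (Fin a) × ℝ) [⋀^Fin 1]→L[ℝ] ℝ :=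
    ContinuousAlternatingMap.compContinuousLinearMapCLM
      (ContinuousLinearMap.fst ℝ (EuclideanSpace ℝ (Fin a)) ℝ)
  have h2 : ContDiff ℝ ∞ L := by apply ContinuousLinearMap.contDiff
  exact h2.comp_contDiffOn h1

/-- `d(s α) = ds ∧ α + s dα` on the product of a vector space with the line. -/
theorem extDeriv_smul_comp_fst_apply {E : Type*} [NormedAddCommGroup E] [NormedSpace ℝ E]
    {β : E → E [⋀^Fin 1]→L[ℝ] ℝ} {u : E} (hβ : DifferentiableAt ℝ β u) (s : ℝ) (v w : E) (σ τ : ℝ) :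
    extDeriv (fun z : E × ℝ => z.2 • (β z.1).compContinuousLinearMap
      (ContinuousLinearMap.fst ℝ E ℝ)) (u, s) ![(v, σ), (w, τ)] =
      σ * β u ![w] - τ * β u ![v] + s * extDeriv β u ![v, w] := by
  have hβ1 : DifferentiableAt ℝ (fun z : E × ℝ => β z.1) (u, s) :=
    DifferentiableAt.comp (u, s) (g := β) (f := Prod.fst) hβ differentiableAt_fst
  have hd : DifferentiableAt ℝ (fun z : E × ℝ => z.2 • (β z.1).compContinuousLinearMap
      (ContinuousLinearMap.fst ℝ E ℝ)) (u, s) :=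
    differentiableAt_snd.fun_smul
      (hβ1.continuousAlternatingMapCompContinuousLinearMap (differentiableAt_const _))
  have hval : ∀ (z : E × ℝ) (w : E) (τ : ℝ), (z.2 • (β z.1).compContinuousLinearMap
      (ContinuousLinearMap.fst ℝ E ℝ)) ![(w, τ)] = z.2 * β z.1 ![w] := fun z w τ => by
    change z.2 * β z.1 (fun i => (![(w, τ)] i).1) = _
    congr 2
    funext i; fin_cases i; rfl
  have hder : ∀ (w v : E) (σ : ℝ), fderiv ℝ (fun z : E × ℝ => z.2 * β z.1 ![w]) (u, s) (v, σ) =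
      σ * β u ![w] + s * fderiv ℝ (fun y => β y ![w]) u v := fun w v σ => by
    have h1 : HasFDerivAt (fun y => β y ![w]) (fderiv ℝ (fun y => β y ![w]) u) u :=
      (hβ.continuousAlternatingMap_apply_const _).hasFDerivAt
    have h2 : HasFDerivAt (fun z : E × ℝ => β z.1 ![w]) _ (u, s) :=
      HasFDerivAt.comp (u, s) (g := fun y => β y ![w]) (f := Prod.fst) h1 hasFDerivAt_fst
    have h3 : HasFDerivAt (fun z : E × ℝ => z.2 * β z.1 ![w]) _ (u, s) := hasFDerivAt_snd.mul h2
    rw [h3.fderiv]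
    simp
    ring
  rw [extDeriv_apply hd, extDeriv_apply hβ, Fin.sum_univ_two, Fin.sum_univ_two]
  have e0 : (0 : Fin 2).removeNth ![(v, σ), (w, τ)] = ![(w, τ)] := by
    funext i; fin_cases i; rfl
  have e1 : (1 : Fin 2).removeNth ![(v, σ), (w, τ)] = ![(v, σ)] := by
    funext i; fin_cases i; rfl
  have e0' : (0 : Fin 2).removeNth ![v, w] = ![w] := by funext i; fin_cases i; rfl
  have e1' : (1 : Fin 2).removeNth ![v, w] = ![v] := by funext i; fin_cases i; rfl
  rw [e0, e1, e0', e1']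
  simp only [hval]
  simp [hder]
  ring

end Symplectization

/-! ### The disk map pulls the symplectic form back to that of the symplectization -/

section CompactificationForm

variable {n k : ℕ}
  {V : Type*} [TopologicalSpace V] [ChartedSpace (EuclideanSpace ℝ (Fin (2 * n + 2))) V]
  {W : Type*} [TopologicalSpace W] [ChartedSpace (EuclideanSpace ℝ (Fin (2 * n))) W]
  {F : Type*} [TopologicalSpace F] [ChartedSpace (EuclideanHalfSpace (2 * n + 2)) F]
  {K : Type*} [TopologicalSpace K] [ChartedSpace (EuclideanSpace ℝ (Fin (2 * n + 1))) K]
  [MulAction Circle K]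
  {Ω : DForm (𝓡 (2 * n + 2)) V 2} {ι : W → V} {lam : DForm (𝓡∂ (2 * n + 2)) F 1}
  {j : K → F} {p : K → W} {q : F → V} {Ψ : F → ℝ → F}
  [IsManifold (𝓡∂ (2 * n + 2)) ∞ F] [T2Space F]
  [IsManifold (𝓡 (2 * n + 2)) ∞ V] [IsManifold (𝓡 (2 * n + 1)) ∞ K]

/-- The backward flow from the boundary as a map on the symplectization: the level `s` is reached at
time `log s`. -/
def logFlow (j : K → F) (Ψ : F → ℝ → F) (x₀ : K) (z : EuclideanSpace ℝ (Fin (2 * n + 1)) × ℝ) : F :=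
  Ψ (j ((extChartAt (𝓡 (2 * n + 1)) x₀).symm z.1)) (Real.log z.2)

namespace IsLiouvilleCompactification

theorem contMDiffAt_logFlow (hF : IsLiouvilleCompactification k Ω ι lam j p q)
    (hΨ : IsBackwardSemiflow lam Ψ) {x₀ : K} {u : EuclideanSpace ℝ (Fin (2 * n + 1))}
    (hu : u ∈ (extChartAt (𝓡 (2 * n + 1)) x₀).target) {s : ℝ} (hs : s ∈ Ioo (0 : ℝ) 1) :
    ContMDiffAt 𝓘(ℝ, EuclideanSpace ℝ (Fin (2 * n + 1)) × ℝ) (𝓡∂ (2 * n + 2)) ∞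
      (logFlow j Ψ x₀) (u, s) := by
  refine ContMDiffAt.comp (u, s) (g := fun z : EuclideanSpace ℝ (Fin (2 * n + 1)) × ℝ =>
    Ψ (j ((extChartAt (𝓡 (2 * n + 1)) x₀).symm z.1)) z.2)
    (f := fun z : EuclideanSpace ℝ (Fin (2 * n + 1)) × ℝ => (z.1, Real.log z.2))
    (hF.contMDiffAt_flow hΨ hu (Real.log_neg hs.1 hs.2)) (ContDiffAt.contMDiffAt ?_)
  exact contDiffAt_fst.prodMk (contDiffAt_snd.log hs.1.ne')

/-- On the symplectization, the Liouville form is `s` times its restriction to the boundary: the flow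
to the level `s` takes time `log s` and rescales the form by `e^{log s}`. -/
theorem pullbackForm_logFlow (hF : IsLiouvilleCompactification k Ω ι lam j p q)
    (hΨ : IsBackwardSemiflow lam Ψ) {x₀ : K} {u : EuclideanSpace ℝ (Fin (2 * n + 1))}
    (hu : u ∈ (extChartAt (𝓡 (2 * n + 1)) x₀).target) {s : ℝ} (hs : s ∈ Ioo (0 : ℝ) 1) :
    (pullbackForm 𝓘(ℝ, EuclideanSpace ℝ (Fin (2 * n + 1)) × ℝ) (𝓡∂ (2 * n + 2)) (logFlow j Ψ x₀)
      lam (u, s) : (EuclideanSpace ℝ (Fin (2 * n + 1)) × ℝ) [⋀^Fin 1]→L[ℝ] ℝ) =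
    s • (chartForm (𝓡 (2 * n + 1)) (pullbackForm (𝓡 (2 * n + 1)) (𝓡∂ (2 * n + 2)) j lam)
      x₀ u).compContinuousLinearMap
        (ContinuousLinearMap.fst ℝ (EuclideanSpace ℝ (Fin (2 * n + 1))) ℝ) := by
  set κ := extChartAt (𝓡 (2 * n + 1)) x₀ with hκ
  have ht : Real.log s < 0 := Real.log_neg hs.1 hs.2
  have hj : MDifferentiableAt (𝓡 (2 * n + 1)) (𝓡∂ (2 * n + 2)) j (κ.symm u) :=
    (hF.boundary_embedding.contMDiff _).mdifferentiableAt (by simp)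
  have hκs : MDifferentiableAt 𝓘(ℝ, EuclideanSpace ℝ (Fin (2 * n + 1))) (𝓡 (2 * n + 1)) κ.symm u :=
    (contMDiffAt_extChartAt_symm_of_mem hu).mdifferentiableAt (by simp)
  have hc₀ : MDifferentiableAt 𝓘(ℝ, EuclideanSpace ℝ (Fin (2 * n + 1))) (𝓡∂ (2 * n + 2))
      (fun w => j (κ.symm w)) u := hj.comp u hκs
  have hchart : chartForm (𝓡 (2 * n + 1)) (pullbackForm (𝓡 (2 * n + 1)) (𝓡∂ (2 * n + 2)) j lam)
      x₀ u = (pullbackForm 𝓘(ℝ, EuclideanSpace ℝ (Fin (2 * n + 1))) (𝓡∂ (2 * n + 2))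
        (fun w => j (κ.symm w)) lam u : EuclideanSpace ℝ (Fin (2 * n + 1)) [⋀^Fin 1]→L[ℝ] ℝ) := by
    rw [chartForm_eq_pullbackForm]
    exact (pullbackForm_comp (g := j) (f := κ.symm) hj hκs lam).symm
  have hlog : HasFDerivAt (fun z : EuclideanSpace ℝ (Fin (2 * n + 1)) × ℝ => (z.1, Real.log z.2))
      _ (u, s) := hasFDerivAt_fst.prodMk
        ((hasFDerivAt_snd (𝕜 := ℝ) (p := (u, s))).log hs.1.ne')
  have hflow := hF.contMDiffAt_flow hΨ hu ht
  have hcomp := pullbackForm_comp (I := 𝓘(ℝ, EuclideanSpace ℝ (Fin (2 * n + 1)) × ℝ)) (x := (u, s))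
    (g := fun z : EuclideanSpace ℝ (Fin (2 * n + 1)) × ℝ => Ψ (j (κ.symm z.1)) z.2)
    (f := fun z : EuclideanSpace ℝ (Fin (2 * n + 1)) × ℝ => (z.1, Real.log z.2))
    (hflow.mdifferentiableAt (by simp)) hlog.differentiableAt.mdifferentiableAt lam
  refine Eq.trans hcomp ?_
  rw [hchart]
  ext v
  change (pullbackForm 𝓘(ℝ, EuclideanSpace ℝ (Fin (2 * n + 1)) × ℝ) (𝓡∂ (2 * n + 2))
    (fun z : EuclideanSpace ℝ (Fin (2 * n + 1)) × ℝ => Ψ (j (κ.symm z.1)) z.2) lam (u, Real.log s) :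
    (EuclideanSpace ℝ (Fin (2 * n + 1)) × ℝ) [⋀^Fin 1]→L[ℝ] ℝ) (fun i => mfderiv
      𝓘(ℝ, EuclideanSpace ℝ (Fin (2 * n + 1)) × ℝ) 𝓘(ℝ, EuclideanSpace ℝ (Fin (2 * n + 1)) × ℝ)
      (fun z : EuclideanSpace ℝ (Fin (2 * n + 1)) × ℝ => (z.1, Real.log z.2)) (u, s) (v i)) =
    s * (pullbackForm 𝓘(ℝ, EuclideanSpace ℝ (Fin (2 * n + 1))) (𝓡∂ (2 * n + 2))
        (fun w => j (κ.symm w)) lam u : EuclideanSpace ℝ (Fin (2 * n + 1)) [⋀^Fin 1]→L[ℝ] ℝ)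
        (fun i => (v i).1)
  rw [mfderiv_eq_fderiv, hlog.fderiv]
  have h2 : (2 : ℕ∞ω) ≤ ∞ := ENat.LEInfty.out
  have key := hΨ.pullbackForm_apply hF.liouville hc₀
    (fun t ht => (hF.contMDiffAt_flow hΨ hu ht).of_le h2) ht (v 0).1 (s⁻¹ * (v 0).2)
  rw [Real.exp_log hs.1] at key
  convert key using 2
  · funext i; fin_cases i; rfl
  · congr 1
    funext i; fin_cases i; rfl

theorem contMDiffAt_diskMap_sqrt (hF : IsLiouvilleCompactification k Ω ι lam j p q)
    (hΨ : IsBackwardSemiflow lam Ψ) (x : K) {s : ℝ} (hs : s ∈ Ioo (0 : ℝ) 1) :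
    ContMDiffAt ((𝓡 (2 * n + 1)).prod 𝓘(ℝ, ℝ)) (𝓡 (2 * n + 2)) ∞
      (fun y : K × ℝ => diskMap j q Ψ (y.1, (Real.sqrt (1 - y.2) : ℂ))) (x, s) := by
  have hs1 := hs.2
  have h1 : ContDiffAt ℝ ∞ (fun s : ℝ => (Real.sqrt (1 - s) : ℂ)) s :=
    Complex.ofRealCLM.contDiff.contDiffAt.comp _
      ((contDiffAt_const.sub contDiffAt_id).sqrt (by simp only [id]; linarith))
  have h2 : ContMDiffAt ((𝓡 (2 * n + 1)).prod 𝓘(ℝ, ℝ)) 𝓘(ℝ, ℂ) ∞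
      (fun y : K × ℝ => (Real.sqrt (1 - y.2) : ℂ)) (x, s) :=
    ContMDiffAt.comp (x, s) (g := fun s : ℝ => (Real.sqrt (1 - s) : ℂ)) (f := Prod.snd)
      h1.contMDiffAt contMDiffAt_snd
  refine ContMDiffAt.comp (x, s) (g := diskMap j q Ψ)
    (f := fun y : K × ℝ => (y.1, (Real.sqrt (1 - y.2) : ℂ))) (hF.contMDiffAt_diskMap hΨ _ ?_)
    (contMDiffAt_fst.prodMk h2)
  rw [Complex.norm_real, Real.norm_eq_abs, abs_of_nonneg (Real.sqrt_nonneg _), Real.sqrt_lt' one_pos]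
  linarith [hs.1]

/-- The disk map in the coordinates of the symplectization, `s = 1 - |z|^2`, pulls `Ω` back to the
canonical symplectic form. -/
theorem pullbackForm_diskMap_sqrt (hF : IsLiouvilleCompactification k Ω ι lam j p q)
    (hΨ : IsBackwardSemiflow lam Ψ) (x : K) {s : ℝ} (hs : s ∈ Ioo (0 : ℝ) 1) :
    pullbackForm ((𝓡 (2 * n + 1)).prod 𝓘(ℝ, ℝ)) (𝓡 (2 * n + 2))
      (fun y : K × ℝ => diskMap j q Ψ (y.1, (Real.sqrt (1 - y.2) : ℂ))) Ω (x, s) =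
    extD ((𝓡 (2 * n + 1)).prod 𝓘(ℝ, ℝ))
      (symplectizationForm (pullbackForm (𝓡 (2 * n + 1)) (𝓡∂ (2 * n + 2)) j lam)) (x, s) := by
  have h2 : (2 : ℕ∞ω) ≤ ∞ := ENat.LEInfty.out
  set αK := pullbackForm (𝓡 (2 * n + 1)) (𝓡∂ (2 * n + 2)) j lam with hαK
  set u := extChartAt (𝓡 (2 * n + 1)) x x with hu_def
  have hu : u ∈ (extChartAt (𝓡 (2 * n + 1)) x).target := mem_extChartAt_target x
  have hgz : prodChartSymm x (u, s) = (x, s) :=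
    Prod.ext ((extChartAt (𝓡 (2 * n + 1)) x).left_inv (mem_extChartAt_source x)) rfl
  have hg := contMDiffAt_prodChartSymm (z := (u, s)) hu
  have hΦ := hF.contMDiffAt_logFlow hΨ hu hs
  have hψ := hF.contMDiffAt_diskMap_sqrt hΨ x hs
  rw [← hgz] at hψ
  have hint : logFlow j Ψ x (u, s) ∈ (𝓡∂ (2 * n + 2)).interior F :=
    hΨ.interior _ _ (Real.log_neg hs.1 hs.2)
  let G₁ : EuclideanSpace ℝ (Fin (2 * n + 1)) × ℝ →
      (EuclideanSpace ℝ (Fin (2 * n + 1)) × ℝ) [⋀^Fin 1]→L[ℝ] ℝ := fun w =>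
    pullbackForm 𝓘(ℝ, EuclideanSpace ℝ (Fin (2 * n + 1)) × ℝ) (𝓡∂ (2 * n + 2))
      (logFlow j Ψ x) lam w
  let G₂ : EuclideanSpace ℝ (Fin (2 * n + 1)) × ℝ →
      (EuclideanSpace ℝ (Fin (2 * n + 1)) × ℝ) [⋀^Fin 1]→L[ℝ] ℝ := fun w =>
    pullbackForm 𝓘(ℝ, EuclideanSpace ℝ (Fin (2 * n + 1)) × ℝ) ((𝓡 (2 * n + 1)).prod 𝓘(ℝ, ℝ))
      (prodChartSymm x) (symplectizationForm αK) w
  have hψΦ : (fun z => diskMap j q Ψ ((prodChartSymm x z).1,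
      (Real.sqrt (1 - (prodChartSymm x z).2) : ℂ))) =ᶠ[𝓝 (u, s)] fun z => q (logFlow j Ψ x z) := by
    filter_upwards [(continuousAt_snd (p := (u, s))).eventually (Iio_mem_nhds hs.2)] with z hz
    exact diskMap_sqrt _ (le_of_lt hz)
  have hev : G₁ =ᶠ[𝓝 (u, s)] G₂ := by
    filter_upwards [(continuousAt_fst (p := (u, s))).eventually (extChartAt_target_mem_nhds' hu),
      (continuousAt_snd (p := (u, s))).eventually (Ioo_mem_nhds hs.1 hs.2)] with w hw1 hw2
    exact (hF.pullbackForm_logFlow hΨ hw1 hw2).trans (pullbackForm_symplectizationForm αK hw1).symm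
  have key : pullbackForm 𝓘(ℝ, EuclideanSpace ℝ (Fin (2 * n + 1)) × ℝ)
      ((𝓡 (2 * n + 1)).prod 𝓘(ℝ, ℝ)) (prodChartSymm x)
      (pullbackForm ((𝓡 (2 * n + 1)).prod 𝓘(ℝ, ℝ)) (𝓡 (2 * n + 2))
        (fun y : K × ℝ => diskMap j q Ψ (y.1, (Real.sqrt (1 - y.2) : ℂ))) Ω) (u, s) =
      pullbackForm 𝓘(ℝ, EuclideanSpace ℝ (Fin (2 * n + 1)) × ℝ)
        ((𝓡 (2 * n + 1)).prod 𝓘(ℝ, ℝ)) (prodChartSymm x)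
        (extD ((𝓡 (2 * n + 1)).prod 𝓘(ℝ, ℝ)) (symplectizationForm αK)) (u, s) := by
    have e1 := pullbackForm_comp (I := 𝓘(ℝ, EuclideanSpace ℝ (Fin (2 * n + 1)) × ℝ))
      (f := prodChartSymm x) (x := (u, s))
      (g := fun y : K × ℝ => diskMap j q Ψ (y.1, (Real.sqrt (1 - y.2) : ℂ)))
      (hψ.mdifferentiableAt (by simp)) (hg.mdifferentiableAt (by simp)) Ω
    have e2 := pullbackForm_congr (I := 𝓘(ℝ, EuclideanSpace ℝ (Fin (2 * n + 1)) × ℝ))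
      (I' := 𝓡 (2 * n + 2)) hψΦ Ω
    have e3 := pullbackForm_comp (I := 𝓘(ℝ, EuclideanSpace ℝ (Fin (2 * n + 1)) × ℝ))
      (f := logFlow j Ψ x) (x := (u, s)) (g := q)
      ((hF.contMDiffAt_collapse hint).mdifferentiableAt (by simp))
      (hΦ.mdifferentiableAt (by simp)) Ω
    have e4 := pullbackForm_congr_form (I := 𝓘(ℝ, EuclideanSpace ℝ (Fin (2 * n + 1)) × ℝ))
      (f := logFlow j Ψ x) (x := (u, s)) (hF.pullback_eq _ hint)
    have e5 := extDeriv_pullbackForm hF.liouville.smooth (hΦ.of_le h2)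
    have e6 := extDeriv_pullbackForm (isSmoothForm_symplectizationForm hF.connection.smooth)
      (hg.of_le h2)
    have e7 := hev.extDeriv_eq
    exact e1.symm.trans (e2.trans (e3.trans (e4.trans (e5.symm.trans (e7.trans e6)))))
  have hfin := eq_of_pullbackForm_eq (surjective_mfderiv_prodChartSymm (z := (u, s)) hu) key
  rwa [hgz] at hfin

end IsLiouvilleCompactification

end CompactificationForm

/-! ### The disk map is a submersion -/

theorem surjective_mfderiv_extChartAt_symm {a : ℕ}
    {K : Type*} [TopologicalSpace K] [ChartedSpace (EuclideanSpace ℝ (Fin a)) K]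
    [IsManifold (𝓡 a) ∞ K] {x₀ : K} {u : EuclideanSpace ℝ (Fin a)}
    (hu : u ∈ (extChartAt (𝓡 a) x₀).target) :
    Function.Surjective
      (mfderiv 𝓘(ℝ, EuclideanSpace ℝ (Fin a)) (𝓡 a) (extChartAt (𝓡 a) x₀).symm u) := by
  intro v
  have h := mfderivWithin_symm_mfderiv_extChartAt ((extChartAt (𝓡 a) x₀).map_target hu) v
  rw [(extChartAt (𝓡 a) x₀).right_inv hu, ModelWithCorners.range_eq_univ, mfderivWithin_univ] at h
  exact ⟨_, h⟩

section CompactificationSubmersion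

variable {n k : ℕ}
  {V : Type*} [TopologicalSpace V] [ChartedSpace (EuclideanSpace ℝ (Fin (2 * n + 2))) V]
  {W : Type*} [TopologicalSpace W] [ChartedSpace (EuclideanSpace ℝ (Fin (2 * n))) W]
  {F : Type*} [TopologicalSpace F] [ChartedSpace (EuclideanHalfSpace (2 * n + 2)) F]
  {K : Type*} [TopologicalSpace K] [ChartedSpace (EuclideanSpace ℝ (Fin (2 * n + 1))) K]
  [MulAction Circle K]
  {Ω : DForm (𝓡 (2 * n + 2)) V 2} {ι : W → V} {lam : DForm (𝓡∂ (2 * n + 2)) F 1}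
  {j : K → F} {p : K → W} {q : F → V} {Ψ : F → ℝ → F}

namespace IsLiouvilleCompactification

/-- The generator of the circle action: a vertical vector on which the connection form does not
vanish. -/
theorem exists_vertical (hF : IsLiouvilleCompactification k Ω ι lam j p q) (x : K) :
    ∃ Y : EuclideanSpace ℝ (Fin (2 * n + 1)),
      pullbackForm (𝓡 (2 * n + 1)) (𝓡∂ (2 * n + 2)) j lam x ![Y] ≠ 0 ∧
      mfderiv (𝓡 (2 * n + 1)) (𝓡 (2 * n)) p x Y = 0 := by
  suffices h : ∃ Y : EuclideanSpace ℝ (Fin (2 * n + 1)),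
      pullbackForm (𝓡 (2 * n + 1)) (𝓡∂ (2 * n + 2)) j lam (Circle.exp 0 • x) ![Y] ≠ 0 ∧
      mfderiv (𝓡 (2 * n + 1)) (𝓡 (2 * n)) p (Circle.exp 0 • x) Y = 0 by
    rwa [Circle.exp_zero, one_smul] at h
  refine ⟨mfderiv 𝓘(ℝ, ℝ) (𝓡 (2 * n + 1)) (fun θ : ℝ => Circle.exp θ • x) 0 (1 : ℝ), ?_, ?_⟩
  · intro h0
    have h := hF.connection.generator x
    rw [h0, mul_zero] at h
    exact zero_ne_one h
  · have hc : MDifferentiableAt 𝓘(ℝ, ℝ) (𝓡 (2 * n + 1)) (fun θ : ℝ => Circle.exp θ • x) 0 := by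
      have h1 : ContMDiff 𝓘(ℝ, ℝ) (𝓡 (2 * n + 1)) ∞ (fun θ : ℝ => Circle.exp θ • x) :=
        hF.bundle.smooth_action.comp ((contMDiff_circleExp (m := ∞)).prodMk contMDiff_const)
      exact (h1 0).mdifferentiableAt (by simp)
    have hp : MDifferentiableAt (𝓡 (2 * n + 1)) (𝓡 (2 * n)) p (Circle.exp 0 • x) :=
      (hF.bundle.smooth _).mdifferentiableAt (by simp)
    have h1 := mfderiv_comp (0 : ℝ) (g := p) (f := fun θ : ℝ => Circle.exp θ • x) hp hc
    have h2 : p ∘ (fun θ : ℝ => Circle.exp θ • x) = fun _ => p x :=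
      funext fun θ => ((hF.bundle.fibres x _).2 ⟨Circle.exp θ, rfl⟩).symm
    rw [h2, mfderiv_const] at h1
    exact (congrArg (fun L : ℝ →L[ℝ] EuclideanSpace ℝ (Fin (2 * n)) => L 1) h1).symm

/-- A vertical vector as in `exists_vertical`, in a chart of the circle bundle. -/
theorem exists_vertical_chart [IsManifold (𝓡 (2 * n + 1)) ∞ K]
    (hF : IsLiouvilleCompactification k Ω ι lam j p q) {x₀ : K}
    {u : EuclideanSpace ℝ (Fin (2 * n + 1))} (hu : u ∈ (extChartAt (𝓡 (2 * n + 1)) x₀).target) :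
    ∃ X : EuclideanSpace ℝ (Fin (2 * n + 1)),
      chartForm (𝓡 (2 * n + 1)) (pullbackForm (𝓡 (2 * n + 1)) (𝓡∂ (2 * n + 2)) j lam) x₀ u ![X] ≠ 0 ∧
      mfderiv 𝓘(ℝ, EuclideanSpace ℝ (Fin (2 * n + 1))) (𝓡 (2 * n))
        (fun w => p ((extChartAt (𝓡 (2 * n + 1)) x₀).symm w)) u X = 0 := by
  obtain ⟨y, hy, rfl⟩ : ∃ y ∈ (extChartAt (𝓡 (2 * n + 1)) x₀).source,
      extChartAt (𝓡 (2 * n + 1)) x₀ y = u :=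
    ⟨_, (extChartAt (𝓡 (2 * n + 1)) x₀).map_target hu, (extChartAt _ x₀).right_inv hu⟩
  obtain ⟨Y, hY, hpY⟩ := hF.exists_vertical y
  refine ⟨mfderiv (𝓡 (2 * n + 1)) 𝓘(ℝ, EuclideanSpace ℝ (Fin (2 * n + 1)))
    (extChartAt (𝓡 (2 * n + 1)) x₀) y Y, ?_, ?_⟩
  · refine fun h0 => hY ((chartForm_mfderiv (pullbackForm (𝓡 (2 * n + 1)) (𝓡∂ (2 * n + 2)) j lam)
      hy ![Y]).symm.trans (Eq.trans ?_ h0))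
    congr 1
    funext i; fin_cases i; rfl
  · have hsy : (extChartAt (𝓡 (2 * n + 1)) x₀).symm (extChartAt (𝓡 (2 * n + 1)) x₀ y) = y :=
      (extChartAt (𝓡 (2 * n + 1)) x₀).left_inv hy
    have h1 : MDifferentiableAt 𝓘(ℝ, EuclideanSpace ℝ (Fin (2 * n + 1))) (𝓡 (2 * n))
        (fun w => p ((extChartAt (𝓡 (2 * n + 1)) x₀).symm w)) (extChartAt (𝓡 (2 * n + 1)) x₀ y) :=
      ((hF.bundle.smooth.contMDiffAt).comp _
        (contMDiffAt_extChartAt_symm_of_mem hu)).mdifferentiableAt (by simp)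
    have h2 := mfderiv_comp y (g := fun w => p ((extChartAt (𝓡 (2 * n + 1)) x₀).symm w)) h1
      (mdifferentiableAt_extChartAt (I := 𝓡 (2 * n + 1)) (x := x₀) (by simpa using hy))
    have h3 : (fun w => p ((extChartAt (𝓡 (2 * n + 1)) x₀).symm w)) ∘ extChartAt (𝓡 (2 * n + 1)) x₀
        =ᶠ[𝓝 y] p := by
      filter_upwards [extChartAt_source_mem_nhds' hy] with y' hy'
      exact congrArg p ((extChartAt (𝓡 (2 * n + 1)) x₀).left_inv hy')
    have h4 : (mfderiv (𝓡 (2 * n + 1)) (𝓡 (2 * n)) ((fun w => p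
        ((extChartAt (𝓡 (2 * n + 1)) x₀).symm w)) ∘ extChartAt (𝓡 (2 * n + 1)) x₀) y :
        EuclideanSpace ℝ (Fin (2 * n + 1)) →L[ℝ] EuclideanSpace ℝ (Fin (2 * n))) =
        mfderiv (𝓡 (2 * n + 1)) (𝓡 (2 * n)) p y := h3.mfderiv_eq
    have h5 := congrArg (fun L : EuclideanSpace ℝ (Fin (2 * n + 1)) →L[ℝ]
      EuclideanSpace ℝ (Fin (2 * n)) => L Y) (h2.symm.trans h4)
    exact h5.trans hpY

/-- The kernel of the derivative of the circle bundle is a line, so the connection form is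
injective on it. -/
theorem eq_zero_of_vertical [IsManifold (𝓡 (2 * n + 1)) ∞ K]
    (hF : IsLiouvilleCompactification k Ω ι lam j p q) {x₀ : K}
    {u : EuclideanSpace ℝ (Fin (2 * n + 1))} (hu : u ∈ (extChartAt (𝓡 (2 * n + 1)) x₀).target)
    (hP : Function.Surjective (mfderiv 𝓘(ℝ, EuclideanSpace ℝ (Fin (2 * n + 1))) (𝓡 (2 * n))
        (fun w => p ((extChartAt (𝓡 (2 * n + 1)) x₀).symm w)) u))
    {v : EuclideanSpace ℝ (Fin (2 * n + 1))}
    (hv : mfderiv 𝓘(ℝ, EuclideanSpace ℝ (Fin (2 * n + 1))) (𝓡 (2 * n))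
        (fun w => p ((extChartAt (𝓡 (2 * n + 1)) x₀).symm w)) u v = 0)
    (hβ : chartForm (𝓡 (2 * n + 1)) (pullbackForm (𝓡 (2 * n + 1)) (𝓡∂ (2 * n + 2)) j lam) x₀ u ![v]
      = 0) : v = 0 := by
  obtain ⟨X, hX, hPX⟩ := hF.exists_vertical_chart hu
  set β := chartForm (𝓡 (2 * n + 1)) (pullbackForm (𝓡 (2 * n + 1)) (𝓡∂ (2 * n + 2)) j lam) x₀ u
  let P₁ : EuclideanSpace ℝ (Fin (2 * n + 1)) →L[ℝ] EuclideanSpace ℝ (Fin (2 * n)) :=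
    mfderiv 𝓘(ℝ, EuclideanSpace ℝ (Fin (2 * n + 1))) (𝓡 (2 * n))
      (fun w => p ((extChartAt (𝓡 (2 * n + 1)) x₀).symm w)) u
  let P : EuclideanSpace ℝ (Fin (2 * n + 1)) →ₗ[ℝ] EuclideanSpace ℝ (Fin (2 * n)) := P₁.toLinearMap
  have hX0 : X ≠ 0 := by
    rintro rfl
    exact hX (β.map_coord_zero 0 rfl)
  have hrank : Module.finrank ℝ (LinearMap.ker P) = 1 := by
    have h1 := LinearMap.finrank_range_add_finrank_ker P
    rw [LinearMap.range_eq_top.2 (show Function.Surjective P from hP), finrank_top,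
      finrank_euclideanSpace_fin, finrank_euclideanSpace_fin] at h1
    omega
  obtain ⟨c, hc⟩ := exists_smul_eq_of_finrank_eq_one hrank (x := ⟨X, hPX⟩)
    (fun h => hX0 (congrArg Subtype.val h)) ⟨v, hv⟩
  have hc' : c • X = v := congrArg Subtype.val hc
  have hsm : β ![c • X] = c * β ![X] := by
    have := β.map_update_smul ![X] 0 c X
    have e : ∀ x y : EuclideanSpace ℝ (Fin (2 * n + 1)),
        Function.update ![x] (0 : Fin 1) y = ![y] := fun x y => by
      funext i; fin_cases i; simp
    rw [e, e] at this
    exact this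
  rw [← hc', hsm] at hβ
  rw [← hc', (mul_eq_zero.1 hβ).resolve_right hX, zero_smul]

variable [IsManifold (𝓡∂ (2 * n + 2)) ∞ F] [T2Space F]
  [IsManifold (𝓡 (2 * n + 2)) ∞ V] [IsManifold (𝓡 (2 * n + 1)) ∞ K]

/-- Away from the zero section, the disk map is a submersion because the canonical form
of the symplectization is nondegenerate. -/
theorem surjective_mfderiv_diskMap_sqrt (hF : IsLiouvilleCompactification k Ω ι lam j p q)
    (hW : IsSymplecticForm (𝓡 (2 * n)) (pullbackForm (𝓡 (2 * n)) (𝓡 (2 * n + 2)) ι Ω))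
    (hΨ : IsBackwardSemiflow lam Ψ) {x₀ : K} {u : EuclideanSpace ℝ (Fin (2 * n + 1))}
    (hu : u ∈ (extChartAt (𝓡 (2 * n + 1)) x₀).target) {s : ℝ} (hs : s ∈ Ioo (0 : ℝ) 1) :
    Function.Surjective (mfderiv 𝓘(ℝ, EuclideanSpace ℝ (Fin (2 * n + 1)) × ℝ) (𝓡 (2 * n + 2))
      (fun z : EuclideanSpace ℝ (Fin (2 * n + 1)) × ℝ => diskMap j q Ψ
        ((prodChartSymm x₀ z).1, (Real.sqrt (1 - (prodChartSymm x₀ z).2) : ℂ))) (u, s)) := by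
  have h2 : (2 : ℕ∞ω) ≤ ∞ := ENat.LEInfty.out
  set αK := pullbackForm (𝓡 (2 * n + 1)) (𝓡∂ (2 * n + 2)) j lam with hαK
  set κ := extChartAt (𝓡 (2 * n + 1)) x₀ with hκ
  set β := chartForm (𝓡 (2 * n + 1)) αK x₀ with hβ_def
  have hg := contMDiffAt_prodChartSymm (z := (u, s)) hu
  have hψ := hF.contMDiffAt_diskMap_sqrt hΨ (κ.symm u) hs
  let L : EuclideanSpace ℝ (Fin (2 * n + 1)) × ℝ →L[ℝ] EuclideanSpace ℝ (Fin (2 * n + 2)) :=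
    mfderiv 𝓘(ℝ, EuclideanSpace ℝ (Fin (2 * n + 1)) × ℝ) (𝓡 (2 * n + 2))
      (fun z : EuclideanSpace ℝ (Fin (2 * n + 1)) × ℝ => diskMap j q Ψ
        ((prodChartSymm x₀ z).1, (Real.sqrt (1 - (prodChartSymm x₀ z).2) : ℂ))) (u, s)
  -- the pull-back of `Ω` in coordinates
  have hβ2 : DifferentiableAt ℝ β u :=
    ((hF.connection.smooth x₀).contDiffAt (extChartAt_target_mem_nhds' hu)).differentiableAt
      (by simp)
  have hform : (pullbackForm 𝓘(ℝ, EuclideanSpace ℝ (Fin (2 * n + 1)) × ℝ) (𝓡 (2 * n + 2))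
      (fun z : EuclideanSpace ℝ (Fin (2 * n + 1)) × ℝ => diskMap j q Ψ
        ((prodChartSymm x₀ z).1, (Real.sqrt (1 - (prodChartSymm x₀ z).2) : ℂ))) Ω (u, s) :
      (EuclideanSpace ℝ (Fin (2 * n + 1)) × ℝ) [⋀^Fin 2]→L[ℝ] ℝ) =
      extDeriv (fun z : EuclideanSpace ℝ (Fin (2 * n + 1)) × ℝ =>
        z.2 • (β z.1).compContinuousLinearMap
          (ContinuousLinearMap.fst ℝ (EuclideanSpace ℝ (Fin (2 * n + 1))) ℝ)) (u, s) := by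
    have e1 := pullbackForm_comp (I := 𝓘(ℝ, EuclideanSpace ℝ (Fin (2 * n + 1)) × ℝ))
      (f := prodChartSymm x₀) (x := (u, s))
      (g := fun y : K × ℝ => diskMap j q Ψ (y.1, (Real.sqrt (1 - y.2) : ℂ)))
      (hψ.mdifferentiableAt (by simp)) (hg.mdifferentiableAt (by simp)) Ω
    have e2 := pullbackForm_congr_form (I := 𝓘(ℝ, EuclideanSpace ℝ (Fin (2 * n + 1)) × ℝ))
      (f := prodChartSymm x₀) (x := (u, s)) (hF.pullbackForm_diskMap_sqrt hΨ (κ.symm u) hs)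
    have e3 := extDeriv_pullbackForm (isSmoothForm_symplectizationForm hF.connection.smooth)
      (hg.of_le h2)
    let G₁ : EuclideanSpace ℝ (Fin (2 * n + 1)) × ℝ →
        (EuclideanSpace ℝ (Fin (2 * n + 1)) × ℝ) [⋀^Fin 1]→L[ℝ] ℝ := fun w =>
      pullbackForm 𝓘(ℝ, EuclideanSpace ℝ (Fin (2 * n + 1)) × ℝ) ((𝓡 (2 * n + 1)).prod 𝓘(ℝ, ℝ))
        (prodChartSymm x₀) (symplectizationForm αK) w
    have hev : G₁ =ᶠ[𝓝 (u, s)] fun z => z.2 • (β z.1).compContinuousLinearMap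
          (ContinuousLinearMap.fst ℝ (EuclideanSpace ℝ (Fin (2 * n + 1))) ℝ) := by
      filter_upwards [(continuousAt_fst (p := (u, s))).eventually (extChartAt_target_mem_nhds' hu)]
        with w hw
      exact pullbackForm_symplectizationForm αK hw
    exact e1.trans (e2.trans (e3.symm.trans hev.extDeriv_eq))
  -- the derivative of the connection form
  have hκs := contMDiffAt_extChartAt_symm_of_mem hu
  have hdβ : extDeriv β u = (pullbackForm 𝓘(ℝ, EuclideanSpace ℝ (Fin (2 * n + 1))) (𝓡 (2 * n))
      (fun w => p (κ.symm w)) (pullbackForm (𝓡 (2 * n)) (𝓡 (2 * n + 2)) ι Ω) u :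
        EuclideanSpace ℝ (Fin (2 * n + 1)) [⋀^Fin 2]→L[ℝ] ℝ) := by
    have e1 : β = fun w => (pullbackForm 𝓘(ℝ, EuclideanSpace ℝ (Fin (2 * n + 1)))
        (𝓡 (2 * n + 1)) κ.symm αK w : EuclideanSpace ℝ (Fin (2 * n + 1)) [⋀^Fin 1]→L[ℝ] ℝ) :=
      funext fun w => chartForm_eq_pullbackForm αK x₀ w
    rw [e1, extDeriv_pullbackForm hF.connection.smooth (hκs.of_le h2), hF.curvature]
    exact (pullbackForm_comp (g := p) (f := κ.symm)
      ((hF.bundle.smooth _).mdifferentiableAt (by simp)) (hκs.mdifferentiableAt (by simp)) _).symm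
  have hPs : Function.Surjective (mfderiv 𝓘(ℝ, EuclideanSpace ℝ (Fin (2 * n + 1))) (𝓡 (2 * n))
      (fun w => p (κ.symm w)) u) := by
    have h1 := mfderiv_comp u (g := p) (f := κ.symm)
      ((hF.bundle.smooth _).mdifferentiableAt (by simp)) (hκs.mdifferentiableAt (by simp))
    change Function.Surjective (mfderiv 𝓘(ℝ, EuclideanSpace ℝ (Fin (2 * n + 1))) (𝓡 (2 * n))
      (p ∘ κ.symm) u)
    rw [h1]
    exact (hF.bundle.submersion _).comp (surjective_mfderiv_extChartAt_symm hu)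
  -- a vector `(v, σ)` in the kernel of `L` is in the kernel of `d(sβ)`; testing with the direction of
  -- `s`, with a vertical vector and with all vectors gives `β v = 0`, `σ = 0` and that `v` is vertical
  have hinj : Function.Injective L := by
    refine (injective_iff_map_eq_zero L).2 ?_
    rintro ⟨v, σ⟩ hv
    have h0 : ∀ w τ, σ * β u ![w] - τ * β u ![v] + s * extDeriv β u ![v, w] = 0 := fun w τ => by
      rw [← extDeriv_smul_comp_fst_apply hβ2, ← hform]
      change Ω _ (fun i => L (![(v, σ), (w, τ)] i)) = 0
      exact (Ω _).map_coord_zero 0 hv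
    have hβ0 : ∀ A : EuclideanSpace ℝ (Fin (2 * n + 1)) [⋀^Fin 2]→L[ℝ] ℝ, A ![v, 0] = 0 :=
      fun A => A.map_coord_zero 1 rfl
    have hβv : β u ![v] = 0 := by
      have h1 := h0 0 1
      rw [hβ0, (β u).map_coord_zero 0 rfl] at h1
      linarith
    have hd : ∀ w, extDeriv β u ![v, w] = pullbackForm (𝓡 (2 * n)) (𝓡 (2 * n + 2)) ι Ω
        (p (κ.symm u)) ![mfderiv 𝓘(ℝ, EuclideanSpace ℝ (Fin (2 * n + 1))) (𝓡 (2 * n))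
      (fun w => p (κ.symm w)) u v, mfderiv 𝓘(ℝ, EuclideanSpace ℝ (Fin (2 * n + 1))) (𝓡 (2 * n))
      (fun w => p (κ.symm w)) u w] := fun w => by
      rw [hdβ]
      change pullbackForm (𝓡 (2 * n)) (𝓡 (2 * n + 2)) ι Ω (p (κ.symm u)) (fun i => _) = _
      congr 1
      funext i; fin_cases i <;> rfl
    have hσ : σ = 0 := by
      obtain ⟨X, hX, hPX⟩ := hF.exists_vertical_chart hu
      have h1 := h0 X 0
      have h2 : extDeriv β u ![v, X] = 0 := by
        rw [hd]
        exact (pullbackForm (𝓡 (2 * n)) (𝓡 (2 * n + 2)) ι Ω _).map_coord_zero 1 hPX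
      rw [h2] at h1
      simp only [zero_mul, sub_zero, mul_zero, add_zero] at h1
      exact (mul_eq_zero.1 h1).resolve_right hX
    have hPv : mfderiv 𝓘(ℝ, EuclideanSpace ℝ (Fin (2 * n + 1))) (𝓡 (2 * n))
        (fun w => p (κ.symm w)) u v = 0 := by
      refine hW.nondegenerate _ _ fun w' => ?_
      obtain ⟨w, rfl⟩ := hPs w'
      have h1 := h0 w 0
      rw [hσ, zero_mul, hβv, mul_zero, sub_zero, zero_add] at h1
      exact (hd w).symm.trans ((mul_eq_zero.1 h1).resolve_left hs.1.ne')
    rw [hF.eq_zero_of_vertical hu hPs hPv hβv, hσ]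
    rfl
  have hfin : Module.finrank ℝ (EuclideanSpace ℝ (Fin (2 * n + 1)) × ℝ) =
      Module.finrank ℝ (EuclideanSpace ℝ (Fin (2 * n + 2))) := by simp
  exact (LinearMap.injective_iff_surjective_of_finrank_eq_finrank hfin (f := L.toLinearMap)).1 hinj

theorem surjective_mfderiv_diskMap_ofReal (hF : IsLiouvilleCompactification k Ω ι lam j p q)
    (hW : IsSymplecticForm (𝓡 (2 * n)) (pullbackForm (𝓡 (2 * n)) (𝓡 (2 * n + 2)) ι Ω))
    (hΨ : IsBackwardSemiflow lam Ψ) (x : K) {r : ℝ} (hr0 : 0 < r) (hr1 : r < 1) :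
    Function.Surjective (mfderiv ((𝓡 (2 * n + 1)).prod 𝓘(ℝ, ℂ)) (𝓡 (2 * n + 2)) (diskMap j q Ψ)
      (x, (r : ℂ))) := by
  obtain ⟨s, hs, rfl⟩ : ∃ s ∈ Ioo (0 : ℝ) 1, Real.sqrt (1 - s) = r :=
    ⟨1 - r ^ 2, ⟨by nlinarith, by nlinarith⟩, by rw [sub_sub_cancel, Real.sqrt_sq hr0.le]⟩
  set u := extChartAt (𝓡 (2 * n + 1)) x x with hu_def
  have hu : u ∈ (extChartAt (𝓡 (2 * n + 1)) x).target := mem_extChartAt_target x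
  let f : EuclideanSpace ℝ (Fin (2 * n + 1)) × ℝ → K × ℂ := fun z =>
    ((prodChartSymm x z).1, (Real.sqrt (1 - (prodChartSymm x z).2) : ℂ))
  have hfz : f (u, s) = (x, (Real.sqrt (1 - s) : ℂ)) :=
    Prod.ext ((extChartAt (𝓡 (2 * n + 1)) x).left_inv (mem_extChartAt_source x)) rfl
  have hs1 := hs.2
  have hsq : ContDiffAt ℝ ∞ (fun z : EuclideanSpace ℝ (Fin (2 * n + 1)) × ℝ =>
      (Real.sqrt (1 - z.2) : ℂ)) (u, s) :=
    Complex.ofRealCLM.contDiff.contDiffAt.comp _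
      ((contDiffAt_const.sub contDiffAt_snd).sqrt (by simp only; linarith))
  have hf : ContMDiffAt 𝓘(ℝ, EuclideanSpace ℝ (Fin (2 * n + 1)) × ℝ)
      ((𝓡 (2 * n + 1)).prod 𝓘(ℝ, ℂ)) ∞ f (u, s) :=
    (contMDiffAt_fst.comp (u, s) (contMDiffAt_prodChartSymm (z := (u, s)) hu)).prodMk
      hsq.contMDiffAt
  have h := surjective_mfderiv_of_comp (f := f) (x := (u, s)) (g := diskMap j q Ψ)
    (I := 𝓘(ℝ, EuclideanSpace ℝ (Fin (2 * n + 1)) × ℝ)) (I' := (𝓡 (2 * n + 1)).prod 𝓘(ℝ, ℂ))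
    (by
      rw [hfz]
      exact (hF.contMDiffAt_diskMap_ofReal hΨ x hr0 hr1).mdifferentiableAt (by simp))
    (hf.mdifferentiableAt (by simp)) (hF.surjective_mfderiv_diskMap_sqrt hW hΨ hu hs)
  rwa [hfz] at h

omit [IsManifold (𝓡∂ (2 * n + 2)) ∞ F] [T2Space F] [IsManifold (𝓡 (2 * n + 2)) ∞ V]
  [IsManifold (𝓡 (2 * n + 1)) ∞ K] in
/-- Along the zero section, the disk map is a submersion because its derivative in the direction of
the fibres spans the normal space. -/
theorem surjective_mfderiv_diskMap_zero (hF : IsLiouvilleCompactification k Ω ι lam j p q)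
    (hι : ContMDiff (𝓡 (2 * n)) (𝓡 (2 * n + 2)) ∞ ι)
    (hΨ : IsBackwardSemiflow lam Ψ) (x : K) :
    Function.Surjective (mfderiv ((𝓡 (2 * n + 1)).prod 𝓘(ℝ, ℂ)) (𝓡 (2 * n + 2)) (diskMap j q Ψ)
      (x, 0)) := by
  intro v
  obtain ⟨-, h⟩ := hF.collapse 1 (fun x t => Ψ (j x) t) one_pos
    (fun x => ⟨hΨ.zero _, (hΨ.integral (j x)).mono fun _ ht => ht.2⟩) x
  obtain ⟨a, z, v₁, v₂, hv, hv₁, hv₂⟩ := h v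
  obtain ⟨b, rfl⟩ := hF.bundle.submersion x a
  have hD : MDifferentiableAt ((𝓡 (2 * n + 1)).prod 𝓘(ℝ, ℂ)) (𝓡 (2 * n + 2)) (diskMap j q Ψ) (x, 0) :=
    (hF.contMDiffAt_diskMap_zero hΨ x).mdifferentiableAt (by simp)
  have hp : MDifferentiableAt (𝓡 (2 * n + 1)) (𝓡 (2 * n)) p x :=
    (hF.bundle.smooth x).mdifferentiableAt (by simp)
  have hi : MDifferentiableAt (𝓡 (2 * n + 1)) ((𝓡 (2 * n + 1)).prod 𝓘(ℝ, ℂ))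
      (fun x : K => (x, (0 : ℂ))) x := mdifferentiableAt_id.prodMk mdifferentiableAt_const
  let D : EuclideanSpace ℝ (Fin (2 * n + 1)) × ℂ →L[ℝ] EuclideanSpace ℝ (Fin (2 * n + 2)) :=
    mfderiv ((𝓡 (2 * n + 1)).prod 𝓘(ℝ, ℂ)) (𝓡 (2 * n + 2)) (diskMap j q Ψ) (x, 0)
  have hb : D (b, 0) = v₁ := by
    have h1 := mfderiv_comp x (g := diskMap j q Ψ) (f := fun x : K => (x, (0 : ℂ))) hD hi
    have h2 := mfderiv_comp x (g := ι) (f := p) ((hι _).mdifferentiableAt (by simp)) hp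
    have h3 : diskMap j q Ψ ∘ (fun x : K => (x, (0 : ℂ))) = ι ∘ p :=
      funext fun x => hF.diskMap_zero hΨ x
    have h4 : mfderiv (𝓡 (2 * n + 1)) ((𝓡 (2 * n + 1)).prod 𝓘(ℝ, ℂ))
      (fun x : K => (x, (0 : ℂ))) x = ContinuousLinearMap.inl ℝ _ _ := mfderiv_prod_left
    have h5 : D.comp (ContinuousLinearMap.inl ℝ (EuclideanSpace ℝ (Fin (2 * n + 1))) ℂ) =
        (mfderiv (𝓡 (2 * n + 1)) (𝓡 (2 * n + 2)) (ι ∘ p) x :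
          EuclideanSpace ℝ (Fin (2 * n + 1)) →L[ℝ] EuclideanSpace ℝ (Fin (2 * n + 2))) := by
      rw [← h3]
      rw [h4] at h1
      exact h1.symm
    have h6 := congrArg (fun L : EuclideanSpace ℝ (Fin (2 * n + 1)) →L[ℝ]
      EuclideanSpace ℝ (Fin (2 * n + 2)) => L b) (h5.trans h2)
    exact h6.trans hv₁.symm
  refine ⟨((b, z) : EuclideanSpace ℝ (Fin (2 * n + 1)) × ℂ), ?_⟩
  change D (b, z) = v
  have hsum : ∀ (b : EuclideanSpace ℝ (Fin (2 * n + 1))) (z : ℂ), D (b, z) = D (b, 0) + D (0, z) :=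
    fun b z => by rw [← map_add, Prod.mk_add_mk, add_zero, zero_add]
  exact (hsum b z).trans ((congrArg₂ (· + ·) hb hv₂.symm).trans hv.symm)

/-- The disk map is a submersion on the open unit disk bundle. -/
theorem surjective_mfderiv_diskMap (hF : IsLiouvilleCompactification k Ω ι lam j p q)
    (hι : ContMDiff (𝓡 (2 * n)) (𝓡 (2 * n + 2)) ∞ ι)
    (hW : IsSymplecticForm (𝓡 (2 * n)) (pullbackForm (𝓡 (2 * n)) (𝓡 (2 * n + 2)) ι Ω))
    (hΨ : IsBackwardSemiflow lam Ψ) (x : K) {z : ℂ} (hz : ‖z‖ < 1) :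
    Function.Surjective (mfderiv ((𝓡 (2 * n + 1)).prod 𝓘(ℝ, ℂ)) (𝓡 (2 * n + 2)) (diskMap j q Ψ)
      (x, z)) := by
  rcases eq_or_ne z 0 with rfl | hz0
  · exact hF.surjective_mfderiv_diskMap_zero hι hΨ x
  · -- rotate to a point of the positive real axis
    obtain ⟨g, hg⟩ := Circle.exists_inv_mul_eq_norm z
    let R : Circle → K × ℂ → K × ℂ := fun g y => (g • y.1, ((g⁻¹ : Circle) : ℂ) * y.2)
    have hR : R g⁻¹ (g • x, (‖z‖ : ℂ)) = (x, z) := by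
      rw [← hg]
      refine Prod.ext (inv_smul_smul g x) ?_
      change ((g⁻¹⁻¹ : Circle) : ℂ) * (((g⁻¹ : Circle) : ℂ) * z) = z
      rw [← mul_assoc, ← Circle.coe_mul, inv_mul_cancel, Circle.coe_one, one_mul]
    have h1 : (fun y => diskMap j q Ψ (R g⁻¹ y)) = diskMap j q Ψ :=
      funext fun y => hF.diskMap_smul hΨ g⁻¹ y.1 y.2
    have h := surjective_mfderiv_of_comp (I := (𝓡 (2 * n + 1)).prod 𝓘(ℝ, ℂ))
      (f := R g⁻¹) (x := (g • x, (‖z‖ : ℂ))) (g := diskMap j q Ψ)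
      (by
        rw [hR]
        exact (hF.contMDiffAt_diskMap hΨ x hz).mdifferentiableAt (by simp))
      ((hF.contMDiff_rotation g⁻¹ _).mdifferentiableAt (by simp))
      (by
        rw [h1]
        exact hF.surjective_mfderiv_diskMap_ofReal hW hΨ (g • x) (norm_pos_iff.2 hz0) hz)
    rwa [hR] at h

end IsLiouvilleCompactification

end CompactificationSubmersion

/-! ### Submersions are open maps -/

/-- A smooth map is open at the points where its derivative is surjective. -/
theorem map_nhds_eq_of_surjective_mfderiv {E : Type*} [NormedAddCommGroup E] [NormedSpace ℝ E]
    [CompleteSpace E] {H : Type*} [TopologicalSpace H] {I : ModelWithCorners ℝ E H} [I.Boundaryless]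
    {M : Type*} [TopologicalSpace M] [ChartedSpace H M] [IsManifold I ∞ M]
    {E' : Type*} [NormedAddCommGroup E'] [NormedSpace ℝ E'] [CompleteSpace E']
    {H' : Type*} [TopologicalSpace H'] {I' : ModelWithCorners ℝ E' H'} [I'.Boundaryless]
    {M' : Type*} [TopologicalSpace M'] [ChartedSpace H' M'] [IsManifold I' ∞ M']
    {f : M → M'} {x : M} (hf : ContMDiffAt I I' ∞ f x)
    (h : Function.Surjective (mfderiv I I' f x)) : Filter.map f (𝓝 x) = 𝓝 (f x) := by
  have hmd := hf.mdifferentiableAt (by simp)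
  have hg : ContDiffAt ℝ ∞ (writtenInExtChartAt I I' x f) (extChartAt I x x) := by
    have := (contMDiffAt_iff.1 hf).2
    rwa [ModelWithCorners.range_eq_univ, contDiffWithinAt_univ] at this
  have hs : HasStrictFDerivAt (writtenInExtChartAt I I' x f)
      (mfderiv I I' f x : E →L[ℝ] E') (extChartAt I x x) := by
    have h1 : (mfderiv I I' f x : E →L[ℝ] E') = fderivWithin ℝ (writtenInExtChartAt I I' x f)
      (range I) (extChartAt I x x) := hmd.mfderiv
    rw [ModelWithCorners.range_eq_univ, fderivWithin_univ] at h1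
    exact (hg.hasStrictFDerivAt (by simp)).congr_fderiv h1.symm
  have hmap := hs.map_nhds_eq_of_surj (LinearMap.range_eq_top.2 h)
  have hval : writtenInExtChartAt I I' x f (extChartAt I x x) = extChartAt I' (f x) (f x) := by
    simp [writtenInExtChartAt]
  have hsymm : Filter.map (extChartAt I' (f x)).symm (𝓝 (extChartAt I' (f x) (f x))) = 𝓝 (f x) := by
    have := map_extChartAt_symm_nhdsWithin_range (I := I') (f x)
    rwa [ModelWithCorners.range_eq_univ, nhdsWithin_univ] at this
  have hev : f =ᶠ[𝓝 x] fun y => (extChartAt I' (f x)).symm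
      (writtenInExtChartAt I I' x f (extChartAt I x y)) := by
    filter_upwards [extChartAt_source_mem_nhds (I := I) x,
      hf.continuousAt.eventually (extChartAt_source_mem_nhds (I := I') (f x))] with y hy hy'
    simp only [writtenInExtChartAt, Function.comp]
    rw [(extChartAt I x).left_inv hy, (extChartAt I' (f x)).left_inv hy']
  rw [Filter.map_congr hev]
  have h3 : (fun y => (extChartAt I' (f x)).symm
      (writtenInExtChartAt I I' x f (extChartAt I x y))) = (extChartAt I' (f x)).symm ∘
      writtenInExtChartAt I I' x f ∘ extChartAt I x := rfl
  rw [h3, ← Filter.map_map, ← Filter.map_map, map_extChartAt_nhds_of_boundaryless, hmap, hval, hsymm]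

/-! ### Multiples of forms -/

section Smul

variable {E : Type*} [NormedAddCommGroup E] [NormedSpace ℝ E]
  {H : Type*} [TopologicalSpace H] {I : ModelWithCorners ℝ E H}
  {M : Type*} [TopologicalSpace M] [ChartedSpace H M] {r : ℕ}

theorem chartForm_smul (c : ℝ) (Ω : DForm I M r) (x₀ : M) :
    chartForm I (c • Ω) x₀ = c • chartForm I Ω x₀ := rfl

theorem IsSmoothForm.smul {Ω : DForm I M r} (h : IsSmoothForm I Ω) (c : ℝ) :
    IsSmoothForm I (c • Ω) := fun x₀ => (h x₀).const_smul c

theorem extD_smul (c : ℝ) (Ω : DForm I M r) (x : M) : extD I (c • Ω) x = c • extD I Ω x := by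
  have h : extDerivWithin (c • chartForm I Ω x) (range I) (extChartAt I x x) =
      c • extDerivWithin (chartForm I Ω x) (range I) (extChartAt I x x) :=
    extDerivWithin_smul _ _ (I.uniqueDiffOn _ (mem_range_self _))
  rw [extD, chartForm_smul, h]
  rfl

theorem IsSymplecticForm.smul {Ω : DForm I M 2} (h : IsSymplecticForm I Ω) {c : ℝ} (hc : c ≠ 0) :
    IsSymplecticForm I (c • Ω) where
  smooth := h.smooth.smul c
  closed x := by rw [extD_smul, h.closed, smul_zero]
  nondegenerate x v hv := h.nondegenerate x v fun w => (mul_eq_zero.1 (hv w)).resolve_left hc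

theorem simplexIntegral_smul (c : ℝ) (Ω : DForm I M 2) (σ : ℝ × ℝ → M) :
    simplexIntegral I (c • Ω) σ = c * simplexIntegral I Ω σ := integral_const_mul c _

theorem HasIntegralPeriods.natCast_smul {Ω : DForm I M 2} (h : HasIntegralPeriods I Ω) (k : ℕ) :
    HasIntegralPeriods I ((k : ℝ) • Ω) := fun c hc hc0 => by
  obtain ⟨m, hm⟩ := h c hc hc0
  refine ⟨k * m, ?_⟩
  push_cast
  rw [← hm, Finsupp.mul_sum]
  refine Finsupp.sum_congr fun σ _ => ?_
  rw [simplexIntegral_smul]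
  ring

theorem symplectizationForm_smul {a : ℕ} {K : Type*} [TopologicalSpace K]
    [ChartedSpace (EuclideanSpace ℝ (Fin a)) K] (c : ℝ) (α : DForm (𝓡 a) K 1) :
    symplectizationForm (c • α) = c • symplectizationForm α := by
  funext y
  ext v
  exact mul_left_comm y.2 c _

end Smul

/-! ### Periods of the pull-back of a form -/

section Periods

/-- The boundary of chains commutes with push-forward. -/
theorem chainBoundary_mapDomain {M M' : Type*} (f : M → M') (c : (ℝ × ℝ → M) →₀ ℤ) :
    chainBoundary (c.mapDomain (f ∘ ·)) = (chainBoundary c).mapDomain (f ∘ ·) := by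
  unfold chainBoundary
  rw [Finsupp.sum_mapDomain_index, Finsupp.sum, Finsupp.sum, Finsupp.mapDomain_finsetSum]
  · refine Finset.sum_congr rfl fun σ _ => ?_
    change _ = Finsupp.mapDomain.addMonoidHom (f ∘ ·) _
    rw [map_add, map_sub]
    simp only [Finsupp.mapDomain.addMonoidHom_apply, Finsupp.mapDomain_single]
    rfl
  · intro σ; simp
  · intro σ m m'
    simp only [Finsupp.single_add]
    abel

variable {E : Type*} [NormedAddCommGroup E] [NormedSpace ℝ E]
  {H : Type*} [TopologicalSpace H] {I : ModelWithCorners ℝ E H}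
  {M : Type*} [TopologicalSpace M] [ChartedSpace H M]
  {E' : Type*} [NormedAddCommGroup E'] [NormedSpace ℝ E']
  {H' : Type*} [TopologicalSpace H'] {I' : ModelWithCorners ℝ E' H'}
  {M' : Type*} [TopologicalSpace M'] [ChartedSpace H' M']

theorem isClosed_stdTriangle : IsClosed stdTriangle :=
  (isClosed_le continuous_const continuous_fst).inter
    ((isClosed_le continuous_const continuous_snd).inter
      (isClosed_le (continuous_fst.add continuous_snd) continuous_const))

theorem uniqueDiffOn_stdTriangle : UniqueDiffOn ℝ stdTriangle := by
  refine uniqueDiffOn_convex ?_ ?_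
  · rintro ⟨a, b⟩ ⟨h1, h2, h3⟩ ⟨c, d⟩ ⟨h4, h5, h6⟩ s t hs ht hst
    simp only [stdTriangle, mem_ofPred_eq, Prod.smul_mk, Prod.mk_add_mk, smul_eq_mul] at *
    refine ⟨by positivity, by positivity, ?_⟩
    nlinarith
  · refine ⟨(1 / 4, 1 / 4), mem_interior.2 ⟨{p | 0 < p.1 ∧ 0 < p.2 ∧ p.1 + p.2 < 1}, ?_, ?_, ?_⟩⟩
    · exact fun p hp => ⟨hp.1.le, hp.2.1.le, hp.2.2.le⟩
    · exact (isOpen_lt continuous_const continuous_fst).inter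
        ((isOpen_lt continuous_const continuous_snd).inter
          (isOpen_lt (continuous_fst.add continuous_snd) continuous_const))
    · norm_num

theorem simplexIntegral_pullbackForm {f : M → M'} (hf : ContMDiff I I' ∞ f) (Ω : DForm I' M' 2)
    {σ : ℝ × ℝ → M} (hσ : ContMDiffOn 𝓘(ℝ, ℝ × ℝ) I ∞ σ stdTriangle) :
    simplexIntegral I (pullbackForm I I' f Ω) σ = simplexIntegral I' Ω (f ∘ σ) := by
  refine setIntegral_congr_fun isClosed_stdTriangle.measurableSet fun x hx => ?_
  have h1 : ∀ v : ℝ × ℝ, (mfderivWithin 𝓘(ℝ, ℝ × ℝ) I' (f ∘ σ) stdTriangle x v : E') =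
      mfderiv I I' f (σ x) (mfderivWithin 𝓘(ℝ, ℝ × ℝ) I σ stdTriangle x v) := fun v =>
    congrArg (fun L : ℝ × ℝ →L[ℝ] E' => L v)
      (mfderiv_comp_mfderivWithin x ((hf _).mdifferentiableAt (by simp))
        ((hσ x hx).mdifferentiableWithinAt (by simp))
        (uniqueDiffOn_stdTriangle x hx).uniqueMDiffWithinAt)
  change Ω (f (σ x)) _ = Ω (f (σ x)) _
  congr 1
  funext i
  fin_cases i
  · exact (h1 _).symm
  · exact (h1 _).symm

/-- Periods are natural. -/
theorem HasIntegralPeriods.pullbackForm {f : M → M'} (hf : ContMDiff I I' ∞ f) {Ω : DForm I' M' 2}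
    (h : HasIntegralPeriods I' Ω) : HasIntegralPeriods I (pullbackForm I I' f Ω) := by
  classical
  intro c hc hc0
  obtain ⟨m, hm⟩ := h (c.mapDomain (f ∘ ·)) (fun σ hσ => by
    obtain ⟨τ, hτ, rfl⟩ := Finset.mem_image.1 (Finsupp.mapDomain_support hσ)
    exact hf.comp_contMDiffOn (hc τ hτ)) (by rw [chainBoundary_mapDomain, hc0, Finsupp.mapDomain_zero])
  refine ⟨m, ?_⟩
  rw [← hm, Finsupp.sum_mapDomain_index (by simp) (by intro σ m m'; push_cast; ring)]
  refine Finsupp.sum_congr fun σ hσ => ?_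
  rw [simplexIntegral_pullbackForm hf Ω (hc σ hσ)]

end Periods

end

theorem mainTheorem8 (n k : ℕ) (hk : 1 ≤ k)
    (V : Type u) [TopologicalSpace V] [T2Space V] [CompactSpace V]
    [ChartedSpace (EuclideanSpace ℝ (Fin (2 * n + 2))) V] [IsManifold (𝓡 (2 * n + 2)) ∞ V]
    (Ω : DForm (𝓡 (2 * n + 2)) V 2)
    (hΩ : IsSymplecticForm (𝓡 (2 * n + 2)) Ω) (hper : HasIntegralPeriods (𝓡 (2 * n + 2)) Ω)
    (W : Type u) [TopologicalSpace W] [T2Space W] [CompactSpace W]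
    [ChartedSpace (EuclideanSpace ℝ (Fin (2 * n))) W] [IsManifold (𝓡 (2 * n)) ∞ W]
    (ι : W → V) (hW : IsSymplecticHyperplaneSection k Ω ι)
    (F : Type u) [TopologicalSpace F] [T2Space F] [CompactSpace F]
    [ChartedSpace (EuclideanHalfSpace (2 * n + 2)) F] [IsManifold (𝓡∂ (2 * n + 2)) ∞ F]
    (lam : DForm (𝓡∂ (2 * n + 2)) F 1)
    (K : Type u) [TopologicalSpace K]
    [ChartedSpace (EuclideanSpace ℝ (Fin (2 * n + 1))) K] [IsManifold (𝓡 (2 * n + 1)) ∞ K]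
    [MulAction Circle K]
    (j : K → F) (p : K → W) (q : F → V)
    (hF : IsLiouvilleCompactification k Ω ι lam j p q) :
    IsClosed (q '' skeleton lam) ∧
    IsNullSubset (d := 2 * n + 2) (q '' skeleton lam) ∧
    IsStandardDiskBundle k Ω (q '' skeleton lam)ᶜ
      ((k : ℝ) • pullbackForm (𝓡 (2 * n)) (𝓡 (2 * n + 2)) ι Ω) ι := by
  obtain ⟨Ψ, hΨ⟩ := exists_isBackwardSemiflow hF.liouville
  have hι : ContMDiff (𝓡 (2 * n)) (𝓡 (2 * n + 2)) ∞ ι := hW.embedding.contMDiff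
  have hk0 : (k : ℝ) ≠ 0 := by exact_mod_cast Nat.one_le_iff_ne_zero.1 hk
  have himg := hF.image_diskMap hΨ
  -- the complement of the image of the skeleton is the image of an open set by a submersion
  have hclosed : IsClosed (q '' skeleton lam) := by
    rw [← isOpen_compl_iff, ← himg, isOpen_iff_mem_nhds]
    rintro _ ⟨⟨x, z⟩, ⟨-, hz⟩, rfl⟩
    have hz' : ‖z‖ < 1 := by simpa using hz
    rw [← map_nhds_eq_of_surjective_mfderiv (hF.contMDiffAt_diskMap hΨ x hz')
      (hF.surjective_mfderiv_diskMap hι hW.symplectic hΨ x hz')]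
    exact Filter.image_mem_map (prod_mem_nhds Filter.univ_mem (Metric.isOpen_ball.mem_nhds hz))
  -- `K` is a compact Hausdorff space because it is embedded onto the boundary of `F`
  have hjK : IsClosed (range j) := by
    rw [hF.boundary_range]
    exact (𝓡∂ (2 * n + 2)).isClosed_boundary (n := ∞) (by simp)
  have hT2 : T2Space K := hF.boundary_embedding.isEmbedding.t2Space
  have hcpt : CompactSpace K :=
    (Topology.IsClosedEmbedding.mk hF.boundary_embedding.isEmbedding hjK).compactSpace
  have hWper := hper.pullbackForm hι
  -- the connection form of the disk bundle is `k` times the restriction of the Liouville form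
  refine ⟨hclosed, hF.isNullSubset_image_skeleton hΩ hΨ hclosed.isCompact, inferInstance,
    hW.symplectic.smul hk0, hWper.natCast_smul k, ?_, K, inferInstance, hT2, hcpt, inferInstance,
    inferInstance, inferInstance, p,
    (k : ℝ) • pullbackForm (𝓡 (2 * n + 1)) (𝓡∂ (2 * n + 2)) j lam, diskMap j q Ψ, hF.bundle,
    ⟨hF.connection.smooth.smul _, fun g => ?_, fun x => ?_⟩, ?_, ?_, ?_, ?_, himg,
    hF.diskMap_zero hΨ, ?_⟩
  · rwa [smul_smul, one_div, inv_mul_cancel₀ hk0, one_smul]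
  · rw [pullbackForm_smul, hF.connection.invariant g]
  · have h1 : ∀ A : ℝ, -2 * Real.pi * 1 * (k * A) = -2 * Real.pi * k * A := fun A => by ring
    exact (h1 _).trans (hF.connection.generator x)
  · funext x
    rw [extD_smul, hF.curvature]
    rfl
  · rintro ⟨x, z⟩ ⟨-, hz⟩
    exact (hF.contMDiffAt_diskMap hΨ x (by simpa using hz)).contMDiffWithinAt
  · rintro ⟨x, z⟩ ⟨-, hz⟩
    exact hF.surjective_mfderiv_diskMap hι hW.symplectic hΨ x (by simpa using hz)
  · exact fun x y z w hz hw =>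
      hF.diskMap_eq_iff hW.embedding.isEmbedding.injective hΨ x y hz hw
  · rintro ⟨x, s⟩ ⟨-, hs⟩
    rw [hF.pullbackForm_diskMap_sqrt hΨ x hs]
    rw [symplectizationForm_smul, extD_smul, smul_smul, one_div, inv_mul_cancel₀ hk0, one_smul]
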